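/- Let $\mathbb T=\mathbb R/\mathbb Z$, and let $|x|=\sqrt{|x_0|}+|x_1|$ for $x=(x_0,x_1)\in\mathbb R\times\mathbb T$, where $|x_1|$ is the distance of $x_1$ to $0$ in $\mathbb T$. Let $\mathcal Q:\mathbb R\to\mathbb R$ be an even polynomial of degree $2n\ge 4$ with $\mathcal Q(0)=0$, $\mathcal Q(r)>0$ for $r\neq 0$, and quadratic coefficient $1$. For $\varepsilon\in(0,1]$ let $\mathcal L_\varepsilon=-\varepsilon^{-2}\mathcal Q(i\varepsilon\partial_{1})$, i.e. $\widehat{\mathcal L_\varepsilon f}(k)=-\varepsilon^{-2}\mathcal Q(-2\pi\varepsilon k)\widehat f(k)$ for $k\in\mathbb Z$, and let $\mathcal L_0=\partial_{1}^2$. Write $-q_\varepsilon(k)$ for the Fourier multiplier of $\mathcal L_\varepsilon$, and for $\varepsilon\in[0,1]$ let $$P_\varepsilon(x_0,x_1)=\mathbf 1_{x_0>0}\sum_{k\in\mathbb Z}e^{-q_\varepsilon(k)x_0}e^{2\pi i k x_1}.$$ Then for every $\varepsilon\in[0,1]$, $P_\varepsilon$ is the Green's function of $\partial_0-\mathcal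 L_\varepsilon$ on $\mathbb R\times\mathbb T$ (it is locally integrable, vanishes for $x_0<0$ and satisfies $(\partial_0-\mathcal L_\varepsilon)P_\varepsilon=\delta_0$ in the sense of distributions), it is smooth on $(\mathbb R\times\mathbb T)\setminus\{0\}$, and there are functions $K_\varepsilon,R_\varepsilon:\mathbb R\times\mathbb T\to\mathbb R$, both vanishing for $x_0<0$ and both even in $x_1$, with $$P_\varepsilon=K_\varepsilon+R_\varepsilon,$$ such that $K_\varepsilon$ is supported in $[0,1]\times\mathbb T$ and smooth away from $0$, and $R_\varepsilon$ is smooth uniformly in $\varepsilon$: each $R_\varepsilon$ is smooth and $\sup_{\varepsilon\in[0,1]}\sup_{x}|\partial_0^m\partial_1^\ell R_\varepsilon(x)|<\infty$ for all $m,\ell\in\mathbb N$. Moreover the following bounds hold, where $f'=\partial_1 f$, and where the constants $C$ may depend on $\mathcal Q$ and on the parameters $\ell,c,\delta$ but not on $\varepsilon\in[0,1]$ or on the points $x,y\in\mathbb R\times\mathbb T$. 1. For every $\ell\ge 1$ and all $x\ne 0$, $|\partial_1^\ell P_\varepsilon(x)|\le C|x|^{-\ell-1}$; for $\ell=0$,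 $|P_\varepsilon(x)|\le C(1+|x|^{-1})$ for all $x\neq0$. 2. For every $\ell\ge 0$ and $c>0$, and all $x\neq 0$ with $|x|\ge c\,\varepsilon$, $|\partial_0\partial_1^\ell P_\varepsilon(x)|\le C|x|^{-\ell-3}$. 3. For every $\delta\in(0,1)$ and all $x\neq0$, $|P_\varepsilon'(x)-P_0'(x)|\le C\varepsilon^\delta|x|^{-2-\delta}$. 4. For every $\delta\in[0,1]$ and all $x,y$ with $y\ne0$ and $x\neq y$, $$|P_\varepsilon'(x-y)-P_\varepsilon'(-y)|\le C\begin{cases}|y|^{-2}, & |x|\ge 2|y|,\\ |x-y|^{-2}, & |x-y|\le |y|/2,\\ \mathbf 1_{|y|<\varepsilon}|y|^{-2}+\mathbf 1_{|y|\ge\varepsilon}|x|^\delta|y|^{-2-\delta}, & \text{otherwise.}\end{cases}$$ All these bounds also hold with $K_\varepsilon$ (and $K_0$) in place of $P_\varepsilon$ (and $P_0$), and for $K_\varepsilon$ the bound in 1 with $\ell=0$ holds in the form $|K_\varepsilon(x)|\le C|x|^{-1}$. -/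

import Mathlib

open scoped ContDiff

noncomputable section

/-- Space-time `ℝ × 𝕋`, where `𝕋 = ℝ / ℤ`. -/
abbrev SpaceTime : Type := ℝ × UnitAddCircle

/-- The parabolic size `|(x₀, x₁)| = √|x₀| + |x₁|`, where `|x₁|` is the distance of `x₁` to `0`
on the circle. -/
def parSize (x : SpaceTime) : ℝ := √|x.1| + ‖x.2‖

/-- The lift of a function on `ℝ × 𝕋` to a function on `ℝ × ℝ`, periodic in the second variable. -/
def spaceLift (f : SpaceTime → ℝ) : ℝ × ℝ → ℝ := fun p => f (p.1, (p.2 : UnitAddCircle))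

/-- `f` is smooth on `ℝ × 𝕋`. -/
def IsSmooth (f : SpaceTime → ℝ) : Prop := ContDiff ℝ ∞ (spaceLift f)

/-- `f` is smooth on `(ℝ × 𝕋) \ {0}`. -/
def IsSmoothOffOrigin (f : SpaceTime → ℝ) : Prop :=
  ContDiffOn ℝ ∞ (spaceLift f) {p | ((p.1, (p.2 : UnitAddCircle)) : SpaceTime) ≠ 0}

/-- The time derivative `∂₀`. -/
def timeDeriv (f : SpaceTime → ℝ) : SpaceTime → ℝ :=
  fun x => deriv (fun s : ℝ => f (s, x.2)) x.1

/-- The spatial derivative `∂₁`. -/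
def spaceDeriv (f : SpaceTime → ℝ) : SpaceTime → ℝ :=
  fun x => deriv (fun s : ℝ => f (x.1, x.2 + (s : UnitAddCircle))) 0

/-- The mixed derivative `∂₀ᵐ ∂₁ˡ f`. -/
def mixedDeriv (m l : ℕ) (f : SpaceTime → ℝ) : SpaceTime → ℝ :=
  timeDeriv^[m] (spaceDeriv^[l] f)

/-- `Q` is an even polynomial of degree at least `4`, positive except for `Q(0) = 0`, whose
quadratic coefficient is `1`. (The degree of an even polynomial is automatically even.) -/
structure IsAdmissible (Q : Polynomial ℝ) : Prop where
  even : ∀ r : ℝ, Q.eval (-r) = Q.eval r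
  eval_zero : Q.eval 0 = 0
  pos : ∀ r : ℝ, r ≠ 0 → 0 < Q.eval r
  four_le_natDegree : 4 ≤ Q.natDegree
  coeff_two : Q.coeff 2 = 1

/-- The operator `L_ε = -ε⁻² Q(i ε ∂₁)` for `ε ≠ 0`, and `L_0 = ∂₁²`. Only even powers of `∂₁`
occur for even `Q`, so that taking real parts of the coefficients changes nothing. -/
def opL (Q : Polynomial ℝ) (ε : ℝ) (f : SpaceTime → ℝ) : SpaceTime → ℝ :=
  fun x =>
    if ε = 0 then mixedDeriv 0 2 f x
    else -(ε ^ 2)⁻¹ * ∑ j ∈ Finset.range (Q.natDegree + 1),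
      Q.coeff j * ((Complex.I * (ε : ℂ)) ^ j).re * mixedDeriv 0 j f x

/-- `-symbolL Q ε k` is the Fourier multiplier of `L_ε`: it equals `-ε⁻² Q(-2π ε k)` for `ε ≠ 0`
and `-(2π k)²` for `ε = 0`. -/
def symbolL (Q : Polynomial ℝ) (ε : ℝ) (k : ℤ) : ℝ :=
  if ε = 0 then (2 * Real.pi * k) ^ 2 else (ε ^ 2)⁻¹ * Q.eval (-(2 * Real.pi * ε * k))

/-- The Green's function `P_ε` of `∂₀ - L_ε` on `ℝ × 𝕋`, that is, the kernel of the semigroup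
`exp (t L_ε)` for `t > 0`, extended by `0` to `t ≤ 0`. -/
def greenP (Q : Polynomial ℝ) (ε : ℝ) : SpaceTime → ℝ :=
  fun x =>
    if 0 < x.1 then
      (∑' k : ℤ, (Real.exp (-(symbolL Q ε k * x.1)) : ℂ) * fourier k x.2).re
    else 0

/-- `G` vanishes at negative times. -/
def IsNonAnticipative (G : SpaceTime → ℝ) : Prop := ∀ x : SpaceTime, x.1 < 0 → G x = 0

/-- `G` is symmetric in the spatial variable. -/
def IsSpaceSymmetric (G : SpaceTime → ℝ) : Prop :=
  ∀ (t : ℝ) (y : UnitAddCircle), G (t, -y) = G (t, y)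

/-- `G` is a retarded fundamental solution of `∂₀ - L`: it vanishes at negative times and
`(∂₀ - L) G = δ₀` in the sense of distributions on `ℝ × 𝕋`. Here `L` is a formally self-adjoint
differential operator in the spatial variable. -/
structure IsGreenFunction (L : (SpaceTime → ℝ) → SpaceTime → ℝ) (G : SpaceTime → ℝ) : Prop where
  nonAnticipative : IsNonAnticipative G
  locallyIntegrable : MeasureTheory.LocallyIntegrable G
  weak_eq : ∀ φ : SpaceTime → ℝ, IsSmooth φ → HasCompactSupport φ →
    ∫ x, G x * (-(timeDeriv φ x) - L φ x) = φ 0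

/-- `|∂₀ᵐ ∂₁ˡ G_ε(x)| ≤ C |x|^{-2m-l-1}` for all `ε ∈ [0,1]` and all `x ≠ 0` with `|x| ≥ c ε`. -/
def DerivBound (G : ℝ → SpaceTime → ℝ) (m l : ℕ) (c : ℝ) : Prop :=
  ∃ C : ℝ, ∀ ε ∈ Set.Icc (0 : ℝ) 1, ∀ x : SpaceTime, x ≠ 0 → c * ε ≤ parSize x →
    |mixedDeriv m l (G ε) x| ≤ C * (parSize x ^ (2 * m + l + 1))⁻¹

/-- `|G_ε'(x) - G_0'(x)| ≤ C ε^δ |x|^{-2-δ}` for all `ε ∈ [0,1]` and all `x ≠ 0`. -/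
def ComparisonBound (G : ℝ → SpaceTime → ℝ) (δ : ℝ) : Prop :=
  ∃ C : ℝ, ∀ ε ∈ Set.Icc (0 : ℝ) 1, ∀ x : SpaceTime, x ≠ 0 →
    |mixedDeriv 0 1 (G ε) x - mixedDeriv 0 1 (G 0) x| ≤ C * (ε ^ δ * parSize x ^ (-2 - δ))

/-- The right-hand side of the increment bound. -/
def incrementRHS (δ ε : ℝ) (x y : SpaceTime) : ℝ :=
  if 2 * parSize y ≤ parSize x then (parSize y ^ 2)⁻¹
  else if parSize (x - y) ≤ parSize y / 2 then (parSize (x - y) ^ 2)⁻¹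
  else if parSize y < ε then (parSize y ^ 2)⁻¹
  else parSize x ^ δ * parSize y ^ (-2 - δ)

/-- The increment bound on `|G_ε'(x - y) - G_ε'(-y)|`, uniformly in `ε ∈ [0,1]` and in all
`x, y` with `y ≠ 0` and `x ≠ y`. -/
def IncrementBound (G : ℝ → SpaceTime → ℝ) (δ : ℝ) : Prop :=
  ∃ C : ℝ, ∀ ε ∈ Set.Icc (0 : ℝ) 1, ∀ x y : SpaceTime, y ≠ 0 → x ≠ y →
    |mixedDeriv 0 1 (G ε) (x - y) - mixedDeriv 0 1 (G ε) (-y)| ≤ C * incrementRHS δ ε x y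

end

open scoped ContDiff

open Polynomial MeasureTheory

noncomputable section

/-! Everything reduces to the series `∑ₖ p(k) e^{-q(k)t} e^{2πikx}` with polynomials `p` and `q`
(`expSeries q p`), since a time or space derivative only multiplies `p(k)` by `-q(k)` or by `2πik`.
The symbol of `L_ε` is `q_ε(x) = (2πx)² S(2πεx)`, where `S(r) = Q(r)/r²` is positive, also at `0`.
Hence `S` dominates the sum of the absolute values of its monomials, and `q_ε` inherits this by
dilation with the same constant (`IsAdmissible.exists_isSymbol`). Uniformity in `ε` is then
automatic: the estimates are proved for the class `IsSymbol d M`, with constants that do not depend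
on the symbol.

Decay in space comes from summation by parts, as `|e^{-2πix} - 1| ≥ 4‖x‖`. The `(L+1)`-st difference
of `k^L e^{-q(k)t}` is at most a multiple of `|k|⁻¹ W e^{-cW}` for large `|k|`, where `W` is `t`
times the absolute-value polynomial of `q` at `|k|`. The sum of these terms is a Riemann sum for `∫
e^{-cw} dw`, bounded whatever `t` and `q` are (`sum_range_div_mul_exp_le`). Decay in time uses `q(k)
≥ k²/M` and the same Riemann sum. Together they give the parabolic bound `exists_norm_expSeries_le`.
In `q_ε` the powers of `k` above the second carry matching powers of `ε`, which `|x| ≥ cε` turns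
into powers of `|x|` (`exists_norm_expSeries_le_of_coeff`); this gives the bound on the time
derivative. The comparison with `ε = 0` differentiates along a path of symbols joining `q_0` to
`q_ε` (`norm_expSeries_sub_le`). The increment bound is the mean value theorem along a time segment
followed by a space segment (`incrementBound_of_derivBound`).

Off the origin every such series tends to `0` as `t ↓ 0`, and so do its time derivatives, which are
series of the same kind. Extension by zero to negative times is therefore smooth off the origin
(`contDiffOn_expKernel`). A smooth cutoff in time splits off `R_ε`, which lives at times `t ≥ 1/2`,
where exponential decay controls all derivatives. The equation for `P_ε` is checked mode by mode in
space: each mode is an exact time derivative, and summing the boundary values at `t = 0` gives the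
Fourier series of the test function at the origin (`IsAdmissible.weak_eq`). -/

/-! ### Polynomials with absolute values of coefficients -/

/-- The polynomial whose coefficients are the absolute values of those of `p`. -/
def absPoly (p : ℝ[X]) : ℝ[X] := ∑ i ∈ p.support, monomial i |p.coeff i|

/-- The value at `r` of the polynomial with the absolute values of the coefficients of `p`. -/
def absEval (p : ℝ[X]) (r : ℝ) : ℝ := (absPoly p).eval r

lemma coeff_absPoly (p : ℝ[X]) (i : ℕ) : (absPoly p).coeff i = |p.coeff i| := by
  simp only [absPoly, finsetSum_coeff, coeff_monomial]
  rw [Finset.sum_ite_eq' p.support i]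
  split_ifs with h
  · rfl
  · simp [notMem_support_iff.1 h]

lemma eval_le_eval_of_coeff_le {p q : ℝ[X]} (h : ∀ i, p.coeff i ≤ q.coeff i) {r : ℝ}
    (hr : 0 ≤ r) : p.eval r ≤ q.eval r := by
  have hp : p.natDegree < max p.natDegree q.natDegree + 1 := by omega
  have hq : q.natDegree < max p.natDegree q.natDegree + 1 := by omega
  rw [eval_eq_sum_range' hp, eval_eq_sum_range' hq]
  exact Finset.sum_le_sum fun i _ => mul_le_mul_of_nonneg_right (h i) (pow_nonneg hr i)

lemma absEval_eq_sum {p : ℝ[X]} {n : ℕ} (hn : p.natDegree < n) (r : ℝ) :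
    absEval p r = ∑ i ∈ Finset.range n, |p.coeff i| * r ^ i := by
  have h : (absPoly p).natDegree < n := by
    refine lt_of_le_of_lt (natDegree_le_iff_coeff_eq_zero.2 fun i hi => ?_) hn
    rw [coeff_absPoly, coeff_eq_zero_of_natDegree_lt hi, abs_zero]
  rw [absEval, eval_eq_sum_range' h]
  simp [coeff_absPoly]

lemma absEval_nonneg (p : ℝ[X]) {r : ℝ} (hr : 0 ≤ r) : 0 ≤ absEval p r := by
  rw [absEval_eq_sum (Nat.lt_succ_self _)]
  positivity

lemma abs_eval_le_absEval (p : ℝ[X]) (x : ℝ) : |p.eval x| ≤ absEval p |x| := by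
  rw [absEval_eq_sum (Nat.lt_succ_self _), eval_eq_sum_range]
  refine (Finset.abs_sum_le_sum_abs _ _).trans (le_of_eq ?_)
  simp [abs_mul, abs_pow]

lemma absEval_mono (p : ℝ[X]) {r s : ℝ} (hr : 0 ≤ r) (hrs : r ≤ s) :
    absEval p r ≤ absEval p s := by
  rw [absEval_eq_sum (Nat.lt_succ_self _), absEval_eq_sum (Nat.lt_succ_self _)]
  gcongr

lemma absEval_add_le (p q : ℝ[X]) {r : ℝ} (hr : 0 ≤ r) :
    absEval (p + q) r ≤ absEval p r + absEval q r := by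
  rw [absEval, absEval, absEval, ← eval_add]
  refine eval_le_eval_of_coeff_le (fun i => ?_) hr
  simp only [coeff_absPoly, coeff_add]
  exact abs_add_le _ _

lemma absEval_neg (p : ℝ[X]) (r : ℝ) : absEval (-p) r = absEval p r := by
  rw [absEval, absEval]
  congr 1
  ext i
  simp [coeff_absPoly]

lemma absEval_mul_le (p q : ℝ[X]) {r : ℝ} (hr : 0 ≤ r) :
    absEval (p * q) r ≤ absEval p r * absEval q r := by
  rw [absEval, absEval, absEval, ← eval_mul]
  refine eval_le_eval_of_coeff_le (fun i => ?_) hr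
  simp only [coeff_absPoly, coeff_mul]
  refine (Finset.abs_sum_le_sum_abs _ _).trans (le_of_eq ?_)
  simp [abs_mul]

lemma absEval_C (a r : ℝ) : absEval (C a) r = |a| := by
  rw [absEval_eq_sum (n := 1) (by simp)]
  simp

lemma absEval_zero (r : ℝ) : absEval 0 r = 0 := by
  rw [absEval_eq_sum (n := 1) (by simp)]
  simp

lemma absEval_C_mul (a : ℝ) (p : ℝ[X]) (r : ℝ) : absEval (C a * p) r = |a| * absEval p r := by
  rw [absEval, absEval, ← eval_C_mul]
  congr 1
  ext i
  simp [coeff_absPoly, abs_mul]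

/-- The Euler operator `X d/dX` multiplies the `i`-th coefficient by `i`, and only `i ≤ d` occur. -/
lemma absEval_X_mul_derivative_le {p : ℝ[X]} {d : ℕ} (hd : p.natDegree ≤ d) {r : ℝ}
    (hr : 0 ≤ r) : absEval (X * derivative p) r ≤ d * absEval p r := by
  rw [absEval, absEval, ← eval_C_mul]
  refine eval_le_eval_of_coeff_le (fun i => ?_) hr
  rw [coeff_absPoly, coeff_C_mul, coeff_absPoly]
  cases i with
  | zero => simp only [coeff_X_mul_zero, abs_zero]; positivity
  | succ i =>
    rw [coeff_X_mul, coeff_derivative, abs_mul, mul_comm]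
    by_cases h : i + 1 ≤ d
    · refine mul_le_mul_of_nonneg_right ?_ (abs_nonneg _)
      rw [abs_of_nonneg (by positivity)]
      exact_mod_cast h
    · rw [coeff_eq_zero_of_natDegree_lt (by omega)]
      simp

lemma absEval_two_mul_le {p : ℝ[X]} {d : ℕ} (hd : p.natDegree ≤ d) {r : ℝ} (hr : 0 ≤ r) :
    absEval p (2 * r) ≤ 2 ^ d * absEval p r := by
  rw [absEval_eq_sum (Nat.lt_succ_of_le hd), absEval_eq_sum (Nat.lt_succ_of_le hd),
    Finset.mul_sum]
  refine Finset.sum_le_sum fun i hi => ?_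
  have h : (2 : ℝ) ^ i ≤ 2 ^ d :=
    pow_le_pow_right₀ (by norm_num) (by simpa [Nat.lt_succ_iff] using hi)
  rw [mul_pow]
  calc |p.coeff i| * (2 ^ i * r ^ i) ≤ |p.coeff i| * (2 ^ d * r ^ i) := by gcongr
    _ = _ := by ring

/-! ### Derivatives of `ξ ^ L * exp (-U ξ)` -/

/-- The falling factorial `L (L - 1) ⋯ (L - N + 1)` as a real number. -/
def fallFactor (L : ℕ) (N : ℕ) : ℝ := ∏ i ∈ Finset.range N, ((L : ℝ) - i)

lemma fallFactor_eq_zero {L N : ℕ} (h : L < N) : fallFactor L N = 0 :=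
  Finset.prod_eq_zero (Finset.mem_range.2 h) (sub_self _)

/-- The `N`-th derivative of `ξ ^ L * exp (-U ξ)` is
`ξ ^ (L - N) * (fallFactor L N + expCofactor L U N) * exp (-U ξ)`. -/
def expCofactor (L : ℕ) (U : ℝ[X]) : ℕ → ℝ[X]
  | 0 => 0
  | N + 1 => C ((L : ℝ) - N) * expCofactor L U N + X * derivative (expCofactor L U N) +
      -(X * derivative U * (C (fallFactor L N) + expCofactor L U N))

lemma natDegree_expCofactor_le (L : ℕ) {U : ℝ[X]} {d : ℕ} (hd : U.natDegree ≤ d) (N : ℕ) :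
    (expCofactor L U N).natDegree ≤ N * d := by
  have hX : ∀ p : ℝ[X], (X * derivative p).natDegree ≤ p.natDegree := by
    intro p
    refine natDegree_le_iff_coeff_eq_zero.2 fun i hi => ?_
    cases i with
    | zero => simp
    | succ i => rw [coeff_X_mul, coeff_derivative, coeff_eq_zero_of_natDegree_lt hi, zero_mul]
  induction N with
  | zero => simp [expCofactor]
  | succ N ih =>
    have hNd : N * d ≤ (N + 1) * d := Nat.mul_le_mul_right _ (by omega)
    refine natDegree_add_le_of_degree_le (natDegree_add_le_of_degree_le ?_ ?_) ?_
    · exact (natDegree_C_mul_le _ _).trans (ih.trans hNd)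
    · exact (hX _).trans (ih.trans hNd)
    · rw [natDegree_neg]
      refine natDegree_mul_le.trans ?_
      have h1 : (C (fallFactor L N) + expCofactor L U N).natDegree ≤ N * d :=
        natDegree_add_le_of_degree_le (by simp) ih
      have h2 := (hX U).trans hd
      calc _ ≤ d + N * d := add_le_add h2 h1
        _ = _ := by ring

/-- Each step of the recursion applies `X d/dX`, which costs at most the degree, or multiplies by `X
U'`, which is dominated by `U` coefficientwise. So `U` enters only through `absEval U`. The factor
`absEval U` in front survives because the part of the prefactor that does not involve `U` is kept
apart as `fallFactor`. -/
lemma absEval_expCofactor_le (L d N : ℕ) : ∃ A : ℝ, 0 ≤ A ∧ ∀ U : ℝ[X], U.natDegree ≤ d →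
    ∀ r : ℝ, 0 ≤ r →
      absEval (expCofactor L U N) r ≤ A * (absEval U r * (1 + absEval U r) ^ N) := by
  induction N with
  | zero => exact ⟨0, le_rfl, fun U _ r _ => by simp [expCofactor, absEval_zero]⟩
  | succ N ih =>
    obtain ⟨A, hA, h⟩ := ih
    refine ⟨|(L : ℝ) - N| * A + (N * d : ℕ) * A + d * (|fallFactor L N| + A), by positivity,
      fun U hU r hr => ?_⟩
    have hV := absEval_nonneg U hr
    have ih := h U hU r hr
    have hr0 := absEval_nonneg (expCofactor L U N) hr
    set V := absEval U r
    set T := absEval (expCofactor L U N) r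
    have hpow : (1 + V) ^ N ≤ (1 + V) ^ (N + 1) :=
      pow_le_pow_right₀ (by linarith) (by omega)
    have hone : 1 ≤ (1 + V) ^ (N + 1) := one_le_pow₀ (by linarith)
    have h1 : absEval (C ((L : ℝ) - N) * expCofactor L U N) r ≤
        |(L : ℝ) - N| * (A * (V * (1 + V) ^ (N + 1))) := by
      rw [absEval_C_mul]
      gcongr
      exact ih.trans (by gcongr)
    have h2 : absEval (X * derivative (expCofactor L U N)) r ≤
        (N * d : ℕ) * (A * (V * (1 + V) ^ (N + 1))) := by
      refine (absEval_X_mul_derivative_le (natDegree_expCofactor_le L hU N) hr).trans ?_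
      gcongr
      exact ih.trans (by gcongr)
    have h3 : absEval (-(X * derivative U * (C (fallFactor L N) + expCofactor L U N))) r ≤
        d * V * ((|fallFactor L N| + A) * (1 + V) ^ (N + 1)) := by
      rw [absEval_neg]
      refine (absEval_mul_le _ _ hr).trans ?_
      gcongr
      · exact absEval_nonneg _ hr
      · exact absEval_X_mul_derivative_le hU hr
      · refine (absEval_add_le _ _ hr).trans ?_
        rw [absEval_C, add_mul]
        refine add_le_add (le_mul_of_one_le_right (abs_nonneg _) hone) (ih.trans ?_)
        gcongr
        rw [pow_succ']
        gcongr
        linarith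
    calc absEval (expCofactor L U (N + 1)) r
        ≤ _ := (absEval_add_le _ _ hr).trans
          (add_le_add ((absEval_add_le _ _ hr).trans (add_le_add h1 h2)) h3)
      _ = _ := by ring

/-- The `N`-th derivative of `ξ ^ L * exp (-U ξ)` away from `0`. -/
def expDeriv (L : ℕ) (U : ℝ[X]) (N : ℕ) (x : ℝ) : ℝ :=
  x ^ ((L : ℤ) - N) * (fallFactor L N + (expCofactor L U N).eval x) * Real.exp (-U.eval x)

lemma expDeriv_zero (L : ℕ) (U : ℝ[X]) (x : ℝ) :
    expDeriv L U 0 x = x ^ L * Real.exp (-U.eval x) := by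
  simp [expDeriv, expCofactor, fallFactor]

lemma hasDerivAt_expDeriv (L : ℕ) (U : ℝ[X]) (N : ℕ) {x : ℝ} (hx : x ≠ 0) :
    HasDerivAt (expDeriv L U N) (expDeriv L U (N + 1) x) x := by
  have h1 := hasDerivAt_zpow ((L : ℤ) - N) x (Or.inl hx)
  have h2 := ((expCofactor L U N).hasDerivAt x).const_add (fallFactor L N)
  have h3 := (U.hasDerivAt x).neg.exp
  refine ((h1.mul h2).mul h3).congr_deriv ?_
  have hz : x ^ ((L : ℤ) - N) = x ^ ((L : ℤ) - N - 1) * x := by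
    rw [← zpow_add_one₀ hx]; congr 1; ring
  have hc : (L : ℤ) - ((N + 1 : ℕ) : ℤ) = (L : ℤ) - N - 1 := by push_cast; ring
  have hf : fallFactor L (N + 1) = fallFactor L N * ((L : ℝ) - N) := Finset.prod_range_succ _ _
  simp only [expDeriv, expCofactor, hc, hf, hz, eval_add, eval_mul, eval_neg, eval_C, eval_X,
    Pi.mul_apply, Pi.neg_apply]
  push_cast
  ring

/-- The iterated forward difference is bounded by the supremum of the iterated derivative. -/
lemma abs_fwdDiff_iter_le (N : ℕ) : ∀ (f : ℕ → ℝ → ℝ) (a B : ℝ),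
    (∀ i < N, ∀ y ∈ Set.Icc a (a + N), HasDerivAt (f i) (f (i + 1) y) y) →
    (∀ y ∈ Set.Icc a (a + N), |f N y| ≤ B) → |(fwdDiff (1 : ℝ))^[N] (f 0) a| ≤ B := by
  induction N with
  | zero => intro f a B _ hB; exact hB a (by simp)
  | succ N ih =>
    intro f a B hf hB
    rw [Function.iterate_succ_apply]
    have hsub : ∀ y ∈ Set.Icc a (a + N), Set.Icc y (y + 1) ⊆ Set.Icc a (a + (N + 1 : ℕ)) := by
      rintro y ⟨h1, h2⟩ z ⟨h3, h4⟩
      push_cast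
      exact ⟨by linarith, by linarith⟩
    -- One difference is taken inside: the differences of the `f i` again form a chain of
    -- derivatives, and the mean value theorem bounds the last one by the next derivative.
    refine ih (fun i => fwdDiff 1 (f i)) a B (fun i hi y hy => ?_) (fun y hy => ?_)
    · have h0 := hf i (by omega) y (hsub y hy ⟨le_rfl, by linarith⟩)
      have h1 := hf i (by omega) (y + 1) (hsub y hy ⟨by linarith, le_rfl⟩)
      exact (h1.comp_add_const y 1).sub h0
    · have := (convex_Icc y (y + 1)).norm_image_sub_le_of_norm_hasDerivWithin_le (f := f N)
        (f' := f (N + 1)) (C := B)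
        (fun z hz => (hf N (by omega) z (hsub y hy hz)).hasDerivWithinAt)
        (fun z hz => hB z (hsub y hy hz)) (x := y) (y := y + 1) (by simp) (by simp)
      simpa [fwdDiff] using this

/-! ### Elementary estimates -/

lemma exists_pow_mul_exp_neg_le (n : ℕ) {c : ℝ} (hc : 0 < c) :
    ∃ B : ℝ, 0 ≤ B ∧ ∀ u : ℝ, 0 ≤ u → u ^ n * Real.exp (-(c * u)) ≤ B := by
  refine ⟨n.factorial / c ^ n, by positivity, fun u hu => ?_⟩
  have h := Real.pow_div_factorial_le_exp (c * u) (by positivity) n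
  rw [Real.exp_neg, ← div_eq_mul_inv, div_le_div_iff₀ (Real.exp_pos _) (by positivity)]
  rw [div_le_iff₀ (by positivity), mul_pow] at h
  linarith

lemma exists_one_add_pow_mul_exp_neg_le (n : ℕ) {c : ℝ} (hc : 0 < c) :
    ∃ B : ℝ, 0 ≤ B ∧ ∀ u : ℝ, 0 ≤ u → (1 + u) ^ n * Real.exp (-(c * u)) ≤ B := by
  obtain ⟨B, hB, h⟩ := exists_pow_mul_exp_neg_le n hc
  refine ⟨Real.exp c * B, by positivity, fun u hu => ?_⟩
  calc (1 + u) ^ n * Real.exp (-(c * u))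
      = Real.exp c * ((1 + u) ^ n * Real.exp (-(c * (1 + u)))) := by
        rw [mul_left_comm, ← Real.exp_add]; ring_nf
    _ ≤ _ := by gcongr; exact h _ (by positivity)

/-- The step condition says `W (n+1) / (n+1) ≤ W (n+1) - W n`, so the sum is at most a lower Riemann
sum for `∫ e^{-cw} dw` over `[0, ∞)`. The bound `1 / c` does not see `W` at all, which is what makes
the later estimates uniform in time and in the symbol. The term `i = 0` vanishes since division by
zero gives zero. -/
lemma sum_range_div_mul_exp_le {W : ℕ → ℝ} (hW : ∀ n, 0 ≤ W n)
    (hstep : ∀ n : ℕ, (n + 1) * W n ≤ n * W (n + 1)) {c : ℝ} (hc : 0 < c) (n : ℕ) :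
    ∑ i ∈ Finset.range n, W i / i * Real.exp (-(c * W i)) ≤ 1 / c := by
  suffices h : ∀ n : ℕ, ∑ i ∈ Finset.range (n + 1), W i / i * Real.exp (-(c * W i)) ≤
      (1 - Real.exp (-(c * W n))) / c by
    calc _ ≤ ∑ i ∈ Finset.range (n + 1), W i / i * Real.exp (-(c * W i)) := by
          rw [Finset.sum_range_succ]
          have := hW n
          exact le_add_of_nonneg_right (by positivity)
      _ ≤ _ := h n
      _ ≤ 1 / c := by gcongr; linarith [Real.exp_pos (-(c * W n))]
  intro n
  induction n with
  | zero =>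
    have h0 : 0 ≤ (1 - Real.exp (-(c * W 0))) / c :=
      div_nonneg (by have := hW 0; simp only [sub_nonneg, Real.exp_le_one_iff]; nlinarith) hc.le
    simpa using h0
  | succ n ih =>
    rw [Finset.sum_range_succ]
    have h1 : W n ≤ W (n + 1) - W (n + 1) / ((n + 1 : ℕ) : ℝ) := by
      have := hstep n
      push_cast
      rw [le_sub_iff_add_le, ← le_sub_iff_add_le', div_le_iff₀ (by positivity)]
      linarith
    -- The tangent inequality `1 + u ≤ e^u` makes the sum telescope.
    have h2 : Real.exp (-(c * W (n + 1))) * (c * (W (n + 1) / ((n + 1 : ℕ) : ℝ)) + 1) ≤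
        Real.exp (-(c * W n)) := by
      calc _ ≤ Real.exp (-(c * W (n + 1))) * Real.exp (c * (W (n + 1) / ((n + 1 : ℕ) : ℝ))) := by
            gcongr; exact Real.add_one_le_exp _
        _ ≤ _ := by rw [← Real.exp_add]; gcongr; nlinarith
    rw [le_div_iff₀ hc] at ih ⊢
    rw [add_mul]
    linarith

lemma summable_and_norm_tsum_int_le {E : Type*} [NormedAddCommGroup E] [CompleteSpace E]
    {f : ℤ → E} {g : ℕ → ℝ} {B : ℝ} (h : ∀ k, ‖f k‖ ≤ g k.natAbs)
    (hg : ∀ n, ∑ i ∈ Finset.range n, g i ≤ B) : Summable f ∧ ‖∑' k, f k‖ ≤ 2 * B := by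
  have hg0 : ∀ n, 0 ≤ g n := fun n => (norm_nonneg _).trans (h n)
  have hs : Summable g := summable_of_sum_range_le hg0 hg
  have hB : ∑' n, g n ≤ B := Real.tsum_le_of_sum_range_le hg0 hg
  have h1 : HasSum (fun n : ℕ => g ((n : ℤ)).natAbs) (∑' n, g n) := by simpa using hs.hasSum
  have h2 : HasSum (fun n : ℕ => g ((-((n : ℤ) + 1))).natAbs) (∑' n, g n - g 0) := by
    have : ∀ n : ℕ, (-((n : ℤ) + 1)).natAbs = n + 1 := fun n => by omega
    simp only [this]
    simpa using (hasSum_nat_add_iff' 1).2 hs.hasSum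
  have h3 := HasSum.of_nat_of_neg_add_one (f := fun k : ℤ => g k.natAbs) h1 h2
  refine ⟨Summable.of_norm_bounded h3.summable h, ?_⟩
  calc ‖∑' k, f k‖ ≤ ∑' n, g n + (∑' n, g n - g 0) := tsum_of_norm_bounded h3 h
    _ ≤ _ := by linarith [hg0 0]

lemma summable_int_of_natAbs {g : ℕ → ℝ} (hg : Summable g) :
    Summable fun k : ℤ => g k.natAbs := by
  refine Summable.of_nat_of_neg ?_ ?_ <;> simpa using hg

lemma summable_abs_pow_mul_exp_neg (L : ℕ) {c : ℝ} (hc : 0 < c) :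
    Summable fun k : ℤ => |(k : ℝ)| ^ L * Real.exp (-(c * (k : ℝ) ^ 2)) := by
  refine Summable.of_nonneg_of_le (fun k => by positivity) (fun k => ?_)
    (summable_int_of_natAbs (Real.summable_pow_mul_exp_neg_nat_mul L hc))
  have h1 : ((k.natAbs : ℕ) : ℝ) = |(k : ℝ)| := by rw [Nat.cast_natAbs]; push_cast; rfl
  rw [h1]
  gcongr
  rw [neg_mul]
  have h2 : |(k : ℝ)| ≤ (k : ℝ) ^ 2 := by
    rw [← h1, ← sq_abs, ← h1]
    exact_mod_cast Nat.le_self_pow (by norm_num) _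
  nlinarith

/-! ### Symbols -/

/-- `q` is a polynomial of degree at most `d` without constant and linear term, with a
nondegenerate quadratic term, all of whose monomials are controlled by `q`. -/
structure IsSymbol (d : ℕ) (M : ℝ) (q : ℝ[X]) : Prop where
  natDegree_le : q.natDegree ≤ d
  coeff_zero : q.coeff 0 = 0
  coeff_one : q.coeff 1 = 0
  one_le_coeff_two : 1 ≤ q.coeff 2
  absEval_le : ∀ x : ℝ, absEval q |x| ≤ M * q.eval x

namespace IsSymbol

variable {d : ℕ} {M : ℝ} {q : ℝ[X]}

lemma two_le (h : IsSymbol d M q) : 2 ≤ q.natDegree :=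
  le_natDegree_of_ne_zero (by have := h.one_le_coeff_two; linarith)

lemma sq_le_absEval (h : IsSymbol d M q) (x : ℝ) : x ^ 2 ≤ absEval q |x| := by
  rw [absEval_eq_sum (Nat.lt_succ_self _)]
  calc x ^ 2 ≤ |q.coeff 2| * |x| ^ 2 := by
        rw [sq_abs]
        exact le_mul_of_one_le_left (sq_nonneg x) (h.one_le_coeff_two.trans (le_abs_self _))
    _ ≤ _ := Finset.single_le_sum (f := fun i => |q.coeff i| * |x| ^ i)
        (fun i _ => by positivity) (Finset.mem_range.2 (by have := h.two_le; omega))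

lemma sq_le (h : IsSymbol d M q) (x : ℝ) : x ^ 2 ≤ M * q.eval x :=
  (h.sq_le_absEval x).trans (h.absEval_le x)

lemma eval_nonneg (h : IsSymbol d M q) (hM : 0 < M) (x : ℝ) : 0 ≤ q.eval x :=
  nonneg_of_mul_nonneg_right ((sq_nonneg x).trans (h.sq_le x)) hM

lemma eval_zero (h : IsSymbol d M q) : q.eval 0 = 0 := by
  rw [← coeff_zero_eq_eval_zero, h.coeff_zero]

lemma sq_div_le (h : IsSymbol d M q) (hM : 0 < M) (x : ℝ) : x ^ 2 / M ≤ q.eval x := by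
  rw [div_le_iff₀ hM, mul_comm]; exact h.sq_le x

/-- Without constant term, `absEval q r / r` has nonnegative coefficients and hence is
nondecreasing. This is the hypothesis on `W` in `sum_range_div_mul_exp_le`. -/
lemma step (h : IsSymbol d M q) (n : ℕ) :
    (n + 1) * absEval q n ≤ n * absEval q ((n + 1 : ℕ) : ℝ) := by
  rw [absEval_eq_sum (Nat.lt_succ_self _), absEval_eq_sum (Nat.lt_succ_self _), Finset.mul_sum,
    Finset.mul_sum]
  refine Finset.sum_le_sum fun i _ => ?_
  cases i with
  | zero => simp [h.coeff_zero]
  | succ i =>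
    have h1 : (n : ℝ) ^ i ≤ (n + 1) ^ i := by gcongr; linarith
    push_cast
    calc ((n : ℝ) + 1) * (|q.coeff (i + 1)| * (n : ℝ) ^ (i + 1))
        = |q.coeff (i + 1)| * n * (n + 1) * (n : ℝ) ^ i := by ring
      _ ≤ |q.coeff (i + 1)| * n * (n + 1) * ((n : ℝ) + 1) ^ i := by gcongr
      _ = _ := by ring

end IsSymbol

/-! ### Differences of the coefficients -/

/-- The function `ξ ↦ ξ ^ L * exp (-(q ξ * t))`. -/
def expCoeff (q : ℝ[X]) (L : ℕ) (t x : ℝ) : ℝ := x ^ L * Real.exp (-(q.eval x * t))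

/-- For `|k| ≥ 2N` all points of `[k, k + N]` have absolute value comparable to `|k|`, so the `N`-th
derivative there can be estimated by quantities at `|k|`. Only `d` and `M` enter the comparison. -/
lemma exists_abs_fwdDiff_expCoeff_le (d : ℕ) {M : ℝ} (hM : 0 < M) {L N : ℕ} (hLN : L < N) :
    ∃ A c : ℝ, 0 ≤ A ∧ 0 < c ∧ ∀ q, IsSymbol d M q → ∀ t : ℝ, 0 < t → ∀ k : ℝ, 2 * N ≤ |k| →
      |(fwdDiff (1 : ℝ))^[N] (expCoeff q L t) k| ≤
        A * (|k| ^ ((L : ℤ) - N) * (t * absEval q |k| * Real.exp (-(c * (t * absEval q |k|))))) := by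
  obtain ⟨A, hA, hAU⟩ := absEval_expCofactor_le L d N
  obtain ⟨B, hB, hBu⟩ := exists_one_add_pow_mul_exp_neg_le N (c := 1 / (2 * M)) (by positivity)
  refine ⟨2 ^ ((N : ℤ) - L) * (A * (2 ^ d * B)), 1 / (2 * M) / 2 ^ d, by positivity, by positivity,
    fun q hq t ht k hk => ?_⟩
  have hN : (1 : ℝ) ≤ N := by exact_mod_cast (show 1 ≤ N by omega)
  have hU : (C t * q).natDegree ≤ d := (natDegree_C_mul_le _ _).trans hq.natDegree_le
  have hUe : ∀ r, absEval (C t * q) r = t * absEval q r := fun r => by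
    rw [absEval_C_mul, abs_of_pos ht]
  have hf0 : expCoeff q L t = expDeriv L (C t * q) 0 := by
    ext x; rw [expDeriv_zero, expCoeff, eval_C_mul, mul_comm (q.eval x)]
  have hy : ∀ y ∈ Set.Icc k (k + N), |k| / 2 ≤ |y| ∧ |y| ≤ 2 * |k| := by
    rintro y ⟨h1, h2⟩
    have h3 : |y - k| ≤ |k| / 2 := by rw [abs_of_nonneg (by linarith)]; linarith
    constructor
    · have := abs_sub_abs_le_abs_sub k y; rw [abs_sub_comm] at this; linarith
    · have := abs_sub_abs_le_abs_sub y k; linarith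
  have hk0 : 0 < |k| := by linarith
  rw [hf0]
  refine abs_fwdDiff_iter_le N (fun i => expDeriv L (C t * q) i) k _
    (fun i _ y hyk => hasDerivAt_expDeriv L _ i ?_) (fun y hyk => ?_)
  · have := (hy y hyk).1
    exact abs_pos.1 (by linarith)
  obtain ⟨hy1, hy2⟩ := hy y hyk
  have hy0 : 0 < |y| := by linarith
  set W := t * absEval q |y| with hWdef
  set Wk := t * absEval q |k| with hWkdef
  have hW0 : 0 ≤ W := mul_nonneg ht.le (absEval_nonneg q (abs_nonneg y))
  have hWk0 : 0 ≤ Wk := mul_nonneg ht.le (absEval_nonneg q (abs_nonneg k))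
  have hWle : W ≤ 2 ^ d * Wk := by
    calc W ≤ t * absEval q (2 * |k|) := by
          exact mul_le_mul_of_nonneg_left (absEval_mono q (abs_nonneg y) hy2) ht.le
      _ ≤ t * (2 ^ d * absEval q |k|) := by
          gcongr; exact absEval_two_mul_le hq.natDegree_le (abs_nonneg k)
      _ = _ := by rw [hWkdef]; ring
  have hWge : Wk ≤ 2 ^ d * W := by
    calc Wk ≤ t * absEval q (2 * |y|) := by
          exact mul_le_mul_of_nonneg_left (absEval_mono q (abs_nonneg k) (by linarith)) ht.le
      _ ≤ t * (2 ^ d * absEval q |y|) := by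
          gcongr; exact absEval_two_mul_le hq.natDegree_le (abs_nonneg y)
      _ = _ := by rw [hWdef]; ring
  -- The available decay `W / M` is split in two. One half stays at `y` and absorbs `(1 + W) ^ N`;
  -- the other is moved to `k`, at the cost of the factor `2 ^ d` in the rate.
  have hexp : Real.exp (-(C t * q).eval y) ≤
      Real.exp (-(1 / (2 * M) * W)) * Real.exp (-(1 / (2 * M) / 2 ^ d * Wk)) := by
    rw [← Real.exp_add, eval_C_mul]
    gcongr
    have h1 : W / M ≤ t * q.eval y := by
      rw [div_le_iff₀ hM, hWdef]
      calc t * absEval q |y| ≤ t * (M * q.eval y) := by gcongr; exact hq.absEval_le y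
        _ = _ := by ring
    have h2 : 1 / (2 * M) / 2 ^ d * Wk ≤ 1 / (2 * M) * W := by
      rw [div_mul_eq_mul_div, div_le_iff₀ (by positivity)]
      calc 1 / (2 * M) * Wk ≤ 1 / (2 * M) * (2 ^ d * W) := by gcongr
        _ = _ := by ring
    have h3 : 1 / (2 * M) * W + 1 / (2 * M) * W = W / M := by field_simp; ring
    linarith
  have hr : |(expCofactor L (C t * q) N).eval y| ≤ A * (W * (1 + W) ^ N) := by
    have := (abs_eval_le_absEval _ y).trans (hAU _ hU |y| (abs_nonneg y))
    rwa [hUe] at this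
  have hz : |y| ^ ((L : ℤ) - N) ≤ 2 ^ ((N : ℤ) - L) * |k| ^ ((L : ℤ) - N) := by
    have e : (L : ℤ) - N = -((N - L : ℕ) : ℤ) := by omega
    have e' : (N : ℤ) - L = ((N - L : ℕ) : ℤ) := by omega
    rw [e, e', zpow_neg, zpow_neg, zpow_natCast, zpow_natCast, zpow_natCast]
    rw [← div_eq_mul_inv, inv_eq_one_div, div_le_div_iff₀ (by positivity) (by positivity), one_mul,
      ← mul_pow]
    gcongr
    linarith
  -- Since `L < N`, the term without a factor `W` disappears; the remaining factor `W` is needed for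
  -- the Riemann sum.
  rw [expDeriv, fallFactor_eq_zero hLN, zero_add, abs_mul, abs_mul, abs_zpow, Real.abs_exp]
  calc |y| ^ ((L : ℤ) - N) * |(expCofactor L (C t * q) N).eval y| * Real.exp (-(C t * q).eval y)
      ≤ 2 ^ ((N : ℤ) - L) * |k| ^ ((L : ℤ) - N) * (A * (W * (1 + W) ^ N)) *
        (Real.exp (-(1 / (2 * M) * W)) * Real.exp (-(1 / (2 * M) / 2 ^ d * Wk))) := by
        gcongr
    _ = 2 ^ ((N : ℤ) - L) * |k| ^ ((L : ℤ) - N) * (A * (W *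
        ((1 + W) ^ N * Real.exp (-(1 / (2 * M) * W))))) *
          Real.exp (-(1 / (2 * M) / 2 ^ d * Wk)) := by ring
    _ ≤ 2 ^ ((N : ℤ) - L) * |k| ^ ((L : ℤ) - N) * (A * (2 ^ d * Wk * B)) *
          Real.exp (-(1 / (2 * M) / 2 ^ d * Wk)) := by
        gcongr
        exact hBu W hW0
    _ = _ := by ring

lemma norm_fwdDiff_iter_le_of_bdd {B : ℝ} (N : ℕ) : ∀ {f : ℤ → ℂ} {k : ℤ},
    (∀ j : ℤ, k ≤ j → j ≤ k + N → ‖f j‖ ≤ B) → ‖(fwdDiff (1 : ℤ))^[N] f k‖ ≤ 2 ^ N * B := by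
  induction N with
  | zero => intro f k h; simpa using h k le_rfl (by simp)
  | succ N ih =>
    intro f k h
    rw [Function.iterate_succ_apply', fwdDiff]
    have h1 := ih (f := f) (k := k + 1) fun j h1 h2 => h j (by omega) (by push_cast; omega)
    have h2 := ih (f := f) (k := k) fun j h1 h2 => h j (by omega) (by push_cast; omega)
    calc _ ≤ _ := norm_sub_le _ _
      _ ≤ 2 ^ N * B + 2 ^ N * B := add_le_add h1 h2
      _ = _ := by ring

lemma fwdDiff_iter_intCast (f : ℝ → ℝ) (N : ℕ) (k : ℤ) :
    (fwdDiff (1 : ℤ))^[N] (fun j : ℤ => ((f j : ℝ) : ℂ)) k =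
      (((fwdDiff (1 : ℝ))^[N] f k : ℝ) : ℂ) := by
  induction N generalizing f with
  | zero => rfl
  | succ N ih =>
    rw [Function.iterate_succ_apply, Function.iterate_succ_apply, ← ih]
    have h : fwdDiff (1 : ℤ) (fun j : ℤ => ((f j : ℝ) : ℂ)) =
        fun j : ℤ => ((fwdDiff (1 : ℝ) f j : ℝ) : ℂ) := by
      ext j
      simp [fwdDiff]
    rw [h]

/-! ### Exponential series on the circle -/

lemma exists_real_rep (x : UnitAddCircle) :
    ∃ r : ℝ, (r : UnitAddCircle) = x ∧ |r| = ‖x‖ ∧ |r| ≤ 1 / 2 := by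
  obtain ⟨y, rfl⟩ := QuotientAddGroup.mk_surjective x
  refine ⟨y - round y, ?_, ?_, abs_sub_round y⟩
  · have : ((round y : ℝ) : UnitAddCircle) = 0 := by
      have := (AddCircle.coe_eq_zero_iff (p := (1 : ℝ)) (x := (round y : ℝ))).2 ⟨round y, by simp⟩
      exact this
    rw [AddCircle.coe_sub, this, sub_zero]
  · exact (UnitAddCircle.norm_eq).symm

/-- `|e^{-2πir} - 1| = 2 |sin πr|`, and Jordan's inequality applies because `|r| ≤ 1/2`. -/
lemma four_mul_norm_le (x : UnitAddCircle) : 4 * ‖x‖ ≤ ‖fourier (-1) x - 1‖ := by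
  obtain ⟨r, rfl, h1, h2⟩ := exists_real_rep x
  rw [← h1, fourier_coe_apply]
  have h3 : (2 * Real.pi * Complex.I * ((-1 : ℤ) : ℂ) * (r : ℂ) / ((1 : ℝ) : ℂ)) =
      Complex.I * ((-(2 * Real.pi * r) : ℝ) : ℂ) := by
    push_cast; ring
  rw [h3, Complex.norm_exp_I_mul_ofReal_sub_one, norm_mul, Real.norm_eq_abs, Real.norm_eq_abs,
    abs_of_pos (by norm_num : (0 : ℝ) < 2), show -(2 * Real.pi * r) / 2 = -(Real.pi * r) by ring,
    Real.sin_neg, abs_neg]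
  have h4 : 2 * |r| ≤ |Real.sin (Real.pi * r)| := by
    have h5 : |Real.sin (Real.pi * r)| = |Real.sin (Real.pi * |r|)| := by
      rcases abs_cases r with ⟨h, _⟩ | ⟨h, _⟩ <;> simp [h]
    rw [h5]
    have h6 := Real.mul_le_sin (x := Real.pi * |r|) (by positivity)
      (by have := Real.pi_pos; nlinarith)
    calc 2 * |r| = 2 / Real.pi * (Real.pi * |r|) := by field_simp
      _ ≤ _ := h6.trans (le_abs_self _)
  linarith

lemma norm_fourier_apply (k : ℤ) (x : UnitAddCircle) : ‖(fourier k x : ℂ)‖ = 1 := by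
  rw [fourier_apply]; exact Circle.norm_coe _

lemma summable_mul_fourier {a : ℤ → ℂ} (ha : Summable a) (x : UnitAddCircle) :
    Summable fun k => a k * fourier k x :=
  Summable.of_norm_bounded ha.norm fun k => by rw [norm_mul, norm_fourier_apply, mul_one]

lemma summable_fwdDiff {a : ℤ → ℂ} (ha : Summable a) : Summable (fwdDiff (1 : ℤ) a) :=
  ((Equiv.addRight (1 : ℤ)).summable_iff.2 ha).sub ha

/-- Summation by parts: shifting the coefficients by one multiplies the series by `fourier (-1)`. -/
lemma tsum_fwdDiff_mul_fourier {a : ℤ → ℂ} (ha : Summable a) (x : UnitAddCircle) :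
    ∑' k, fwdDiff (1 : ℤ) a k * fourier k x = (fourier (-1) x - 1) * ∑' k, a k * fourier k x := by
  have h1 := summable_mul_fourier ha x
  have h2 : ∀ k : ℤ, fwdDiff (1 : ℤ) a k * fourier k x =
      fourier (-1) x * (a (k + 1) * fourier (k + 1) x) - a k * fourier k x := by
    intro k
    rw [mul_left_comm, ← fourier_add, neg_add_cancel_comm_assoc, fwdDiff, sub_mul]
  generalize hb : (fun k => a k * (fourier k x : ℂ)) = b at h1
  have h3 : Summable fun k : ℤ => b (k + 1) := (Equiv.addRight (1 : ℤ)).summable_iff.2 h1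
  have h4 : ∑' k : ℤ, b (k + 1) = ∑' k, b k := (Equiv.addRight (1 : ℤ)).tsum_eq b
  have h5 : ∀ k : ℤ, fwdDiff (1 : ℤ) a k * fourier k x = fourier (-1) x * b (k + 1) - b k := by
    intro k; rw [h2, ← hb]
  rw [tsum_congr h5, (h3.mul_left _).tsum_sub h1, tsum_mul_left, h4]
  ring

lemma tsum_fwdDiff_iter_mul_fourier {a : ℤ → ℂ} (ha : Summable a) (x : UnitAddCircle) (N : ℕ) :
    ∑' k, (fwdDiff (1 : ℤ))^[N] a k * fourier k x =
      (fourier (-1) x - 1) ^ N * ∑' k, a k * fourier k x := by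
  induction N generalizing a with
  | zero => simp
  | succ N ih =>
    simp only [Function.iterate_succ_apply]
    rw [ih (summable_fwdDiff ha), tsum_fwdDiff_mul_fourier ha]
    ring

/-- The series `∑ₖ p(k) exp (-q(k) t) exp (2πi k x)`. -/
def expSeries (q : ℝ[X]) (p : ℂ[X]) (t : ℝ) (x : UnitAddCircle) : ℂ :=
  ∑' k : ℤ, p.eval (k : ℂ) * (Real.exp (-(q.eval (k : ℝ) * t)) : ℂ) * fourier k x

lemma summable_norm_eval_mul_exp (p : ℂ[X]) {c : ℝ} (hc : 0 < c) :
    Summable fun k : ℤ => ‖p.eval (k : ℂ)‖ * Real.exp (-(c * (k : ℝ) ^ 2)) := by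
  have h : Summable fun k : ℤ => ∑ j ∈ Finset.range (p.natDegree + 1),
      ‖p.coeff j‖ * (|(k : ℝ)| ^ j * Real.exp (-(c * (k : ℝ) ^ 2))) :=
    summable_sum fun j _ => (summable_abs_pow_mul_exp_neg j hc).mul_left _
  refine Summable.of_nonneg_of_le (fun k => by positivity) (fun k => ?_) h
  rw [eval_eq_sum_range]
  calc _ ≤ (∑ j ∈ Finset.range (p.natDegree + 1), ‖p.coeff j * (k : ℂ) ^ j‖) *
        Real.exp (-(c * (k : ℝ) ^ 2)) := by gcongr; exact norm_sum_le _ _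
    _ = _ := by
      rw [Finset.sum_mul]
      refine Finset.sum_congr rfl fun j _ => ?_
      rw [norm_mul, norm_pow, Complex.norm_intCast]
      ring

/-! ### Convergence and uniform decay of the exponential series. -/

section Symbol

variable {d : ℕ} {M : ℝ} {q : ℝ[X]}

lemma IsSymbol.exp_le (hq : IsSymbol d M q) (hM : 0 < M) {t₀ t : ℝ} (h0 : 0 ≤ t₀) (ht : t₀ ≤ t)
    (x : ℝ) : Real.exp (-(q.eval x * t)) ≤ Real.exp (-(t₀ / M * x ^ 2)) := by
  refine Real.exp_le_exp.2 (neg_le_neg ?_)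
  calc t₀ / M * x ^ 2 = x ^ 2 / M * t₀ := by ring
    _ ≤ q.eval x * t := mul_le_mul (hq.sq_div_le hM x) ht h0 (hq.eval_nonneg hM x)

lemma IsSymbol.norm_term_le (hq : IsSymbol d M q) (hM : 0 < M) (p : ℂ[X]) {t₀ t : ℝ}
    (h0 : 0 ≤ t₀) (ht : t₀ ≤ t) (k : ℤ) :
    ‖p.eval (k : ℂ) * (Real.exp (-(q.eval (k : ℝ) * t)) : ℂ)‖ ≤
      ‖p.eval (k : ℂ)‖ * Real.exp (-(t₀ / M * (k : ℝ) ^ 2)) := by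
  rw [norm_mul, Complex.norm_real, Real.norm_eq_abs, Real.abs_exp]
  exact mul_le_mul_of_nonneg_left (hq.exp_le hM h0 ht _) (norm_nonneg _)

lemma IsSymbol.summable (hq : IsSymbol d M q) (hM : 0 < M) (p : ℂ[X]) {t : ℝ} (ht : 0 < t) :
    Summable fun k : ℤ => p.eval (k : ℂ) * (Real.exp (-(q.eval (k : ℝ) * t)) : ℂ) :=
  Summable.of_norm_bounded (summable_norm_eval_mul_exp p (div_pos ht hM))
    fun k => hq.norm_term_le hM p ht.le le_rfl k

lemma expSeries_eq_sum (hq : IsSymbol d M q) (hM : 0 < M) (p : ℂ[X]) {t : ℝ} (ht : 0 < t)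
    (x : UnitAddCircle) {n : ℕ} (hn : p.natDegree < n) :
    expSeries q p t x = ∑ j ∈ Finset.range n, p.coeff j * expSeries q (X ^ j) t x := by
  simp only [expSeries]
  simp_rw [← tsum_mul_left]
  rw [← Summable.tsum_finsetSum]
  · refine tsum_congr fun k => ?_
    rw [eval_eq_sum_range' hn, Finset.sum_mul, Finset.sum_mul]
    refine Finset.sum_congr rfl fun j _ => ?_
    simp only [eval_pow, eval_X]
    ring
  · exact fun j _ => (summable_mul_fourier (hq.summable hM (X ^ j) ht) x).mul_left _

lemma eval_X_pow_mul_exp (q : ℝ[X]) (L : ℕ) (t : ℝ) (k : ℤ) :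
    (X ^ L : ℂ[X]).eval (k : ℂ) * (Real.exp (-(q.eval (k : ℝ) * t)) : ℂ) =
      ((expCoeff q L t k : ℝ) : ℂ) := by
  simp [expCoeff]

/-- The iterated differences of the coefficients of `expSeries q (X ^ L)`. -/
def coeffDiff (q : ℝ[X]) (L N : ℕ) (t : ℝ) (k : ℤ) : ℂ :=
  (fwdDiff (1 : ℤ))^[N] (fun j : ℤ => ((expCoeff q L t j : ℝ) : ℂ)) k

lemma tsum_coeffDiff_mul_fourier (hq : IsSymbol d M q) (hM : 0 < M) (L N : ℕ) {t : ℝ}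
    (ht : 0 < t) (x : UnitAddCircle) :
    ∑' k, coeffDiff q L N t k * fourier k x =
      (fourier (-1) x - 1) ^ N * expSeries q (X ^ L) t x := by
  have h := hq.summable hM (X ^ L) ht
  simp only [expSeries]
  simp only [eval_X_pow_mul_exp] at h ⊢
  exact tsum_fwdDiff_iter_mul_fourier h x N

/-- For `|k| < 2N` the interval `[k, k + N]` may come close to `0`, where `ξ ^ (L - N)` is singular.
There the coefficients themselves are at most `(3N) ^ L`, and `N` differences cost `2 ^ N`. -/
lemma exists_norm_coeffDiff_le (d : ℕ) {M : ℝ} (hM : 0 < M) {L N : ℕ} (hLN : L < N) :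
    ∃ A B c : ℝ, 0 ≤ A ∧ 0 ≤ B ∧ 0 < c ∧ ∀ q, IsSymbol d M q → ∀ t : ℝ, 0 < t → ∀ k : ℤ,
      ‖coeffDiff q L N t k‖ ≤ (if k.natAbs < 2 * N then B else 0) +
        A * ((k.natAbs : ℝ) ^ ((L : ℤ) - N) * (t * absEval q k.natAbs *
          Real.exp (-(c * (t * absEval q k.natAbs))))) := by
  obtain ⟨A, c, hA, hc, h⟩ := exists_abs_fwdDiff_expCoeff_le d hM hLN
  refine ⟨A, 2 ^ N * (3 * N) ^ L, c, hA, by positivity, hc, fun q hq t ht k => ?_⟩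
  have habs : ((k.natAbs : ℕ) : ℝ) = |(k : ℝ)| := by rw [Nat.cast_natAbs]; push_cast; rfl
  have hnn : 0 ≤ A * ((k.natAbs : ℝ) ^ ((L : ℤ) - N) * (t * absEval q k.natAbs *
          Real.exp (-(c * (t * absEval q k.natAbs))))) := by
    have := absEval_nonneg q (Nat.cast_nonneg (α := ℝ) k.natAbs)
    positivity
  split_ifs with hk
  · refine le_add_of_le_of_nonneg ?_ hnn
    refine norm_fwdDiff_iter_le_of_bdd N fun j h1 h2 => ?_
    have hj : |(j : ℝ)| ≤ 3 * N := by
      have : |j| ≤ 3 * N := by rw [abs_le]; omega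
      exact_mod_cast this
    rw [Complex.norm_real, Real.norm_eq_abs, expCoeff, abs_mul, Real.abs_exp, abs_pow]
    calc |(j : ℝ)| ^ L * Real.exp (-(q.eval (j : ℝ) * t)) ≤ (3 * N) ^ L * 1 := by
          gcongr
          rw [Real.exp_le_one_iff, neg_nonpos]
          exact mul_nonneg (hq.eval_nonneg hM _) ht.le
      _ = _ := mul_one _
  · rw [zero_add, coeffDiff, fwdDiff_iter_intCast, Complex.norm_real, Real.norm_eq_abs, habs]
    refine h q hq t ht k ?_
    rw [← habs]
    exact_mod_cast (not_lt.1 hk)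

/-- Decay of the series in the spatial variable, uniformly in the symbol and in time. -/
lemma exists_norm_pow_mul_expSeries_le (d : ℕ) {M : ℝ} (hM : 0 < M) (L : ℕ) :
    ∃ B : ℝ, 0 ≤ B ∧ ∀ q, IsSymbol d M q → ∀ t : ℝ, 0 < t → ∀ x : UnitAddCircle,
      ‖x‖ ^ (L + 1) * ‖expSeries q (X ^ L) t x‖ ≤ B := by
  -- Exactly `L + 1` differences are taken: the resulting weight `|k|⁻¹` is the one of the Riemann
  -- sum, and the prefactor gives the power `‖x‖ ^ (L + 1)`.
  obtain ⟨A, B, c, hA, hB, hc, h⟩ := exists_norm_coeffDiff_le d hM (Nat.lt_succ_self L)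
  refine ⟨2 * ((2 * (L + 1) : ℕ) * B + A * (1 / c)), by positivity, fun q hq t ht x => ?_⟩
  have h1 : ‖∑' k, coeffDiff q L (L + 1) t k * fourier k x‖ ≤
      2 * ((2 * (L + 1) : ℕ) * B + A * (1 / c)) := by
    refine (summable_and_norm_tsum_int_le (g := fun n => (if n < 2 * (L + 1) then B else 0) +
        A * ((t * absEval q n) / n * Real.exp (-(c * (t * absEval q n))))) (fun k => ?_)
        fun n => ?_).2
    · rw [norm_mul, norm_fourier_apply, mul_one]
      refine (h q hq t ht k).trans (le_of_eq ?_)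
      have e : (L : ℤ) - ((L + 1 : ℕ) : ℤ) = -1 := by push_cast; ring
      rw [Nat.succ_eq_add_one, e, zpow_neg_one]
      ring
    · rw [Finset.sum_add_distrib, ← Finset.mul_sum]
      refine add_le_add ?_ (mul_le_mul_of_nonneg_left (sum_range_div_mul_exp_le
        (W := fun n => t * absEval q n) (fun n => ?_) (fun n => ?_) hc n) hA)
      · rw [← Finset.sum_filter, Finset.sum_const, nsmul_eq_mul]
        gcongr
        calc _ ≤ (Finset.range (2 * (L + 1))).card := Finset.card_le_card fun i hi => by
              simp only [Finset.mem_filter, Finset.mem_range] at hi ⊢; exact hi.2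
          _ = _ := Finset.card_range _
      · exact mul_nonneg ht.le (absEval_nonneg q (Nat.cast_nonneg n))
      · have := mul_le_mul_of_nonneg_left (hq.step n) ht.le
        calc _ = t * ((n + 1) * absEval q n) := by ring
          _ ≤ _ := this
          _ = _ := by ring
  rw [tsum_coeffDiff_mul_fourier hq hM L (L + 1) ht x, norm_mul, norm_pow] at h1
  refine le_trans ?_ h1
  gcongr
  linarith [four_mul_norm_le x, norm_nonneg x]

/-- Decay of the series in time, uniformly in the symbol and in space. -/
lemma exists_sqrt_pow_mul_expSeries_le (d : ℕ) {M : ℝ} (hM : 0 < M) (L : ℕ) :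
    ∃ B : ℝ, 0 ≤ B ∧ ∀ q, IsSymbol d M q → ∀ t : ℝ, 0 < t → ∀ x : UnitAddCircle,
      √t ^ (L + 2) * ‖expSeries q (X ^ (L + 1)) t x‖ ≤ B := by
  obtain ⟨B, hB, h⟩ := exists_pow_mul_exp_neg_le L (c := 1 / (2 * M) * 2) (by positivity)
  refine ⟨2 * (Real.exp (1 / (2 * M)) * B * (1 / (1 / (2 * M)))), by positivity,
    fun q hq t ht x => ?_⟩
  set s := √t with hs
  have hs0 : 0 < s := Real.sqrt_pos.2 ht
  have hst : s ^ 2 = t := Real.sq_sqrt ht.le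
  have h1 : ‖∑' k : ℤ, ((s : ℂ) ^ (L + 2) * ((X ^ (L + 1) : ℂ[X]).eval (k : ℂ) *
      (Real.exp (-(q.eval (k : ℝ) * t)) : ℂ) * fourier k x))‖ ≤
      2 * (Real.exp (1 / (2 * M)) * B * (1 / (1 / (2 * M)))) := by
    refine (summable_and_norm_tsum_int_le (g := fun n => Real.exp (1 / (2 * M)) * B *
      ((s ^ 2 * (n : ℝ) ^ 2) / n * Real.exp (-(1 / (2 * M) * (s ^ 2 * (n : ℝ) ^ 2)))))
      (fun k => ?_) fun n => ?_).2
    · have habs : ((k.natAbs : ℕ) : ℝ) = |(k : ℝ)| := by rw [Nat.cast_natAbs]; push_cast; rfl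
      have h2 := hq.norm_term_le hM (X ^ (L + 1)) ht.le le_rfl k
      rw [norm_mul, norm_mul, norm_fourier_apply, mul_one, norm_pow, Complex.norm_real,
        Real.norm_eq_abs, abs_of_pos hs0]
      rw [eval_pow, eval_X, norm_pow, Complex.norm_intCast, ← sq_abs, ← habs] at h2
      rw [eval_pow, eval_X]
      generalize k.natAbs = n at h2
      refine (mul_le_mul_of_nonneg_left h2 (by positivity)).trans ?_
      rcases Nat.eq_zero_or_pos n with rfl | hn
      · simp
      have hn' : (0 : ℝ) < n := by exact_mod_cast hn
      have h3 := h (s * n) (by positivity)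
      -- Half of the Gaussian is linearized by `u² ≥ 2u - 1` with `u = sn`, to absorb `u ^ L`; the
      -- other half is kept for the Riemann sum with `W n = s² n²`.
      have h4 : Real.exp (-(t / M * (n : ℝ) ^ 2)) ≤ Real.exp (1 / (2 * M)) *
          Real.exp (-(1 / (2 * M) * 2 * (s * n))) *
            Real.exp (-(1 / (2 * M) * (s ^ 2 * (n : ℝ) ^ 2))) := by
        rw [← Real.exp_add, ← Real.exp_add]
        gcongr
        have : t / M * (n : ℝ) ^ 2 = 1 / (2 * M) * (s * n) ^ 2 +
            1 / (2 * M) * (s ^ 2 * (n : ℝ) ^ 2) := by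
          rw [← hst]; field_simp; ring
        have h5 : 0 ≤ 1 / (2 * M) * (s * n - 1) ^ 2 := by positivity
        nlinarith
      calc s ^ (L + 2) * ((n : ℝ) ^ (L + 1) * Real.exp (-(t / M * (n : ℝ) ^ 2)))
          ≤ s ^ (L + 2) * ((n : ℝ) ^ (L + 1) * (Real.exp (1 / (2 * M)) *
          Real.exp (-(1 / (2 * M) * 2 * (s * n))) *
            Real.exp (-(1 / (2 * M) * (s ^ 2 * (n : ℝ) ^ 2))))) := by gcongr
        _ = Real.exp (1 / (2 * M)) * ((s * n) ^ L * Real.exp (-(1 / (2 * M) * 2 * (s * n)))) *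
            ((s ^ 2 * (n : ℝ) ^ 2) / n * Real.exp (-(1 / (2 * M) * (s ^ 2 * (n : ℝ) ^ 2)))) := by
          field_simp
          ring
        _ ≤ _ := by gcongr
    · rw [← Finset.mul_sum]
      refine mul_le_mul_of_nonneg_left (sum_range_div_mul_exp_le
        (W := fun n => s ^ 2 * (n : ℝ) ^ 2) (fun n => by positivity) (fun n => ?_)
          (by positivity) n) (by positivity)
      push_cast
      have : (0 : ℝ) ≤ s ^ 2 * n * (n + 1) := by positivity
      nlinarith
  rw [tsum_mul_left, norm_mul, norm_pow, Complex.norm_real, Real.norm_eq_abs,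
    abs_of_pos hs0] at h1
  exact h1

lemma exists_sqrt_mul_expSeries_sub_one_le (d : ℕ) {M : ℝ} (hM : 0 < M) :
    ∃ B : ℝ, 0 ≤ B ∧ ∀ q, IsSymbol d M q → ∀ t : ℝ, 0 < t → ∀ x : UnitAddCircle,
      √t * ‖expSeries q 1 t x - 1‖ ≤ B := by
  refine ⟨2 * (Real.exp (M / 4) * (1 / 1)), by positivity, fun q hq t ht x => ?_⟩
  set s := √t with hs
  have hs0 : 0 < s := Real.sqrt_pos.2 ht
  have hst : s ^ 2 = t := Real.sq_sqrt ht.le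
  -- The mode `k = 0` equals `1` at all times because `q(0) = 0`; only the remaining modes decay.
  have h0 : expSeries q 1 t x - 1 = ∑' k : ℤ, if k = 0 then 0 else
      ((1 : ℂ[X]).eval (k : ℂ) * (Real.exp (-(q.eval (k : ℝ) * t)) : ℂ) * fourier k x) := by
    rw [expSeries, (summable_mul_fourier (hq.summable hM 1 ht) x).tsum_eq_add_tsum_ite 0]
    simp [hq.eval_zero]
  have h1 : ‖∑' k : ℤ, ((s : ℂ) * (if k = 0 then 0 else
      ((1 : ℂ[X]).eval (k : ℂ) * (Real.exp (-(q.eval (k : ℝ) * t)) : ℂ) * fourier k x)))‖ ≤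
      2 * (Real.exp (M / 4) * (1 / 1)) := by
    refine (summable_and_norm_tsum_int_le (g := fun n => Real.exp (M / 4) *
      ((s * (n : ℝ)) / n * Real.exp (-(1 * (s * (n : ℝ)))))) (fun k => ?_) fun n => ?_).2
    · have habs : ((k.natAbs : ℕ) : ℝ) = |(k : ℝ)| := by rw [Nat.cast_natAbs]; push_cast; rfl
      split_ifs with hk
      · simp [hk]
      have h2 := hq.norm_term_le hM 1 ht.le le_rfl k
      rw [norm_mul, norm_mul, norm_fourier_apply, mul_one, Complex.norm_real,
        Real.norm_eq_abs, abs_of_pos hs0]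
      rw [← sq_abs, ← habs] at h2
      simp only [eval_one, norm_one, one_mul] at h2 ⊢
      have hn : 0 < k.natAbs := Int.natAbs_pos.2 hk
      generalize k.natAbs = n at h2 hn
      have hn' : (0 : ℝ) < n := by exact_mod_cast hn
      -- Completing the square, `u² / M ≥ u - M / 4` with `u = sn`.
      have h4 : Real.exp (-(t / M * (n : ℝ) ^ 2)) ≤ Real.exp (M / 4) * Real.exp (-(s * n)) := by
        rw [← Real.exp_add]
        gcongr
        have : t / M * (n : ℝ) ^ 2 = 1 / M * (s * n) ^ 2 := by rw [← hst]; field_simp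
        have h5 : 0 ≤ 1 / M * (s * n - M / 2) ^ 2 := by positivity
        have h6 : 1 / M * (s * n - M / 2) ^ 2 = 1 / M * (s * n) ^ 2 - s * n + M / 4 := by
          field_simp; ring
        linarith
      calc _ ≤ s * (Real.exp (M / 4) * Real.exp (-(s * n))) := by gcongr; exact h2.trans h4
        _ = _ := by field_simp
    · rw [← Finset.mul_sum]
      refine mul_le_mul_of_nonneg_left (sum_range_div_mul_exp_le
        (W := fun n => s * (n : ℝ)) (fun n => by positivity) (fun n => ?_)
          (by positivity) n) (by positivity)
      push_cast
      exact le_of_eq (by ring)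
  rw [tsum_mul_left, norm_mul, Complex.norm_real, Real.norm_eq_abs, abs_of_pos hs0, ← h0] at h1
  exact h1

/-- The series tends to zero at initial time away from the origin of the circle. -/
lemma tendsto_expSeries_X_pow (hq : IsSymbol d M q) (hM : 0 < M) (L : ℕ) {x : UnitAddCircle}
    (hx : x ≠ 0) :
    Filter.Tendsto (fun t => expSeries q (X ^ L) t x) (nhdsWithin 0 (Set.Ioi 0)) (nhds 0) := by
  -- One difference more than for the bound: the weight `|k|⁻²` is summable, which gives a majorant
  -- independent of `t`.
  obtain ⟨A, B, c, hA, hB, hc, h⟩ := exists_norm_coeffDiff_le d hM (show L < L + 2 by omega)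
  obtain ⟨B₁, hB₁, h₁⟩ := exists_pow_mul_exp_neg_le 1 hc
  set N := L + 2 with hN
  have hne : (fourier (-1) x - 1 : ℂ) ^ N ≠ 0 := by
    refine pow_ne_zero _ (norm_pos_iff.1 ?_)
    have := four_mul_norm_le x
    have := norm_pos_iff.2 hx
    linarith
  have hlim : Filter.Tendsto (fun t => ∑' k, coeffDiff q L N t k * fourier k x)
      (nhdsWithin 0 (Set.Ioi 0)) (nhds (∑' k : ℤ, (0 : ℂ))) := by
    refine tendsto_tsum_of_dominated_convergence (bound := fun k : ℤ =>
      (if k.natAbs < 2 * N then B else 0) + A * B₁ * (1 / (k : ℝ) ^ 2)) ?_ (fun k => ?_) ?_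
    · refine Summable.add ?_ ((Real.summable_one_div_int_pow.2 (by norm_num)).mul_left _)
      refine summable_of_ne_finset_zero (s := Finset.Icc (-(2 * N : ℤ)) (2 * N)) fun k hk => ?_
      rw [if_neg]
      intro hk'
      exact hk (Finset.mem_Icc.2 ⟨by omega, by omega⟩)
    · have hzero : (fwdDiff (1 : ℝ))^[N] (fun y : ℝ => y ^ L) = 0 :=
        fwdDiff_iter_pow_eq_zero_of_lt (by omega)
      have h3 : Filter.Tendsto (fun t => (fwdDiff (1 : ℝ))^[N] (expCoeff q L t) k)
          (nhdsWithin 0 (Set.Ioi 0)) (nhds ((fwdDiff (1 : ℝ))^[N] (fun y : ℝ => y ^ L) k)) := by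
        simp only [fwdDiff_iter_eq_sum_shift]
        refine tendsto_finsetSum _ fun i _ => Filter.Tendsto.const_smul ?_ _
        have : Continuous fun t : ℝ => expCoeff q L t (k + i • (1 : ℝ)) := by
          unfold expCoeff; fun_prop
        have h4 := (this.tendsto 0).mono_left (nhdsWithin_le_nhds (s := Set.Ioi 0))
        simpa [expCoeff] using h4
      rw [hzero] at h3
      have h4 : Filter.Tendsto (fun t => coeffDiff q L N t k) (nhdsWithin 0 (Set.Ioi 0))
          (nhds ((0 : ℝ) : ℂ)) := by
        simp only [coeffDiff, fwdDiff_iter_intCast]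
        exact (Complex.continuous_ofReal.tendsto 0).comp h3
      simpa using h4.mul_const (fourier k x : ℂ)
    · filter_upwards [self_mem_nhdsWithin] with t ht k
      rw [norm_mul, norm_fourier_apply, mul_one]
      refine (h q hq t ht k).trans ?_
      gcongr _ + ?_
      have habs : ((k.natAbs : ℕ) : ℝ) = |(k : ℝ)| := by rw [Nat.cast_natAbs]; push_cast; rfl
      have hW := mul_nonneg (le_of_lt ht) (absEval_nonneg q (Nat.cast_nonneg (α := ℝ) k.natAbs))
      have h5 := h₁ _ hW
      have e : (L : ℤ) - (N : ℤ) = -2 := by rw [hN]; push_cast; ring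
      rw [e, zpow_neg, mul_assoc A B₁]
      refine mul_le_mul_of_nonneg_left ?_ hA
      rw [mul_comm]
      rw [pow_one] at h5
      refine mul_le_mul h5 ?_ (by positivity) hB₁
      rw [habs, one_div]
      norm_cast
      simp
  rw [tsum_zero] at hlim
  have h6 := hlim.const_mul ((fourier (-1) x - 1 : ℂ) ^ N)⁻¹
  rw [mul_zero] at h6
  refine h6.congr' ?_
  filter_upwards [self_mem_nhdsWithin] with t ht
  rw [tsum_coeffDiff_mul_fourier hq hM L N ht x, inv_mul_cancel_left₀ hne]

/-- Parabolic decay of the series. -/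
lemma exists_norm_expSeries_le (d : ℕ) {M : ℝ} (hM : 0 < M) {L : ℕ} (hL : 1 ≤ L) :
    ∃ B : ℝ, 0 ≤ B ∧ ∀ q, IsSymbol d M q → ∀ t : ℝ, 0 < t → ∀ x : UnitAddCircle,
      ‖expSeries q (X ^ L) t x‖ ≤ B * ((√t + ‖x‖) ^ (L + 1))⁻¹ := by
  obtain ⟨B₁, h0₁, h₁⟩ := exists_norm_pow_mul_expSeries_le d hM L
  obtain ⟨B₂, h0₂, h₂⟩ := exists_sqrt_pow_mul_expSeries_le d hM (L - 1)
  refine ⟨2 ^ L * (B₂ + B₁), by positivity, fun q hq t ht x => ?_⟩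
  have h3 := h₁ q hq t ht x
  have h4 := h₂ q hq t ht x
  rw [show L - 1 + 2 = L + 1 by omega, show L - 1 + 1 = L by omega] at h4
  have hs : 0 < √t := Real.sqrt_pos.2 ht
  rw [← div_eq_mul_inv, le_div_iff₀ (by positivity), mul_comm]
  calc (√t + ‖x‖) ^ (L + 1) * ‖expSeries q (X ^ L) t x‖
      ≤ (2 ^ (L + 1 - 1) * (√t ^ (L + 1) + ‖x‖ ^ (L + 1))) * ‖expSeries q (X ^ L) t x‖ := by
        gcongr; exact add_pow_le hs.le (norm_nonneg x) _
    _ = 2 ^ L * (√t ^ (L + 1) * ‖expSeries q (X ^ L) t x‖ +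
        ‖x‖ ^ (L + 1) * ‖expSeries q (X ^ L) t x‖) := by rw [Nat.add_sub_cancel]; ring
    _ ≤ _ := by gcongr

lemma exists_norm_expSeries_one_le (d : ℕ) {M : ℝ} (hM : 0 < M) :
    ∃ B : ℝ, 0 ≤ B ∧ ∀ q, IsSymbol d M q → ∀ t : ℝ, 0 < t → ∀ x : UnitAddCircle,
      ‖expSeries q 1 t x‖ ≤ B * (1 + (√t + ‖x‖)⁻¹) := by
  obtain ⟨B₁, h0₁, h₁⟩ := exists_norm_pow_mul_expSeries_le d hM 0
  obtain ⟨B₂, h0₂, h₂⟩ := exists_sqrt_mul_expSeries_sub_one_le d hM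
  refine ⟨B₂ + B₁ + 1, by positivity, fun q hq t ht x => ?_⟩
  have h3 := h₁ q hq t ht x
  have h4 := h₂ q hq t ht x
  rw [pow_zero, zero_add, pow_one] at h3
  have hs : 0 < √t := Real.sqrt_pos.2 ht
  have hρ : 0 < √t + ‖x‖ := by positivity
  have h5 : ‖expSeries q 1 t x‖ ≤ ‖expSeries q 1 t x - 1‖ + 1 := by
    have := norm_add_le (expSeries q 1 t x - 1) 1
    simpa using this
  have h6 : (√t + ‖x‖) * ‖expSeries q 1 t x‖ ≤ (B₂ + B₁ + 1) * (√t + ‖x‖ + 1) := by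
    have := mul_le_mul_of_nonneg_left h5 hs.le
    nlinarith [norm_nonneg x]
  calc ‖expSeries q 1 t x‖ = ((√t + ‖x‖) * ‖expSeries q 1 t x‖) * (√t + ‖x‖)⁻¹ := by field_simp
    _ ≤ ((B₂ + B₁ + 1) * (√t + ‖x‖ + 1)) * (√t + ‖x‖)⁻¹ := by gcongr
    _ = _ := by field_simp

end Symbol

/-! ### The derivatives of the exponential series -/

/-- The factor by which `∂₀` acts on the coefficients. -/
def timeFactor (q : ℝ[X]) : ℂ[X] := -(q.map Complex.ofRealHom)

/-- The factor by which `∂₁` acts on the coefficients. -/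
def spaceFactor : ℂ[X] := C (2 * Real.pi * Complex.I) * X

lemma eval_timeFactor (q : ℝ[X]) (k : ℤ) :
    (timeFactor q).eval (k : ℂ) = -((q.eval (k : ℝ) : ℝ) : ℂ) := by
  have h := Polynomial.eval_map_apply (p := q) Complex.ofRealHom (k : ℝ)
  rw [timeFactor, eval_neg, ← Complex.ofRealHom_eq_coe, ← h]
  simp

lemma eval_spaceFactor (k : ℤ) :
    spaceFactor.eval (k : ℂ) = 2 * Real.pi * Complex.I * k := by
  simp [spaceFactor]

/-- The lift of the exponential series to `ℝ × ℝ`, extended by zero to nonpositive times. -/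
def expKernel (q : ℝ[X]) (p : ℂ[X]) (z : ℝ × ℝ) : ℂ :=
  if 0 < z.1 then expSeries q p z.1 (z.2 : UnitAddCircle) else 0

lemma expKernel_of_pos (q : ℝ[X]) (p : ℂ[X]) {z : ℝ × ℝ} (hz : 0 < z.1) :
    expKernel q p z = expSeries q p z.1 (z.2 : UnitAddCircle) := if_pos hz

lemma expKernel_of_nonpos (q : ℝ[X]) (p : ℂ[X]) {z : ℝ × ℝ} (hz : z.1 ≤ 0) :
    expKernel q p z = 0 := if_neg hz.not_gt

/-- The continuous linear map `(s, y) ↦ s • a + y • b`. -/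
def pairCLM (a b : ℂ) : ℝ × ℝ →L[ℝ] ℂ :=
  ContinuousLinearMap.smulRightL ℝ (ℝ × ℝ) ℂ (ContinuousLinearMap.fst ℝ ℝ ℝ) a +
    ContinuousLinearMap.smulRightL ℝ (ℝ × ℝ) ℂ (ContinuousLinearMap.snd ℝ ℝ ℝ) b

lemma pairCLM_apply (a b : ℂ) (z : ℝ × ℝ) : pairCLM a b z = z.1 • a + z.2 • b := rfl

lemma norm_pairCLM_le (a b : ℂ) : ‖pairCLM a b‖ ≤ ‖a‖ + ‖b‖ := by
  refine ContinuousLinearMap.opNorm_le_bound _ (by positivity) fun z => ?_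
  rw [pairCLM_apply, add_mul]
  refine (norm_add_le _ _).trans ?_
  rw [norm_smul, norm_smul]
  have h1 := norm_fst_le z
  have h2 := norm_snd_le z
  rw [mul_comm ‖z.1‖, mul_comm ‖z.2‖]
  gcongr

lemma hasSum_pairCLM {a b : ℤ → ℂ} (ha : Summable a) (hb : Summable b) :
    HasSum (fun k => pairCLM (a k) (b k)) (pairCLM (∑' k, a k) (∑' k, b k)) :=
  ((ContinuousLinearMap.smulRightL ℝ (ℝ × ℝ) ℂ (ContinuousLinearMap.fst ℝ ℝ ℝ)).hasSum
    ha.hasSum).add ((ContinuousLinearMap.smulRightL ℝ (ℝ × ℝ) ℂ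
      (ContinuousLinearMap.snd ℝ ℝ ℝ)).hasSum hb.hasSum)

/-- The complement of the origin of `ℝ × 𝕋`, lifted to `ℝ × ℝ`. -/
def offOrigin : Set (ℝ × ℝ) := {p | ((p.1, (p.2 : UnitAddCircle)) : SpaceTime) ≠ 0}

lemma continuous_spaceProj :
    Continuous fun p : ℝ × ℝ => ((p.1, (p.2 : UnitAddCircle)) : SpaceTime) :=
  continuous_fst.prodMk ((AddCircle.continuous_mk' 1).comp continuous_snd)

lemma isOpen_offOrigin : IsOpen offOrigin := isOpen_ne.preimage continuous_spaceProj

section Symbol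

variable {d : ℕ} {M : ℝ} {q : ℝ[X]}

lemma hasFDerivAt_term (q : ℝ[X]) (p : ℂ[X]) (k : ℤ) (z : ℝ × ℝ) :
    HasFDerivAt (fun z : ℝ × ℝ => p.eval (k : ℂ) * (Real.exp (-(q.eval (k : ℝ) * z.1)) : ℂ) *
        fourier k (z.2 : UnitAddCircle))
      (pairCLM ((timeFactor q * p).eval (k : ℂ) * (Real.exp (-(q.eval (k : ℝ) * z.1)) : ℂ) *
        fourier k (z.2 : UnitAddCircle))
        ((spaceFactor * p).eval (k : ℂ) * (Real.exp (-(q.eval (k : ℝ) * z.1)) : ℂ) *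
        fourier k (z.2 : UnitAddCircle))) z := by
  have h1 : HasDerivAt (fun s : ℝ => (Real.exp (-(q.eval (k : ℝ) * s)) : ℂ))
      ((Real.exp (-(q.eval (k : ℝ) * z.1)) * -(q.eval (k : ℝ) * 1) : ℝ) : ℂ) z.1 :=
    ((((hasDerivAt_id z.1).const_mul (q.eval (k : ℝ))).neg).exp).ofReal_comp
  have h2 := hasDerivAt_fourier 1 k z.2
  have h1' := h1.hasFDerivAt.comp z (hasFDerivAt_fst (𝕜 := ℝ) (E := ℝ) (F := ℝ) (p := z))
  have h2' := h2.hasFDerivAt.comp z (hasFDerivAt_snd (𝕜 := ℝ) (E := ℝ) (F := ℝ) (p := z))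
  refine ((h1'.const_mul (p.eval (k : ℂ))).mul h2').congr_fderiv ?_
  ext <;>
  · simp [pairCLM_apply, eval_timeFactor, eval_spaceFactor]
    try ring

lemma hasFDerivAt_expKernel_of_pos (hq : IsSymbol d M q) (hM : 0 < M) (p : ℂ[X]) {z : ℝ × ℝ}
    (hz : 0 < z.1) : HasFDerivAt (expKernel q p)
      (pairCLM (expKernel q (timeFactor q * p) z) (expKernel q (spaceFactor * p) z)) z := by
  -- On the half-plane of times larger than `z.1 / 2` the differentiated terms have a common
  -- Gaussian majorant, so the series may be differentiated termwise.
  have hz2 : 0 < z.1 / 2 := by positivity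
  have hs : IsOpen {w : ℝ × ℝ | z.1 / 2 < w.1} := isOpen_lt continuous_const continuous_fst
  have hc : Convex ℝ {w : ℝ × ℝ | z.1 / 2 < w.1} :=
    convex_halfSpace_gt (f := fun w : ℝ × ℝ => w.1) ⟨fun _ _ => rfl, fun _ _ => rfl⟩ _
  have hzs : z ∈ {w : ℝ × ℝ | z.1 / 2 < w.1} := by simp only [Set.mem_ofPred_eq]; linarith
  have hsum := ((summable_norm_eval_mul_exp (timeFactor q * p) (div_pos hz2 hM)).add
    (summable_norm_eval_mul_exp (spaceFactor * p) (div_pos hz2 hM)))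
  have h := hasFDerivAt_tsum_of_isPreconnected (𝕜 := ℝ) hsum hs hc.isPreconnected
    (fun k w _ => hasFDerivAt_term q p k w) (fun k w hw => ?_) hzs
    (summable_mul_fourier (hq.summable hM p hz) (z.2 : UnitAddCircle)) hzs
  · rw [(hasSum_pairCLM (summable_mul_fourier (hq.summable hM _ hz) (z.2 : UnitAddCircle))
      (summable_mul_fourier (hq.summable hM _ hz) (z.2 : UnitAddCircle))).tsum_eq] at h
    rw [expKernel_of_pos _ _ hz, expKernel_of_pos _ _ hz]
    refine h.congr_of_eventuallyEq ?_
    filter_upwards [hs.mem_nhds hzs] with w hw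
    exact expKernel_of_pos q p (hz2.trans hw)
  · refine (norm_pairCLM_le _ _).trans (add_le_add ?_ ?_) <;>
    · rw [norm_mul, norm_fourier_apply, mul_one]
      exact hq.norm_term_le hM _ hz2.le (le_of_lt hw) k

lemma hasDerivAt_expSeries_time (hq : IsSymbol d M q) (hM : 0 < M) (p : ℂ[X]) {t : ℝ}
    (ht : 0 < t) (x : UnitAddCircle) :
    HasDerivAt (fun s => expSeries q p s x) (expSeries q (timeFactor q * p) t x) t := by
  obtain ⟨r, rfl, -, -⟩ := exists_real_rep x
  have h := (hasFDerivAt_expKernel_of_pos hq hM p (z := (t, r)) ht).comp_hasDerivAt t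
    ((hasDerivAt_id t).prodMk (hasDerivAt_const t r))
  rw [pairCLM_apply, expKernel_of_pos _ _ (z := (t, r)) ht] at h
  simp only [one_smul, zero_smul, add_zero] at h
  refine h.congr_of_eventuallyEq ?_
  filter_upwards [lt_mem_nhds ht] with s hs
  exact (expKernel_of_pos q p (z := (s, r)) hs).symm

/-! ### Vanishing at initial time and smoothness off the origin. -/

lemma exists_norm_expSeries_le_of_le_norm (hq : IsSymbol d M q) (hM : 0 < M) (p : ℂ[X]) {δ : ℝ}
    (hδ : 0 < δ) : ∃ B : ℝ, 0 ≤ B ∧ ∀ t : ℝ, 0 < t → ∀ x : UnitAddCircle, δ ≤ ‖x‖ →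
      ‖expSeries q p t x‖ ≤ B := by
  choose B hB h using fun L => exists_norm_pow_mul_expSeries_le d hM L
  refine ⟨∑ j ∈ Finset.range (p.natDegree + 1), ‖p.coeff j‖ * (B j / δ ^ (j + 1)),
    Finset.sum_nonneg fun j _ => by have := hB j; positivity, fun t ht x hx => ?_⟩
  rw [expSeries_eq_sum hq hM p ht x (Nat.lt_succ_self _)]
  refine (norm_sum_le _ _).trans (Finset.sum_le_sum fun j _ => ?_)
  rw [norm_mul]
  gcongr
  rw [le_div_iff₀ (by positivity), mul_comm]
  refine le_trans ?_ (h j q hq t ht x)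
  gcongr

lemma tendsto_expSeries (hq : IsSymbol d M q) (hM : 0 < M) (p : ℂ[X]) {x : UnitAddCircle}
    (hx : x ≠ 0) :
    Filter.Tendsto (fun t => expSeries q p t x) (nhdsWithin 0 (Set.Ioi 0)) (nhds 0) := by
  have h : Filter.Tendsto (fun t => ∑ j ∈ Finset.range (p.natDegree + 1),
      p.coeff j * expSeries q (X ^ j) t x) (nhdsWithin 0 (Set.Ioi 0))
      (nhds (∑ j ∈ Finset.range (p.natDegree + 1), p.coeff j * 0)) :=
    tendsto_finsetSum _ fun j _ => (tendsto_expSeries_X_pow hq hM j hx).const_mul _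
  simp only [mul_zero, Finset.sum_const_zero] at h
  refine h.congr' ?_
  filter_upwards [self_mem_nhdsWithin] with t ht
  exact (expSeries_eq_sum hq hM p ht x (Nat.lt_succ_self _)).symm

/-- Mean value theorem between `s` and `t`, then `s ↓ 0`, where the series tends to zero. -/
lemma norm_expSeries_le_of_timeDeriv_le (hq : IsSymbol d M q) (hM : 0 < M) (p : ℂ[X])
    {x : UnitAddCircle} (hx : x ≠ 0) {t C : ℝ} (ht : 0 < t)
    (hC : ∀ s ∈ Set.Ioc 0 t, ‖expSeries q (timeFactor q * p) s x‖ ≤ C) :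
    ‖expSeries q p t x‖ ≤ C * t := by
  have h1 : ∀ s ∈ Set.Ioc 0 t, ‖expSeries q p t x - expSeries q p s x‖ ≤ C * t := by
    intro s hs
    have h2 := (convex_Ioc (0 : ℝ) t).norm_image_sub_le_of_norm_hasDerivWithin_le
      (fun s hs => (hasDerivAt_expSeries_time hq hM p hs.1 x).hasDerivWithinAt) hC hs
      (Set.right_mem_Ioc.2 ht)
    refine h2.trans ?_
    have hC0 : 0 ≤ C := (norm_nonneg _).trans (hC s hs)
    gcongr
    rw [Real.norm_eq_abs, abs_of_nonneg (by linarith [hs.2])]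
    linarith [hs.1]
  have h3 : Filter.Tendsto (fun s => ‖expSeries q p t x - expSeries q p s x‖)
      (nhdsWithin 0 (Set.Ioi 0)) (nhds ‖expSeries q p t x - 0‖) :=
    (tendsto_const_nhds.sub (tendsto_expSeries hq hM p hx)).norm
  rw [sub_zero] at h3
  refine le_of_tendsto h3 ?_
  filter_upwards [Ioc_mem_nhdsGT ht] with s hs using h1 s hs

/-- Two integrations in time of a bounded second time derivative. Quadratic vanishing is what makes
the extension by zero differentiable on the line `t = 0`. -/
lemma exists_norm_expSeries_le_sq (hq : IsSymbol d M q) (hM : 0 < M) (p : ℂ[X]) {δ : ℝ}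
    (hδ : 0 < δ) : ∃ B : ℝ, 0 ≤ B ∧ ∀ t : ℝ, 0 < t → ∀ x : UnitAddCircle, δ ≤ ‖x‖ →
      ‖expSeries q p t x‖ ≤ B * t ^ 2 := by
  obtain ⟨B, hB, h⟩ := exists_norm_expSeries_le_of_le_norm hq hM
    (timeFactor q * (timeFactor q * p)) hδ
  refine ⟨B, hB, fun t ht x hx => ?_⟩
  have hx0 : x ≠ 0 := norm_pos_iff.1 (hδ.trans_le hx)
  rw [pow_two, ← mul_assoc]
  refine norm_expSeries_le_of_timeDeriv_le hq hM p hx0 ht fun s hs => ?_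
  refine (norm_expSeries_le_of_timeDeriv_le hq hM _ hx0 hs.1 fun r hr => h r hr.1 x hx).trans ?_
  gcongr
  exact hs.2

/-- The kernels form a family closed under differentiation, and the same formula holds below, on and
above the line `t = 0` away from the origin. -/
lemma hasFDerivAt_expKernel (hq : IsSymbol d M q) (hM : 0 < M) (p : ℂ[X]) {z : ℝ × ℝ}
    (hz : z ∈ offOrigin) : HasFDerivAt (expKernel q p)
      (pairCLM (expKernel q (timeFactor q * p) z) (expKernel q (spaceFactor * p) z)) z := by
  rcases lt_trichotomy z.1 0 with h | h | h
  · rw [expKernel_of_nonpos _ _ h.le, expKernel_of_nonpos _ _ h.le]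
    have h0 : pairCLM 0 0 = 0 := by ext <;> simp [pairCLM_apply]
    rw [h0]
    refine (hasFDerivAt_const (0 : ℂ) z).congr_of_eventuallyEq ?_
    filter_upwards [(isOpen_lt continuous_fst continuous_const).mem_nhds h] with w hw
    exact expKernel_of_nonpos q p (le_of_lt hw)
  · rw [expKernel_of_nonpos _ _ h.le, expKernel_of_nonpos _ _ h.le]
    have h0 : pairCLM 0 0 = 0 := by ext <;> simp [pairCLM_apply]
    rw [h0]
    have hx : (z.2 : UnitAddCircle) ≠ 0 := fun hx => hz (by rw [h, hx]; rfl)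
    have hδ : 0 < ‖(z.2 : UnitAddCircle)‖ / 2 := half_pos (norm_pos_iff.2 hx)
    obtain ⟨B, hB, hb⟩ := exists_norm_expSeries_le_sq hq hM p hδ
    -- Near `z` the kernel is `O(t²)`, and `t` is at most the distance to `z`; hence the derivative
    -- at `z` is zero.
    refine Asymptotics.IsBigO.hasFDerivAt (n := 2) ?_ (by norm_num)
    refine Asymptotics.IsBigO.of_bound B ?_
    have hcont : Continuous fun w : ℝ × ℝ => ‖(w.2 : UnitAddCircle)‖ :=
      ((AddCircle.continuous_mk' 1).comp continuous_snd).norm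
    filter_upwards [(isOpen_lt continuous_const hcont).mem_nhds (half_lt_self
      (norm_pos_iff.2 hx))] with w hw
    rcases le_or_gt w.1 0 with hw1 | hw1
    · rw [expKernel_of_nonpos _ _ hw1, norm_zero]; positivity
    · rw [expKernel_of_pos _ _ hw1]
      refine (hb w.1 hw1 _ (le_of_lt hw)).trans ?_
      rw [norm_pow, norm_norm]
      gcongr
      have := norm_fst_le (w - z)
      rw [Prod.fst_sub, h, sub_zero, Real.norm_eq_abs] at this
      exact (le_abs_self _).trans this
  · exact hasFDerivAt_expKernel_of_pos hq hM p h

lemma contDiffOn_expKernel (hq : IsSymbol d M q) (hM : 0 < M) (p : ℂ[X]) :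
    ContDiffOn ℝ ∞ (expKernel q p) offOrigin := by
  rw [contDiffOn_infty]
  intro n
  -- The polynomial must vary, as the partial derivatives are kernels with other polynomials.
  induction n generalizing p with
  | zero =>
    rw [Nat.cast_zero, contDiffOn_zero]
    exact fun z hz => (hasFDerivAt_expKernel hq hM p hz).continuousAt.continuousWithinAt
  | succ n ih =>
    rw [Nat.cast_succ, contDiffOn_succ_iff_fderiv_of_isOpen isOpen_offOrigin]
    refine ⟨fun z hz => (hasFDerivAt_expKernel hq hM p hz).differentiableAt.differentiableWithinAt,
      by simp, ?_⟩
    refine ContDiffOn.congr ?_ fun z hz => (hasFDerivAt_expKernel hq hM p hz).fderiv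
    exact ((ContinuousLinearMap.smulRightL ℝ (ℝ × ℝ) ℂ
      (ContinuousLinearMap.fst ℝ ℝ ℝ)).contDiff.comp_contDiffOn (ih _)).add
        ((ContinuousLinearMap.smulRightL ℝ (ℝ × ℝ) ℂ
      (ContinuousLinearMap.snd ℝ ℝ ℝ)).contDiff.comp_contDiffOn (ih _))

end Symbol

/-! ### Real kernels on space-time -/

/-- The real part of the exponential series, extended by zero to nonpositive times. -/
def reKernel (q : ℝ[X]) (p : ℂ[X]) (x : SpaceTime) : ℝ :=
  if 0 < x.1 then (expSeries q p x.1 x.2).re else 0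

lemma spaceLift_reKernel (q : ℝ[X]) (p : ℂ[X]) (z : ℝ × ℝ) :
    spaceLift (reKernel q p) z = (expKernel q p z).re := by
  simp only [spaceLift, reKernel, expKernel]
  split_ifs <;> simp

lemma abs_reKernel_le (q : ℝ[X]) (p : ℂ[X]) (x : SpaceTime) {B : ℝ} (hB : 0 ≤ B)
    (h : 0 < x.1 → ‖expSeries q p x.1 x.2‖ ≤ B) : |reKernel q p x| ≤ B := by
  rw [reKernel]
  split_ifs with hx
  · exact (Complex.abs_re_le_norm _).trans (h hx)
  · simpa using hB

lemma eventually_ne_zero_time {x : SpaceTime} (hx : x ≠ 0) :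
    ∀ᶠ s in nhds x.1, ((s, x.2) : SpaceTime) ≠ 0 := by
  have : Continuous fun s : ℝ => ((s, x.2) : SpaceTime) := by fun_prop
  exact this.continuousAt.eventually_ne (by simpa using hx)

lemma eventually_ne_zero_space {x : SpaceTime} (hx : x ≠ 0) :
    ∀ᶠ s : ℝ in nhds 0, ((x.1, x.2 + (s : UnitAddCircle)) : SpaceTime) ≠ 0 := by
  have : Continuous fun s : ℝ => ((x.1, x.2 + (s : UnitAddCircle)) : SpaceTime) :=
    continuous_const.prodMk (continuous_const.add (AddCircle.continuous_mk' 1))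
  exact this.continuousAt.eventually_ne (by simpa using hx)

/-- The derivative formulas hold only off the origin; that set is open, so they can still be
iterated there. -/
lemma timeDeriv_congr {f g : SpaceTime → ℝ} (h : ∀ x ≠ 0, f x = g x) :
    ∀ x ≠ 0, timeDeriv f x = timeDeriv g x := fun x hx => by
  refine Filter.EventuallyEq.deriv_eq ?_
  filter_upwards [eventually_ne_zero_time hx] with s hs using h _ hs

lemma spaceDeriv_congr {f g : SpaceTime → ℝ} (h : ∀ x ≠ 0, f x = g x) :
    ∀ x ≠ 0, spaceDeriv f x = spaceDeriv g x := fun x hx => by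
  refine Filter.EventuallyEq.deriv_eq ?_
  filter_upwards [eventually_ne_zero_space hx] with s hs using h _ hs

section Symbol

variable {d : ℕ} {M : ℝ} {q : ℝ[X]}

lemma hasDerivAt_reKernel_time (hq : IsSymbol d M q) (hM : 0 < M) (p : ℂ[X]) {t : ℝ}
    {x : UnitAddCircle} (hx : ((t, x) : SpaceTime) ≠ 0) :
    HasDerivAt (fun s : ℝ => reKernel q p (s, x)) (reKernel q (timeFactor q * p) (t, x)) t := by
  obtain ⟨r, rfl, -, -⟩ := exists_real_rep x
  have h := (hasFDerivAt_expKernel hq hM p (z := (t, r)) hx).comp_hasDerivAt t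
    ((hasDerivAt_id t).prodMk (hasDerivAt_const t r))
  have h2 := (Complex.reCLM.hasFDerivAt).comp_hasDerivAt t h
  rw [pairCLM_apply] at h2
  simp only [one_smul, zero_smul, add_zero] at h2
  convert! h2 using 1
  · ext s; exact spaceLift_reKernel q p (s, r)
  · exact spaceLift_reKernel q _ (t, r)

lemma hasDerivAt_reKernel_space (hq : IsSymbol d M q) (hM : 0 < M) (p : ℂ[X]) {t r : ℝ}
    (hx : ((t, (r : UnitAddCircle)) : SpaceTime) ≠ 0) :
    HasDerivAt (fun s : ℝ => reKernel q p (t, (s : UnitAddCircle)))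
      (reKernel q (spaceFactor * p) (t, (r : UnitAddCircle))) r := by
  have h := (hasFDerivAt_expKernel hq hM p (z := (t, r)) hx).comp_hasDerivAt r
    ((hasDerivAt_const r t).prodMk (hasDerivAt_id r))
  have h2 := (Complex.reCLM.hasFDerivAt).comp_hasDerivAt r h
  rw [pairCLM_apply] at h2
  simp only [one_smul, zero_smul, zero_add] at h2
  convert! h2 using 1
  · ext s; exact spaceLift_reKernel q p (t, s)
  · exact spaceLift_reKernel q _ (t, r)

lemma timeDeriv_reKernel (hq : IsSymbol d M q) (hM : 0 < M) (p : ℂ[X]) {x : SpaceTime}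
    (hx : x ≠ 0) : timeDeriv (reKernel q p) x = reKernel q (timeFactor q * p) x :=
  (hasDerivAt_reKernel_time hq hM p hx).deriv

lemma spaceDeriv_reKernel (hq : IsSymbol d M q) (hM : 0 < M) (p : ℂ[X]) {x : SpaceTime}
    (hx : x ≠ 0) : spaceDeriv (reKernel q p) x = reKernel q (spaceFactor * p) x := by
  obtain ⟨t, y⟩ := x
  obtain ⟨r, rfl, -, -⟩ := exists_real_rep y
  have h := hasDerivAt_reKernel_space hq hM p hx
  have h2 : HasDerivAt (fun s : ℝ => reKernel q p (t, ((r + s : ℝ) : UnitAddCircle)))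
      (reKernel q (spaceFactor * p) (t, (r : UnitAddCircle))) 0 := by
    refine HasDerivAt.comp_const_add (f := fun s : ℝ => reKernel q p (t, (s : UnitAddCircle)))
      r 0 ?_
    rwa [add_zero]
  simp only [AddCircle.coe_add] at h2
  exact h2.deriv

lemma mixedDeriv_reKernel (hq : IsSymbol d M q) (hM : 0 < M) (p : ℂ[X]) (m l : ℕ) :
    ∀ x ≠ 0, mixedDeriv m l (reKernel q p) x =
      reKernel q (timeFactor q ^ m * (spaceFactor ^ l * p)) x := by
  have hl : ∀ l, ∀ x ≠ 0, spaceDeriv^[l] (reKernel q p) x = reKernel q (spaceFactor ^ l * p) x := by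
    intro l
    induction l with
    | zero => simp
    | succ l ih =>
      intro x hx
      rw [Function.iterate_succ_apply', spaceDeriv_congr ih x hx, spaceDeriv_reKernel hq hM _ hx,
        pow_succ', mul_assoc]
  induction m with
  | zero => simpa [mixedDeriv] using hl l
  | succ m ih =>
    intro x hx
    rw [mixedDeriv, Function.iterate_succ_apply', ← mixedDeriv, timeDeriv_congr ih x hx,
      timeDeriv_reKernel hq hM _ hx, pow_succ', mul_assoc]

lemma isSmoothOffOrigin_reKernel (hq : IsSymbol d M q) (hM : 0 < M) (p : ℂ[X]) :
    IsSmoothOffOrigin (reKernel q p) := by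
  have h := Complex.reCLM.contDiff.comp_contDiffOn (contDiffOn_expKernel hq hM p)
  exact h.congr fun z _ => spaceLift_reKernel q p z

end Symbol

/-! ### The parabolic size -/

lemma parSize_nonneg (x : SpaceTime) : 0 ≤ parSize x := by unfold parSize; positivity

lemma parSize_pos {x : SpaceTime} (hx : x ≠ 0) : 0 < parSize x := by
  by_contra h
  have h0 : parSize x = 0 := le_antisymm (not_lt.1 h) (parSize_nonneg x)
  have h1 : √|x.1| = 0 := by
    have := norm_nonneg x.2; have := Real.sqrt_nonneg |x.1|; unfold parSize at h0; linarith
  have h2 : ‖x.2‖ = 0 := by unfold parSize at h0; linarith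
  rw [Real.sqrt_eq_zero (abs_nonneg _), abs_eq_zero] at h1
  exact hx (Prod.ext h1 (norm_eq_zero.1 h2))

lemma parSize_neg (x : SpaceTime) : parSize (-x) = parSize x := by simp [parSize]

lemma parSize_add_le (x y : SpaceTime) : parSize (x + y) ≤ parSize x + parSize y := by
  have h1 : √|x.1 + y.1| ≤ √|x.1| + √|y.1| := by
    refine (Real.sqrt_le_sqrt (abs_add_le _ _)).trans ?_
    rw [Real.sqrt_le_left (by positivity)]
    nlinarith [Real.sq_sqrt (abs_nonneg x.1), Real.sq_sqrt (abs_nonneg y.1),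
      Real.sqrt_nonneg |x.1|, Real.sqrt_nonneg |y.1|]
  have h2 := norm_add_le x.2 y.2
  simp only [parSize, Prod.fst_add, Prod.snd_add]
  linarith

/-! ### Convex combinations of symbols -/

/-- All conditions are convex in the symbol, the last one because `absEval` is subadditive. This
allows interpolation between two symbols with the same `M`. -/
lemma IsSymbol.combo {d : ℕ} {M : ℝ} {q₀ q₁ : ℝ[X]} (h₀ : IsSymbol d M q₀)
    (h₁ : IsSymbol d M q₁) {a b : ℝ} (ha : 0 ≤ a) (hb : 0 ≤ b) (hab : a + b = 1) :
    IsSymbol d M (C a * q₁ + C b * q₀) where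
  natDegree_le := natDegree_add_le_of_degree_le
    ((natDegree_C_mul_le _ _).trans h₁.natDegree_le)
    ((natDegree_C_mul_le _ _).trans h₀.natDegree_le)
  coeff_zero := by simp [h₀.coeff_zero, h₁.coeff_zero]
  coeff_one := by simp [h₀.coeff_one, h₁.coeff_one]
  one_le_coeff_two := by
    simp only [coeff_add, coeff_C_mul]
    nlinarith [h₀.one_le_coeff_two, h₁.one_le_coeff_two]
  absEval_le x := by
    refine (absEval_add_le _ _ (abs_nonneg x)).trans ?_
    rw [absEval_C_mul, absEval_C_mul, abs_of_nonneg ha, abs_of_nonneg hb, eval_add, eval_C_mul,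
      eval_C_mul]
    have := mul_le_mul_of_nonneg_left (h₀.absEval_le x) hb
    have := mul_le_mul_of_nonneg_left (h₁.absEval_le x) ha
    linarith

/-- Along a path of symbols from `q₀` to `q₁`, differentiating the exponential brings down `-t (q₁ -
q₀)` times the speed of the path, so the difference is controlled by series with the polynomial
`timeFactor (q₁ - q₀) * p`. -/
lemma norm_expSeries_sub_le {d : ℕ} {M : ℝ} (hM : 0 < M) {q₀ q₁ : ℝ[X]} (h₀ : IsSymbol d M q₀)
    (h₁ : IsSymbol d M q₁) (p : ℂ[X]) {t : ℝ} (ht : 0 < t) (x : UnitAddCircle) {B : ℝ}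
    (hB : ∀ q, IsSymbol d M q → ‖expSeries q (timeFactor (q₁ - q₀) * p) t x‖ ≤ B) :
    ‖expSeries q₁ p t x - expSeries q₀ p t x‖ ≤ 2 * (t * B) := by
  -- The weights `sin² s` and `cos² s` are admissible for every real `s`, so termwise
  -- differentiation needs no restriction of the parameter. The speed is `sin 2s`, at most `1`, and
  -- the length `π / 2` is at most `2`.
  let qs : ℝ → ℝ[X] := fun s => C (Real.sin s ^ 2) * q₁ + C (Real.cos s ^ 2) * q₀
  have hqs : ∀ s, IsSymbol d M (qs s) := fun s =>
    h₀.combo h₁ (sq_nonneg _) (sq_nonneg _) (Real.sin_sq_add_cos_sq s)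
  have hqe : ∀ s y, (qs s).eval y = Real.sin s ^ 2 * q₁.eval y + Real.cos s ^ 2 * q₀.eval y :=
    fun s y => by simp [qs]
  have hterm : ∀ (k : ℤ) (s : ℝ), HasDerivAt
      (fun s => p.eval (k : ℂ) * (Real.exp (-((qs s).eval (k : ℝ) * t)) : ℂ) * fourier k x)
      (((2 * Real.sin s * Real.cos s * t : ℝ) : ℂ) * ((timeFactor (q₁ - q₀) * p).eval (k : ℂ) *
        (Real.exp (-((qs s).eval (k : ℝ) * t)) : ℂ) * fourier k x)) s := by
    intro k s
    have h1 : HasDerivAt (fun s => (qs s).eval (k : ℝ))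
        (2 * Real.sin s * Real.cos s * (q₁.eval (k : ℝ) - q₀.eval (k : ℝ))) s := by
      simp only [hqe]
      refine (((Real.hasDerivAt_sin s).pow 2).mul_const (q₁.eval (k : ℝ)) |>.add
        (((Real.hasDerivAt_cos s).pow 2).mul_const (q₀.eval (k : ℝ)))).congr_deriv ?_
      push_cast
      ring
    have h2 := ((((h1.mul_const t).neg.exp).ofReal_comp).const_mul (p.eval (k : ℂ))).mul_const
      (fourier k x : ℂ)
    refine h2.congr_deriv ?_
    simp only [eval_mul, eval_timeFactor, eval_sub, Pi.neg_apply]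
    push_cast
    ring
  have hsc : ∀ s : ℝ, |2 * Real.sin s * Real.cos s * t| ≤ t := by
    intro s
    rw [← Real.sin_two_mul, abs_mul, abs_of_pos ht]
    exact mul_le_of_le_one_left ht.le (Real.abs_sin_le_one _)
  have hsum := (summable_norm_eval_mul_exp (timeFactor (q₁ - q₀) * p) (div_pos ht hM)).mul_left t
  have hF : ∀ s, HasDerivAt (fun s => expSeries (qs s) p t x)
      (((2 * Real.sin s * Real.cos s * t : ℝ) : ℂ) *
        expSeries (qs s) (timeFactor (q₁ - q₀) * p) t x) s := by
    intro s
    have h3 := hasDerivAt_tsum hsum hterm (fun k s => ?_)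
      (summable_mul_fourier ((hqs 0).summable hM p ht) x) s
    · rwa [tsum_mul_left] at h3
    · rw [norm_mul, norm_mul _ (fourier k x : ℂ), norm_fourier_apply, mul_one, Complex.norm_real,
        Real.norm_eq_abs]
      gcongr
      · exact hsc s
      · exact (hqs s).norm_term_le hM _ ht.le le_rfl k
  have hB0 : 0 ≤ B := (norm_nonneg _).trans (hB q₀ h₀)
  have h4 := convex_univ.norm_image_sub_le_of_norm_hasDerivWithin_le (C := t * B)
    (fun s _ => (hF s).hasDerivWithinAt) (fun s _ => by
      rw [norm_mul, Complex.norm_real, Real.norm_eq_abs]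
      exact mul_le_mul (hsc s) (hB _ (hqs s)) (norm_nonneg _) ht.le)
    (Set.mem_univ (0 : ℝ)) (Set.mem_univ (Real.pi / 2))
  have e1 : qs (Real.pi / 2) = q₁ := by simp [qs]
  have e0 : qs 0 = q₀ := by simp [qs]
  rw [e1, e0] at h4
  refine h4.trans ?_
  rw [sub_zero, Real.norm_eq_abs, abs_of_pos (by positivity), mul_comm]
  have := Real.pi_le_four
  gcongr
  linarith

/-- A bound on the series for polynomials whose coefficients scale like powers of `ε`. -/
lemma exists_norm_expSeries_le_of_coeff (d : ℕ) {M : ℝ} (hM : 0 < M) {c : ℝ} (hc : 0 < c) (D : ℕ)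
    {a : ℕ} (ha : 1 ≤ a) : ∃ B : ℝ, 0 ≤ B ∧ ∀ q, IsSymbol d M q → ∀ (ε A : ℝ) (p : ℂ[X]), 0 ≤ ε →
      0 ≤ A → p.natDegree < D → (∀ n < a, p.coeff n = 0) →
      (∀ n, a ≤ n → ‖p.coeff n‖ ≤ A * ε ^ (n - a)) →
      ∀ (t : ℝ) (x : UnitAddCircle), 0 < t → c * ε ≤ √t + ‖x‖ →
        ‖expSeries q p t x‖ ≤ A * (B * ((√t + ‖x‖) ^ (a + 1))⁻¹) := by
  have H : ∀ L : ℕ, ∃ B : ℝ, 0 ≤ B ∧ (1 ≤ L → ∀ q, IsSymbol d M q → ∀ t : ℝ, 0 < t →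
      ∀ x : UnitAddCircle, ‖expSeries q (X ^ L) t x‖ ≤ B * ((√t + ‖x‖) ^ (L + 1))⁻¹) := by
    intro L
    by_cases hL : 1 ≤ L
    · obtain ⟨B, hB, h⟩ := exists_norm_expSeries_le d hM hL
      exact ⟨B, hB, fun _ => h⟩
    · exact ⟨0, le_rfl, fun h => absurd h hL⟩
  choose B hB h using H
  refine ⟨∑ n ∈ Finset.range D, B n * (c⁻¹) ^ (n - a), Finset.sum_nonneg fun n _ => by
    have := hB n; positivity, fun q hq ε A p hε hA hD hlow hcoeff t x ht hρ => ?_⟩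
  have hρ0 : 0 < √t + ‖x‖ := add_pos_of_pos_of_nonneg (Real.sqrt_pos.2 ht) (norm_nonneg x)
  set ρ := √t + ‖x‖
  rw [expSeries_eq_sum hq hM p ht x hD, Finset.sum_mul, Finset.mul_sum]
  refine (norm_sum_le _ _).trans (Finset.sum_le_sum fun n _ => ?_)
  rcases lt_or_ge n a with hn | hn
  · rw [hlow n hn, zero_mul, norm_zero]
    have := hB n
    positivity
  have h1 := h n (ha.trans hn) q hq t ht x
  -- The surplus powers of `ε` compensate the surplus negative powers of `ρ`.
  have h2 : ε ≤ c⁻¹ * ρ := by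
    rw [inv_mul_eq_div, le_div_iff₀ hc, mul_comm]; exact hρ
  have hBn := hB n
  rw [norm_mul]
  calc ‖p.coeff n‖ * ‖expSeries q (X ^ n) t x‖
      ≤ (A * ε ^ (n - a)) * (B n * (ρ ^ (n + 1))⁻¹) := by gcongr; exact hcoeff n hn
    _ ≤ (A * (c⁻¹ * ρ) ^ (n - a)) * (B n * (ρ ^ (n + 1))⁻¹) := by gcongr
    _ = A * (B n * c⁻¹ ^ (n - a) * (ρ ^ (n - a) * (ρ ^ (n + 1))⁻¹)) := by rw [mul_pow]; ring
    _ = _ := by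
      have : ρ ^ (n + 1) = ρ ^ (n - a) * ρ ^ (a + 1) := by rw [← pow_add]; congr 1; omega
      rw [this, mul_inv, mul_inv_cancel_left₀ (by positivity)]

/-! ### The symbol of `L_ε` -/

/-- The polynomial `x ↦ ε⁻² Q(2π ε x)`, extended continuously to `ε = 0`. -/
def symbolPoly (Q : ℝ[X]) (ε : ℝ) : ℝ[X] :=
  C ((2 * Real.pi) ^ 2) * (Q.divX.divX.comp (C (2 * Real.pi * ε) * X) * X ^ 2)

lemma eval_symbolPoly (Q : ℝ[X]) (ε x : ℝ) :
    (symbolPoly Q ε).eval x = (2 * Real.pi * x) ^ 2 * Q.divX.divX.eval (2 * Real.pi * ε * x) := by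
  simp only [symbolPoly, eval_mul, eval_C, eval_comp, eval_X, eval_pow]
  ring

lemma coeff_symbolPoly_of_lt (Q : ℝ[X]) (ε : ℝ) {j : ℕ} (hj : j < 2) :
    (symbolPoly Q ε).coeff j = 0 := by
  rw [symbolPoly, coeff_C_mul, coeff_mul_X_pow', if_neg (by omega), mul_zero]

lemma coeff_symbolPoly (Q : ℝ[X]) (ε : ℝ) (j : ℕ) :
    (symbolPoly Q ε).coeff (j + 2) =
      (2 * Real.pi) ^ 2 * (Q.coeff (j + 2) * (2 * Real.pi * ε) ^ j) := by
  rw [symbolPoly, coeff_C_mul, coeff_mul_X_pow', if_pos (by omega), Nat.add_sub_cancel,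
    comp_C_mul_X_coeff, coeff_divX, coeff_divX]

lemma natDegree_symbolPoly_le (Q : ℝ[X]) (ε : ℝ) : (symbolPoly Q ε).natDegree ≤ Q.natDegree + 2 := by
  refine natDegree_le_iff_coeff_eq_zero.2 fun n hn => ?_
  obtain ⟨j, rfl⟩ : ∃ j, n = j + 2 := ⟨n - 2, by omega⟩
  rw [coeff_symbolPoly, coeff_eq_zero_of_natDegree_lt (by omega), zero_mul, mul_zero]

section Admissible

variable {Q : ℝ[X]}

lemma IsAdmissible.coeff_odd (hQ : IsAdmissible Q) {n : ℕ} (hn : Odd n) : Q.coeff n = 0 := by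
  have h : Q.comp (C (-1) * X) = Q := Polynomial.funext fun r => by
    simp [eval_comp, hQ.even]
  have h1 := congrArg (fun p => p.coeff n) h
  simp only [comp_C_mul_X_coeff, hn.neg_one_pow] at h1
  linarith

lemma IsAdmissible.eval_eq (hQ : IsAdmissible Q) (r : ℝ) :
    Q.eval r = r ^ 2 * Q.divX.divX.eval r := by
  have h1 := divX_mul_X_add Q
  have h2 := divX_mul_X_add Q.divX
  rw [coeff_zero_eq_eval_zero, hQ.eval_zero, C_0, add_zero] at h1
  rw [coeff_divX, zero_add, hQ.coeff_odd odd_one, C_0, add_zero] at h2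
  conv_lhs => rw [← h1, ← h2]
  simp only [eval_mul, eval_X]
  ring

lemma IsAdmissible.divX_pos (hQ : IsAdmissible Q) (r : ℝ) : 0 < Q.divX.divX.eval r := by
  by_cases hr : r = 0
  · rw [hr, ← coeff_zero_eq_eval_zero, coeff_divX, coeff_divX]
    simp [hQ.coeff_two]
  · have h := hQ.pos r hr
    rw [hQ.eval_eq] at h
    exact pos_of_mul_pos_right h (sq_nonneg r)

lemma IsAdmissible.divX_even (hQ : IsAdmissible Q) (r : ℝ) :
    Q.divX.divX.eval (-r) = Q.divX.divX.eval r := by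
  by_cases hr : r = 0
  · simp [hr]
  · have h := hQ.even r
    rw [hQ.eval_eq, hQ.eval_eq, neg_sq] at h
    exact mul_left_cancel₀ (pow_ne_zero 2 hr) h

/-- With `S = Q / r²`, the ratio of `absPoly S` to `S` is bounded at infinity by comparison of
degrees and on compact sets by continuity, since `S` has no zero. Evenness of `S` reduces everything
to `r ≥ 0`. -/
lemma IsAdmissible.exists_absEval_le (hQ : IsAdmissible Q) :
    ∃ M : ℝ, 0 < M ∧ ∀ r : ℝ, absEval Q.divX.divX |r| ≤ M * Q.divX.divX.eval r := by
  set S := Q.divX.divX with hS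
  have hdeg : (absPoly S).degree ≤ S.degree := by
    rw [degree_le_iff_coeff_zero]
    intro m hm
    rw [coeff_absPoly, coeff_eq_zero_of_degree_lt hm, abs_zero]
  obtain ⟨C₁, h₁⟩ := (Polynomial.isBigO_atTop_of_degree_le (absPoly S) S hdeg).bound
  obtain ⟨R, hR⟩ := Filter.eventually_atTop.1 h₁
  obtain ⟨C₂, h₂⟩ := (isCompact_Icc (a := (0 : ℝ)) (b := max R 0)).exists_bound_of_continuousOn
    (f := fun r => (absPoly S).eval r / S.eval r)
    (((absPoly S).continuous.div S.continuous fun r => (hQ.divX_pos r).ne').continuousOn)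
  refine ⟨max (max C₁ C₂) 1, by positivity, fun r => ?_⟩
  have hr : S.eval r = S.eval |r| := by
    rcases abs_cases r with ⟨h, _⟩ | ⟨h, _⟩
    · rw [h]
    · rw [h, hQ.divX_even]
  rw [hr]
  have hpos := hQ.divX_pos |r|
  rw [← hS] at hpos
  have key : ∀ K : ℝ, K ≤ max (max C₁ C₂) 1 → absEval S |r| ≤ K * S.eval |r| →
      absEval S |r| ≤ max (max C₁ C₂) 1 * S.eval |r| := fun K hK h => h.trans (by gcongr)
  rcases le_or_gt |r| (max R 0) with h | h
  · refine key C₂ ((le_max_right _ _).trans (le_max_left _ _)) ?_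
    have := h₂ |r| ⟨abs_nonneg r, h⟩
    rw [Real.norm_eq_abs, abs_div, abs_of_pos hpos, div_le_iff₀ hpos] at this
    exact (le_abs_self _).trans this
  · refine key C₁ ((le_max_left _ _).trans (le_max_left _ _)) ?_
    have := hR |r| ((le_max_left _ _).trans h.le)
    rw [Real.norm_eq_abs, Real.norm_eq_abs, abs_of_pos hpos] at this
    exact (le_abs_self _).trans this

lemma absEval_symbolPoly (Q : ℝ[X]) {ε : ℝ} (hε : 0 ≤ ε) (r : ℝ) :
    absEval (symbolPoly Q ε) r =
      (2 * Real.pi * r) ^ 2 * absEval Q.divX.divX (2 * Real.pi * ε * r) := by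
  have h : absPoly (symbolPoly Q ε) =
      C ((2 * Real.pi) ^ 2) * ((absPoly Q.divX.divX).comp (C (2 * Real.pi * ε) * X) * X ^ 2) := by
    have hpi := Real.pi_pos
    ext n
    rw [coeff_absPoly, symbolPoly, coeff_C_mul, coeff_C_mul, coeff_mul_X_pow', coeff_mul_X_pow']
    split_ifs
    · rw [comp_C_mul_X_coeff, comp_C_mul_X_coeff, coeff_absPoly, abs_mul, abs_mul,
        abs_of_pos (by positivity : 0 < (2 * Real.pi) ^ 2),
        abs_of_nonneg (by positivity : 0 ≤ (2 * Real.pi * ε) ^ (n - 2))]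
    · simp
  rw [absEval, h, absEval]
  simp only [eval_mul, eval_C, eval_comp, eval_X, eval_pow]
  ring

/-- The symbols of `L_ε` are controlled uniformly in `ε`. -/
lemma IsAdmissible.exists_isSymbol (hQ : IsAdmissible Q) :
    ∃ M : ℝ, 0 < M ∧ ∀ ε : ℝ, 0 ≤ ε → IsSymbol (Q.natDegree + 2) M (symbolPoly Q ε) := by
  obtain ⟨M, hM, h⟩ := hQ.exists_absEval_le
  refine ⟨M, hM, fun ε hε => ⟨natDegree_symbolPoly_le Q ε, coeff_symbolPoly_of_lt Q ε (by norm_num),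
    coeff_symbolPoly_of_lt Q ε (by norm_num), ?_, fun x => ?_⟩⟩
  · have := coeff_symbolPoly Q ε 0
    rw [zero_add] at this
    rw [this, hQ.coeff_two]
    nlinarith [Real.pi_gt_three]
  -- The parameter `ε` enters only through the argument of `S`, so the constant is that of `S`.
  · have h1 := h (2 * Real.pi * ε * x)
    have hpi := Real.pi_pos
    rw [abs_mul, abs_of_nonneg (by positivity : 0 ≤ 2 * Real.pi * ε)] at h1
    rw [absEval_symbolPoly Q hε, eval_symbolPoly, mul_pow, sq_abs, ← mul_pow]
    calc _ ≤ (2 * Real.pi * x) ^ 2 * (M * Q.divX.divX.eval (2 * Real.pi * ε * x)) := by gcongr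
      _ = _ := by ring

lemma IsAdmissible.symbolL_eq (hQ : IsAdmissible Q) (ε : ℝ) (k : ℤ) :
    symbolL Q ε k = (symbolPoly Q ε).eval (k : ℝ) := by
  rw [eval_symbolPoly, symbolL]
  split_ifs with h
  · rw [h, mul_zero, zero_mul, ← coeff_zero_eq_eval_zero, coeff_divX, coeff_divX]
    simp [hQ.coeff_two]
  · rw [hQ.even, hQ.eval_eq]
    field_simp

lemma IsAdmissible.greenP_eq (hQ : IsAdmissible Q) (ε : ℝ) :
    greenP Q ε = reKernel (symbolPoly Q ε) 1 := by
  ext x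
  simp only [greenP, reKernel, expSeries, eval_one, one_mul, hQ.symbolL_eq]

/-- A monomial two degrees or more above `j = 0` carries the matching factor `ε ^ j`; this is the
homogeneity required by `exists_norm_expSeries_le_of_coeff`. -/
lemma exists_abs_coeff_symbolPoly_le (Q : ℝ[X]) : ∃ A : ℝ, 0 ≤ A ∧ ∀ ε : ℝ, 0 ≤ ε → ∀ j : ℕ,
    |(symbolPoly Q ε).coeff (j + 2)| ≤ A * ε ^ j := by
  refine ⟨∑ j ∈ Finset.range (Q.natDegree + 1), (2 * Real.pi) ^ 2 *
    (|Q.coeff (j + 2)| * (2 * Real.pi) ^ j), Finset.sum_nonneg fun j _ => by positivity,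
    fun ε hε j => ?_⟩
  rw [coeff_symbolPoly]
  by_cases hj : j ≤ Q.natDegree
  · have hpi := Real.pi_pos
    have := Finset.single_le_sum (f := fun j => (2 * Real.pi) ^ 2 *
      (|Q.coeff (j + 2)| * (2 * Real.pi) ^ j)) (fun j _ => by positivity)
      (Finset.mem_range.2 (Nat.lt_succ_of_le hj))
    refine le_trans (le_of_eq ?_) (mul_le_mul_of_nonneg_right this (by positivity))
    rw [abs_mul, abs_mul, abs_of_nonneg (by positivity : 0 ≤ (2 * Real.pi) ^ 2),
      abs_of_nonneg (by positivity : 0 ≤ (2 * Real.pi * ε) ^ j), mul_pow _ ε]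
    ring
  · rw [coeff_eq_zero_of_natDegree_lt (by omega), zero_mul, mul_zero, abs_zero]
    exact mul_nonneg (Finset.sum_nonneg fun j _ => by positivity) (by positivity)

lemma spaceFactor_pow (l : ℕ) :
    spaceFactor ^ l = C ((2 * Real.pi * Complex.I) ^ l) * X ^ l := by
  rw [spaceFactor, mul_pow, C_pow]

lemma coeff_timeFactor (q : ℝ[X]) (n : ℕ) : (timeFactor q).coeff n = -((q.coeff n : ℝ) : ℂ) := by
  simp [timeFactor]

lemma norm_coeff_timeFactor (q : ℝ[X]) (n : ℕ) : ‖(timeFactor q).coeff n‖ = |q.coeff n| := by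
  rw [coeff_timeFactor, norm_neg, Complex.norm_real, Real.norm_eq_abs]

lemma coeff_mul_spaceFactor_pow (p : ℂ[X]) (l n : ℕ) :
    (p * spaceFactor ^ l).coeff n =
      if l ≤ n then (2 * Real.pi * Complex.I) ^ l * p.coeff (n - l) else 0 := by
  rw [spaceFactor_pow, mul_left_comm, coeff_C_mul, coeff_mul_X_pow']
  split_ifs <;> simp

lemma natDegree_mul_spaceFactor_pow_le (p : ℂ[X]) (l : ℕ) :
    (p * spaceFactor ^ l).natDegree ≤ p.natDegree + l := by
  refine natDegree_mul_le.trans (Nat.add_le_add_left ?_ _)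
  rw [spaceFactor_pow]
  exact natDegree_C_mul_X_pow_le _ _

lemma natDegree_timeFactor_le (q : ℝ[X]) : (timeFactor q).natDegree ≤ q.natDegree := by
  rw [timeFactor, natDegree_neg]; exact natDegree_map_le

lemma parSize_of_pos {x : SpaceTime} (hx : 0 < x.1) : parSize x = √x.1 + ‖x.2‖ := by
  rw [parSize, abs_of_pos hx]

/-! ### Bounds on the Green's function -/

lemma IsAdmissible.greenP_bound (hQ : IsAdmissible Q) : ∃ C : ℝ, ∀ ε ∈ Set.Icc (0 : ℝ) 1,
    ∀ x : SpaceTime, x ≠ 0 → |greenP Q ε x| ≤ C * (1 + (parSize x)⁻¹) := by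
  obtain ⟨M, hM, hs⟩ := hQ.exists_isSymbol
  obtain ⟨B, hB, h⟩ := exists_norm_expSeries_one_le (Q.natDegree + 2) hM
  refine ⟨B, fun ε hε x hx => ?_⟩
  rw [hQ.greenP_eq]
  have := parSize_pos hx
  refine abs_reKernel_le _ _ _ (by positivity) fun hx0 => ?_
  rw [parSize_of_pos hx0]
  exact h _ (hs ε hε.1) _ hx0 _

lemma IsAdmissible.derivBound_space (hQ : IsAdmissible Q) {l : ℕ} (hl : 1 ≤ l) :
    DerivBound (greenP Q) 0 l 0 := by
  obtain ⟨M, hM, hs⟩ := hQ.exists_isSymbol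
  obtain ⟨B, hB, h⟩ := exists_norm_expSeries_le_of_coeff (Q.natDegree + 2) hM one_pos (l + 1) hl
  refine ⟨‖(2 * Real.pi * Complex.I : ℂ) ^ l‖ * B, fun ε hε x hx _ => ?_⟩
  rw [hQ.greenP_eq, mixedDeriv_reKernel (hs ε hε.1) hM 1 0 l x hx, pow_zero, one_mul, mul_one,
    ← one_mul (spaceFactor ^ l), mul_zero, zero_add]
  have hp := parSize_pos hx
  refine abs_reKernel_le _ _ _ (by positivity) fun hx0 => ?_
  rw [parSize_of_pos hx0, mul_assoc]
  -- The scaling parameter is taken to be `0`: the polynomial is a single monomial, and the lower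
  -- bound on `|x|` becomes void.
  refine h _ (hs ε hε.1) 0 _ _ le_rfl (norm_nonneg _) ?_ (fun n hn => ?_) (fun n hn => ?_) _ _ hx0
    (by rw [mul_zero]; positivity)
  · have := natDegree_mul_spaceFactor_pow_le 1 l
    rw [natDegree_one] at this
    omega
  · rw [coeff_mul_spaceFactor_pow, if_neg (by omega)]
  · rw [coeff_mul_spaceFactor_pow, if_pos hn, norm_mul, coeff_one]
    gcongr
    split_ifs with h0 <;> simp [h0]

lemma IsAdmissible.derivBound_time (hQ : IsAdmissible Q) (l : ℕ) {c : ℝ} (hc : 0 < c) :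
    DerivBound (greenP Q) 1 l c := by
  obtain ⟨M, hM, hs⟩ := hQ.exists_isSymbol
  obtain ⟨A, hA, hcoeff⟩ := exists_abs_coeff_symbolPoly_le Q
  obtain ⟨B, hB, h⟩ := exists_norm_expSeries_le_of_coeff (Q.natDegree + 2) hM hc
    (Q.natDegree + 2 + l + 1) (a := l + 2) (by omega)
  refine ⟨‖(2 * Real.pi * Complex.I : ℂ) ^ l‖ * A * B, fun ε hε x hx hxc => ?_⟩
  rw [hQ.greenP_eq, mixedDeriv_reKernel (hs ε hε.1) hM 1 1 l x hx, pow_one, mul_one,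
    show 2 * 1 + l + 1 = l + 2 + 1 by ring]
  have hp := parSize_pos hx
  refine abs_reKernel_le _ _ _ (by positivity) fun hx0 => ?_
  rw [parSize_of_pos hx0] at hxc ⊢
  rw [mul_assoc (_ * A)]
  refine h _ (hs ε hε.1) ε _ _ hε.1 (by positivity) ?_ (fun n hn => ?_) (fun n hn => ?_) _ _ hx0
    hxc
  · have := natDegree_mul_spaceFactor_pow_le (timeFactor (symbolPoly Q ε)) l
    have := natDegree_timeFactor_le (symbolPoly Q ε)
    have := natDegree_symbolPoly_le Q ε
    omega
  · rw [coeff_mul_spaceFactor_pow]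
    split_ifs
    · rw [coeff_timeFactor, coeff_symbolPoly_of_lt Q ε (by omega)]; simp
    · rfl
  · rw [coeff_mul_spaceFactor_pow, if_pos (by omega), norm_mul, norm_coeff_timeFactor]
    have := hcoeff ε hε.1 (n - (l + 2))
    rw [show n - (l + 2) + 2 = n - l by omega] at this
    exact (mul_le_mul_of_nonneg_left this (norm_nonneg _)).trans (le_of_eq (by ring))

/-- For `|x| < ε` the two derivatives are bounded separately. For `|x| ≥ ε` the symbols differ by
terms of degree at least three carrying a factor `ε`, which gives `t ε |x|⁻⁵ ≤ ε |x|⁻³`, up to a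
constant. -/
lemma IsAdmissible.comparisonBound (hQ : IsAdmissible Q) {δ : ℝ} (hδ : δ ∈ Set.Ioo (0 : ℝ) 1) :
    ComparisonBound (greenP Q) δ := by
  obtain ⟨M, hM, hs⟩ := hQ.exists_isSymbol
  obtain ⟨A, hA, hcoeff⟩ := exists_abs_coeff_symbolPoly_le Q
  -- The quadratic terms of `q_ε` and `q_0` cancel, so the difference starts at degree three; the
  -- space derivative raises this to `a = 4`.
  obtain ⟨B, hB, h⟩ := exists_norm_expSeries_le_of_coeff (Q.natDegree + 2) hM one_pos
    (Q.natDegree + 2 + 1 + 1) (a := 4) (by omega)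
  obtain ⟨C₁, h₁⟩ := hQ.derivBound_space (l := 1) le_rfl
  set A' := ‖(2 * Real.pi * Complex.I : ℂ) ^ 1‖ * A with hA'
  have hA'0 : 0 ≤ A' := by positivity
  have hC₁ : 0 ≤ |C₁| := abs_nonneg _
  refine ⟨2 * |C₁| + 2 * (A' * B), fun ε hε x hx => ?_⟩
  have hp := parSize_pos hx
  have hε0 := hε.1
  have hR0 : 0 ≤ ε ^ δ * parSize x ^ (-2 - δ) := by positivity
  rcases lt_or_ge (parSize x) ε with hlt | hge
  · have h0 : ∀ ε' ∈ Set.Icc (0 : ℝ) 1, |mixedDeriv 0 1 (greenP Q ε') x| ≤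
        |C₁| * (ε ^ δ * parSize x ^ (-2 - δ)) := by
      intro ε' hε'
      refine (h₁ ε' hε' x hx (by rw [zero_mul]; exact hp.le)).trans ?_
      have e : (parSize x ^ (2 * 0 + 1 + 1))⁻¹ ≤ ε ^ δ * parSize x ^ (-2 - δ) := by
        calc (parSize x ^ (2 * 0 + 1 + 1))⁻¹ = parSize x ^ δ * parSize x ^ (-2 - δ) := by
              rw [← Real.rpow_add hp, show δ + (-2 - δ) = -((2 : ℕ) : ℝ) by push_cast; ring,
                Real.rpow_neg hp.le, Real.rpow_natCast]
          _ ≤ _ := mul_le_mul_of_nonneg_right (Real.rpow_le_rpow hp.le hlt.le hδ.1.le)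
              (by positivity)
      have := le_abs_self C₁
      gcongr
    have h3 := h0 ε hε
    have h4 := h0 0 ⟨le_rfl, zero_le_one⟩
    have h5 := abs_sub (mixedDeriv 0 1 (greenP Q ε) x) (mixedDeriv 0 1 (greenP Q 0) x)
    have h6 : 0 ≤ 2 * (A' * B) * (ε ^ δ * parSize x ^ (-2 - δ)) := by positivity
    linarith
  · rw [hQ.greenP_eq, hQ.greenP_eq, mixedDeriv_reKernel (hs ε hε.1) hM 1 0 1 x hx,
      mixedDeriv_reKernel (hs 0 le_rfl) hM 1 0 1 x hx, pow_zero, one_mul, pow_zero, one_mul,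
      mul_one]
    rcases le_or_gt x.1 0 with hx0 | hx0
    · rw [reKernel, reKernel, if_neg hx0.not_gt, if_neg hx0.not_gt, sub_self, abs_zero]
      positivity
    rw [reKernel, reKernel, if_pos hx0, if_pos hx0, ← Complex.sub_re]
    refine (Complex.abs_re_le_norm _).trans ?_
    have hρ := parSize_of_pos hx0
    have h2 := norm_expSeries_sub_le hM (hs 0 le_rfl) (hs ε hε.1) (spaceFactor ^ 1) hx0 x.2
      (B := (A' * ε) * (B * (parSize x ^ 5)⁻¹)) (fun q hq => ?_)
    · refine h2.trans ?_
      have ht : x.1 ≤ parSize x ^ 2 := by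
        rw [hρ]
        nlinarith [Real.sq_sqrt hx0.le, Real.sqrt_nonneg x.1, norm_nonneg x.2]
      -- Interpolation: `ε = ε^δ ε^{1-δ} ≤ ε^δ |x|^{1-δ}`. The case `ε = 0` is separate because of
      -- the addition rule for real powers.
      have h7 : ε * (parSize x ^ 3)⁻¹ ≤ ε ^ δ * parSize x ^ (-2 - δ) := by
        rcases hε0.eq_or_lt with h0 | h0
        · rw [← h0, zero_mul]; positivity
        calc ε * (parSize x ^ 3)⁻¹ = ε ^ δ * (ε ^ (1 - δ) * (parSize x ^ 3)⁻¹) := by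
              rw [← mul_assoc, ← Real.rpow_add h0]; simp
          _ ≤ ε ^ δ * (parSize x ^ (1 - δ) * (parSize x ^ 3)⁻¹) := by
              have : 0 ≤ 1 - δ := by linarith [hδ.2]
              gcongr
          _ = _ := by
              rw [show (parSize x ^ 3)⁻¹ = parSize x ^ (-3 : ℝ) by
                rw [Real.rpow_neg hp.le]; norm_cast, ← Real.rpow_add hp]
              congr 2; ring
      calc 2 * (x.1 * (A' * ε * (B * (parSize x ^ 5)⁻¹)))
          ≤ 2 * (parSize x ^ 2 * (A' * ε * (B * (parSize x ^ 5)⁻¹))) := by gcongr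
        _ = 2 * (A' * B) * (ε * (parSize x ^ 3)⁻¹) := by field_simp
        _ ≤ 2 * (A' * B) * (ε ^ δ * parSize x ^ (-2 - δ)) := by gcongr
        _ ≤ _ := by
          gcongr
          linarith
    · rw [hρ] at hge ⊢
      refine h q hq ε _ _ hε.1 (by positivity) ?_ (fun n hn => ?_) (fun n hn => ?_) _ _ hx0
        (by rwa [one_mul])
      · have h3 := natDegree_mul_spaceFactor_pow_le
          (timeFactor (symbolPoly Q ε - symbolPoly Q 0)) 1
        have h4 := natDegree_timeFactor_le (symbolPoly Q ε - symbolPoly Q 0)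
        have h5 := natDegree_sub_le_of_le (natDegree_symbolPoly_le Q ε)
          (natDegree_symbolPoly_le Q 0)
        rw [max_self] at h5
        omega
      · rw [coeff_mul_spaceFactor_pow]
        split_ifs with hn1
        · have : (symbolPoly Q ε - symbolPoly Q 0).coeff (n - 1) = 0 := by
            rw [coeff_sub]
            rcases lt_or_ge (n - 1) 2 with h6 | h6
            · rw [coeff_symbolPoly_of_lt Q _ h6, coeff_symbolPoly_of_lt Q _ h6, sub_self]
            · rw [show n - 1 = 0 + 2 by omega, coeff_symbolPoly, coeff_symbolPoly]; simp
          rw [coeff_timeFactor, this]; simp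
        · rfl
      · rw [coeff_mul_spaceFactor_pow, if_pos (by omega), norm_mul, norm_coeff_timeFactor,
          hA']
        have h6 := hcoeff ε hε.1 (n - 3)
        have h7 := coeff_symbolPoly Q 0 (n - 3)
        rw [show n - 3 + 2 = n - 1 by omega] at h6 h7
        rw [mul_zero, zero_pow (by omega), mul_zero, mul_zero] at h7
        rw [coeff_sub, h7, sub_zero]
        rw [show n - 3 = n - 4 + 1 by omega, pow_succ'] at h6
        exact (mul_le_mul_of_nonneg_left h6 (norm_nonneg _)).trans (le_of_eq (by ring))

end Admissible

/-! ### The increment bound -/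

lemma norm_coe_le_abs (s : ℝ) : ‖(s : UnitAddCircle)‖ ≤ |s| := by
  rw [UnitAddCircle.norm_eq]
  simpa using round_le s 0

lemma le_rpow_mul_rpow {a b δ : ℝ} (ha : 0 ≤ a) (hb : 0 < b) (hab : a ≤ b) (hδ : δ ∈ Set.Icc (0 : ℝ) 1) :
    a * (b ^ 3)⁻¹ ≤ a ^ δ * b ^ (-2 - δ) := by
  rcases ha.eq_or_lt with h0 | h0
  · rw [← h0, zero_mul]; positivity
  calc a * (b ^ 3)⁻¹ = a ^ δ * (a ^ (1 - δ) * (b ^ 3)⁻¹) := by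
        rw [← mul_assoc, ← Real.rpow_add h0]; simp
    _ ≤ a ^ δ * (b ^ (1 - δ) * (b ^ 3)⁻¹) := by
        have : 0 ≤ 1 - δ := by linarith [hδ.2]
        gcongr
    _ = _ := by
        rw [show (b ^ 3)⁻¹ = b ^ (-3 : ℝ) by
          rw [Real.rpow_neg hb.le]; norm_cast, ← Real.rpow_add hb]
        congr 2; ring

/-- A time step `h` lowers the parabolic size by at most `√|h|`, so the whole segment stays outside
the ball of radius `b`, where the derivative bound holds. -/
lemma abs_increment_time_le {f : SpaceTime → ℝ}
    (hf : ∀ (t : ℝ) (y : UnitAddCircle), ((t, y) : SpaceTime) ≠ 0 →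
      DifferentiableAt ℝ (fun s => f (s, y)) t) {z : SpaceTime} {h b B : ℝ} (hb : 0 < b)
    (hh : √|h| ≤ parSize z - b) (hB : ∀ w : SpaceTime, w ≠ 0 → b ≤ parSize w → |timeDeriv f w| ≤ B) :
    |f (z.1 + h, z.2) - f z| ≤ B * |h| := by
  have key : ∀ s ∈ Set.uIcc z.1 (z.1 + h), ((s, z.2) : SpaceTime) ≠ 0 ∧
      b ≤ parSize ((s, z.2) : SpaceTime) := by
    intro s hs
    have h1 : |s - z.1| ≤ |h| := by
      have := Set.abs_sub_left_of_mem_uIcc hs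
      simpa using this
    have h2 := parSize_add_le ((s, z.2) : SpaceTime) (z.1 - s, 0)
    have h3 : ((s, z.2) : SpaceTime) + (z.1 - s, 0) = z := by ext <;> simp
    have h4 : parSize ((z.1 - s, 0) : SpaceTime) ≤ √|h| := by
      simp only [parSize, norm_zero, add_zero]
      rw [abs_sub_comm]
      exact Real.sqrt_le_sqrt h1
    rw [h3] at h2
    have h5 : b ≤ parSize ((s, z.2) : SpaceTime) := by linarith
    refine ⟨fun h0 => ?_, h5⟩
    rw [h0] at h5
    simp [parSize] at h5
    linarith
  have := (convex_uIcc z.1 (z.1 + h)).norm_image_sub_le_of_norm_deriv_le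
    (f := fun s => f (s, z.2)) (C := B) (fun s hs => hf s z.2 (key s hs).1)
    (fun s hs => hB (s, z.2) (key s hs).1 (key s hs).2) Set.left_mem_uIcc Set.right_mem_uIcc
  simpa using this

lemma abs_increment_space_le {f : SpaceTime → ℝ}
    (hf : ∀ (t : ℝ) (y : UnitAddCircle), ((t, y) : SpaceTime) ≠ 0 →
      DifferentiableAt ℝ (fun s : ℝ => f (t, y + (s : UnitAddCircle))) 0) {z : SpaceTime}
    {r b B : ℝ} (hb : 0 < b)
    (hr : |r| ≤ parSize z - b) (hB : ∀ w : SpaceTime, w ≠ 0 → b ≤ parSize w → |spaceDeriv f w| ≤ B) :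
    |f (z.1, z.2 + (r : UnitAddCircle)) - f z| ≤ B * |r| := by
  have key : ∀ s ∈ Set.uIcc 0 r, ((z.1, z.2 + (s : UnitAddCircle)) : SpaceTime) ≠ 0 ∧
      b ≤ parSize ((z.1, z.2 + (s : UnitAddCircle)) : SpaceTime) := by
    intro s hs
    have h1 : |s| ≤ |r| := by
      have := Set.abs_sub_left_of_mem_uIcc hs
      simpa using this
    have h2 := parSize_add_le ((z.1, z.2 + (s : UnitAddCircle)) : SpaceTime)
      (0, -(s : UnitAddCircle))
    have h3 : ((z.1, z.2 + (s : UnitAddCircle)) : SpaceTime) + (0, -(s : UnitAddCircle)) = z := by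
      ext <;> simp
    have h4 : parSize ((0, -(s : UnitAddCircle)) : SpaceTime) ≤ |r| := by
      simp only [parSize, abs_zero, Real.sqrt_zero, norm_neg, zero_add]
      exact (norm_coe_le_abs s).trans h1
    rw [h3] at h2
    have h5 : b ≤ parSize ((z.1, z.2 + (s : UnitAddCircle)) : SpaceTime) := by linarith
    refine ⟨fun h0 => ?_, h5⟩
    rw [h0] at h5
    simp [parSize] at h5
    linarith
  have hd : ∀ s ∈ Set.uIcc 0 r, HasDerivAt (fun s : ℝ => f (z.1, z.2 + (s : UnitAddCircle)))
      (spaceDeriv f (z.1, z.2 + (s : UnitAddCircle))) s := by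
    intro s hs
    have h1 := (hf _ _ (key s hs).1).hasDerivAt
    have h2 : HasDerivAt (fun u : ℝ => f (z.1, z.2 + (s : UnitAddCircle) +
        ((u - s : ℝ) : UnitAddCircle))) (spaceDeriv f (z.1, z.2 + (s : UnitAddCircle))) s := by
      refine HasDerivAt.comp_sub_const (f := fun u : ℝ => f (z.1, z.2 + (s : UnitAddCircle) +
        (u : UnitAddCircle))) s s ?_
      rw [sub_self]
      exact h1
    refine h2.congr_of_eventuallyEq (Filter.Eventually.of_forall fun u => ?_)
    simp
  have := (convex_uIcc 0 r).norm_image_sub_le_of_norm_hasDerivWithin_le (C := B)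
    (fun s hs => (hd s hs).hasDerivWithinAt)
    (fun s hs => hB _ (key s hs).1 (key s hs).2) Set.left_mem_uIcc Set.right_mem_uIcc
  simpa using this

/-- Only derivative bounds and differentiability enter, so the argument serves `P_ε` and `K_ε`
alike. The one case that needs more than the triangle inequality is `|x| < |y| / 2` with `|y| ≥ ε`;
the path from `-y` to `x - y` then stays at size at least `|y| / 2 ≥ ε / 2`, whence the constant `1
/ 2` in the bound on the time derivative. -/
lemma incrementBound_of_derivBound {G : ℝ → SpaceTime → ℝ} {δ : ℝ} (hδ : δ ∈ Set.Icc (0 : ℝ) 1)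
    (h1 : DerivBound G 0 1 0) (h2 : DerivBound G 0 2 0) (h3 : DerivBound G 1 1 (1 / 2))
    (ht : ∀ ε ∈ Set.Icc (0 : ℝ) 1, ∀ (t : ℝ) (y : UnitAddCircle), ((t, y) : SpaceTime) ≠ 0 →
      DifferentiableAt ℝ (fun s => mixedDeriv 0 1 (G ε) (s, y)) t)
    (hs : ∀ ε ∈ Set.Icc (0 : ℝ) 1, ∀ (t : ℝ) (y : UnitAddCircle), ((t, y) : SpaceTime) ≠ 0 →
      DifferentiableAt ℝ (fun s : ℝ => mixedDeriv 0 1 (G ε) (t, y + (s : UnitAddCircle))) 0) :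
    IncrementBound G δ := by
  obtain ⟨C₁, h1⟩ := h1
  obtain ⟨C₂, h2⟩ := h2
  obtain ⟨C₃, h3⟩ := h3
  -- The first term covers the cases settled by the size of `G_ε'`; the factors `16` and `8` are the
  -- fourth and third powers of `2` lost on replacing `|y|` by `|y| / 2`.
  refine ⟨10 * |C₁| + (16 * |C₃| + 8 * |C₂|), fun ε hε x y hy hxy => ?_⟩
  have hb := parSize_pos hy
  have he := parSize_pos (sub_ne_zero.2 hxy)
  have ha := parSize_nonneg x
  have hC₁ := abs_nonneg C₁
  have hC₂ := abs_nonneg C₂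
  have hC₃ := abs_nonneg C₃
  have hG : ∀ z : SpaceTime, z ≠ 0 → |mixedDeriv 0 1 (G ε) z| ≤ |C₁| * (parSize z ^ 2)⁻¹ := by
    intro z hz
    have hz0 := parSize_pos hz
    refine (h1 ε hε z hz (by rw [zero_mul]; exact hz0.le)).trans ?_
    have := le_abs_self C₁
    gcongr
  have hL : |mixedDeriv 0 1 (G ε) (x - y) - mixedDeriv 0 1 (G ε) (-y)| ≤
      |C₁| * (parSize (x - y) ^ 2)⁻¹ + |C₁| * (parSize y ^ 2)⁻¹ := by
    refine (abs_sub _ _).trans (add_le_add (hG _ (sub_ne_zero.2 hxy)) ?_)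
    have := hG (-y) (neg_ne_zero.2 hy)
    rwa [parSize_neg] at this
  have hae : parSize x ≤ parSize (x - y) + parSize y := by
    have := parSize_add_le (x - y) y
    rwa [sub_add_cancel] at this
  rw [incrementRHS]
  have hK : ∀ {c u v : ℝ}, 0 ≤ u → c ≤ 10 * |C₁| → v ≤ c * u →
      v ≤ (10 * |C₁| + (16 * |C₃| + 8 * |C₂|)) * u := fun hu hc hv =>
    hv.trans (mul_le_mul_of_nonneg_right (by linarith) hu)
  split_ifs with c1 c2 c3
  · refine hK (c := 2 * |C₁|) (by positivity) (by linarith) (hL.trans ?_)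
    have : (parSize (x - y) ^ 2)⁻¹ ≤ (parSize y ^ 2)⁻¹ := by gcongr; linarith
    nlinarith
  · refine hK (c := 2 * |C₁|) (by positivity) (by linarith) (hL.trans ?_)
    have : (parSize y ^ 2)⁻¹ ≤ (parSize (x - y) ^ 2)⁻¹ := by gcongr; linarith
    nlinarith
  all_goals
    have hL' : |mixedDeriv 0 1 (G ε) (x - y) - mixedDeriv 0 1 (G ε) (-y)| ≤
        5 * |C₁| * (parSize y ^ 2)⁻¹ := by
      refine hL.trans ?_
      have h4 : (parSize (x - y) ^ 2)⁻¹ ≤ ((parSize y / 2) ^ 2)⁻¹ := by gcongr; linarith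
      have h5 : ((parSize y / 2) ^ 2)⁻¹ = 4 * (parSize y ^ 2)⁻¹ := by field_simp; norm_num
      rw [h5] at h4
      nlinarith
  · exact hK (c := 5 * |C₁|) (by positivity) (by linarith) hL'
  rcases le_or_gt (parSize y / 2) (parSize x) with c4 | c4
  · refine hK (c := 10 * |C₁|) (by positivity) le_rfl (hL'.trans ?_)
    have h6 : (parSize y ^ 2)⁻¹ ≤ 2 * (parSize x ^ δ * parSize y ^ (-2 - δ)) := by
      calc (parSize y ^ 2)⁻¹ = 2 * (parSize y / 2 * (parSize y ^ 3)⁻¹) := by field_simp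
        _ ≤ 2 * ((parSize y / 2) ^ δ * parSize y ^ (-2 - δ)) := by
          gcongr 2 * ?_
          exact le_rpow_mul_rpow (by positivity) hb (by linarith) hδ
        _ ≤ _ := by gcongr; exact hδ.1
    nlinarith
  · set f := mixedDeriv 0 1 (G ε) with hf
    obtain ⟨r, hr, hrn, -⟩ := exists_real_rep x.2
    have hx0 : √|x.1| ≤ parSize x := by simp [parSize]
    have hxp : parSize x = √|x.1| + |r| := by rw [hrn]; rfl
    have hb2 : 0 < parSize y / 2 := by positivity
    -- The path first moves in time by `x.1`, then in space by the representative `r` of `x.2`. The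
    -- space step has `|x| - √|x.1|` to cover, which leaves the lower bound `|y| / 2` on the size
    -- intact.
    have e1 := abs_increment_time_le (ht ε hε) (z := -y) (h := x.1) (B := |C₃| * ((parSize y / 2) ^ 4)⁻¹)
      hb2 (by rw [parSize_neg]; linarith) (fun w hw hwb => by
        have hw0 := parSize_pos hw
        refine (h3 ε hε w hw (by linarith)).trans ?_
        have := le_abs_self C₃
        gcongr)
    have hz : parSize (-y) ≤ parSize (((-y).1 + x.1, (-y).2) : SpaceTime) + √|x.1| := by
      have h7 := parSize_add_le (((-y).1 + x.1, (-y).2) : SpaceTime) (-x.1, 0)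
      have h8 : (((-y).1 + x.1, (-y).2) : SpaceTime) + (-x.1, 0) = -y := by ext <;> simp
      rw [h8] at h7
      simpa [parSize] using h7
    rw [parSize_neg] at hz
    have e2 := abs_increment_space_le (hs ε hε) (z := ((-y).1 + x.1, (-y).2)) (r := r)
      (B := |C₂| * ((parSize y / 2) ^ 3)⁻¹) hb2 (by linarith) (fun w hw hwb => by
        have hw0 := parSize_pos hw
        refine (h2 ε hε w hw (by rw [zero_mul]; exact hw0.le)).trans ?_
        have := le_abs_self C₂
        gcongr)
    have e3 : (((-y).1 + x.1, (-y).2 + (r : UnitAddCircle)) : SpaceTime) = x - y := by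
      rw [hr]; exact Prod.ext (neg_add_eq_sub _ _) (neg_add_eq_sub _ _)
    simp only [] at e2
    rw [e3] at e2
    -- The time derivative is worse by one power of `|y|`; this is recovered since `x.1` is
    -- quadratic in the parabolic size.
    have hx1 : |x.1| ≤ parSize x * parSize y := by
      have h9 : |x.1| = √|x.1| ^ 2 := (Real.sq_sqrt (abs_nonneg _)).symm
      rw [h9, pow_two]
      have := Real.sqrt_nonneg |x.1|
      gcongr
      linarith
    have hrx : |r| ≤ parSize x := by have := Real.sqrt_nonneg |x.1|; linarith
    have hfin : |f (x - y) - f (-y)| ≤ (16 * |C₃| + 8 * |C₂|) * (parSize x * (parSize y ^ 3)⁻¹) := by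
      calc |f (x - y) - f (-y)| ≤ |f (x - y) - f ((-y).1 + x.1, (-y).2)| +
            |f ((-y).1 + x.1, (-y).2) - f (-y)| := abs_sub_le _ _ _
        _ ≤ |C₂| * ((parSize y / 2) ^ 3)⁻¹ * |r| + |C₃| * ((parSize y / 2) ^ 4)⁻¹ * |x.1| :=
          add_le_add e2 e1
        _ ≤ |C₂| * ((parSize y / 2) ^ 3)⁻¹ * parSize x +
            |C₃| * ((parSize y / 2) ^ 4)⁻¹ * (parSize x * parSize y) := by gcongr
        _ = _ := by field_simp; ring
    refine hfin.trans ?_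
    have h10 := le_rpow_mul_rpow ha hb (by linarith) hδ
    have h11 : 0 ≤ parSize x ^ δ * parSize y ^ (-2 - δ) := by positivity
    nlinarith [mul_le_mul_of_nonneg_left h10 (by positivity : 0 ≤ 16 * |C₃| + 8 * |C₂|)]

/-! ### Increments, smoothness and symmetry of `P_ε`. -/

section Admissible

variable {Q : ℝ[X]}

lemma IsAdmissible.differentiableAt_time (hQ : IsAdmissible Q) (l : ℕ) {ε : ℝ} (hε : 0 ≤ ε) (t : ℝ)
    (y : UnitAddCircle) (hx : ((t, y) : SpaceTime) ≠ 0) :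
    DifferentiableAt ℝ (fun s => mixedDeriv 0 l (greenP Q ε) (s, y)) t := by
  obtain ⟨M, hM, hs⟩ := hQ.exists_isSymbol
  refine ((hasDerivAt_reKernel_time (hs ε hε) hM (spaceFactor ^ l * 1) hx).congr_of_eventuallyEq
    ?_).differentiableAt
  filter_upwards [eventually_ne_zero_time hx] with s hs'
  rw [hQ.greenP_eq, mixedDeriv_reKernel (hs ε hε) hM 1 0 l _ hs', pow_zero, one_mul]

lemma IsAdmissible.differentiableAt_space (hQ : IsAdmissible Q) (l : ℕ) {ε : ℝ} (hε : 0 ≤ ε) (t : ℝ)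
    (y : UnitAddCircle) (hx : ((t, y) : SpaceTime) ≠ 0) :
    DifferentiableAt ℝ (fun s : ℝ => mixedDeriv 0 l (greenP Q ε) (t, y + (s : UnitAddCircle))) 0 := by
  obtain ⟨M, hM, hs⟩ := hQ.exists_isSymbol
  obtain ⟨r, rfl, -, -⟩ := exists_real_rep y
  have h := hasDerivAt_reKernel_space (hs ε hε) hM (spaceFactor ^ l * 1) hx
  have h2 : DifferentiableAt ℝ (fun s : ℝ => reKernel (symbolPoly Q ε) (spaceFactor ^ l * 1)
      (t, ((r + s : ℝ) : UnitAddCircle))) 0 := by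
    have h' : HasDerivAt (fun s : ℝ => reKernel (symbolPoly Q ε) (spaceFactor ^ l * 1)
      (t, (s : UnitAddCircle))) (reKernel (symbolPoly Q ε) (spaceFactor * (spaceFactor ^ l * 1))
        (t, (r : UnitAddCircle))) (r + 0) := by rwa [add_zero]
    exact (HasDerivAt.comp_const_add r 0 h').differentiableAt
  refine h2.congr_of_eventuallyEq ?_
  filter_upwards [eventually_ne_zero_space hx] with s hs'
  rw [hQ.greenP_eq, mixedDeriv_reKernel (hs ε hε) hM 1 0 l _ hs', pow_zero, one_mul,
    AddCircle.coe_add]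

lemma IsAdmissible.incrementBound (hQ : IsAdmissible Q) {δ : ℝ} (hδ : δ ∈ Set.Icc (0 : ℝ) 1) :
    IncrementBound (greenP Q) δ :=
  incrementBound_of_derivBound hδ (hQ.derivBound_space le_rfl) (hQ.derivBound_space one_le_two)
    (hQ.derivBound_time 1 one_half_pos) (fun _ hε => hQ.differentiableAt_time 1 hε.1)
    (fun _ hε => hQ.differentiableAt_space 1 hε.1)

lemma IsAdmissible.isSmoothOffOrigin (hQ : IsAdmissible Q) {ε : ℝ} (hε : 0 ≤ ε) :
    IsSmoothOffOrigin (greenP Q ε) := by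
  obtain ⟨M, hM, hs⟩ := hQ.exists_isSymbol
  rw [hQ.greenP_eq]
  exact isSmoothOffOrigin_reKernel (hs ε hε) hM 1

lemma isNonAnticipative_greenP (Q : ℝ[X]) (ε : ℝ) : IsNonAnticipative (greenP Q ε) :=
  fun _ hx => if_neg hx.not_gt

/-- Complex conjugation of the series replaces `y` by `-y` and leaves the real part unchanged. -/
lemma isSpaceSymmetric_greenP (Q : ℝ[X]) (ε : ℝ) : IsSpaceSymmetric (greenP Q ε) := by
  intro t y
  simp only [greenP]
  split_ifs
  · rw [← Complex.conj_re, Complex.conj_tsum]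
    congr 2
    ext k
    rw [map_mul, Complex.conj_ofReal, ← fourier_neg, fourier_apply, fourier_apply, smul_neg, neg_smul,
      neg_neg]
  · rfl

end Admissible

/-! ### The cutoff in time -/

/-- A smooth function of time that vanishes before time `1/2` and equals `1` after time `3/4`. -/
def lateCutoff (t : ℝ) : ℝ := Real.smoothTransition (4 * t - 2)

lemma lateCutoff_of_le {t : ℝ} (ht : t ≤ 1 / 2) : lateCutoff t = 0 :=
  Real.smoothTransition.zero_of_nonpos (by linarith)

lemma lateCutoff_of_ge {t : ℝ} (ht : 3 / 4 ≤ t) : lateCutoff t = 1 :=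
  Real.smoothTransition.one_of_one_le (by linarith)

lemma contDiff_lateCutoff : ContDiff ℝ ∞ lateCutoff :=
  Real.smoothTransition.contDiff.comp ((contDiff_const.mul contDiff_id).sub contDiff_const)

lemma differentiableAt_lateCutoff (t : ℝ) : DifferentiableAt ℝ lateCutoff t :=
  contDiff_lateCutoff.differentiable (by simp) t

lemma abs_one_sub_lateCutoff_le (t : ℝ) : |1 - lateCutoff t| ≤ 1 := by
  have h1 := Real.smoothTransition.nonneg (4 * t - 2)
  have h2 := Real.smoothTransition.le_one (4 * t - 2)
  rw [abs_le, lateCutoff]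
  constructor <;> linarith

lemma exists_abs_iteratedDeriv_lateCutoff_le (j : ℕ) :
    ∃ B : ℝ, 0 ≤ B ∧ ∀ t, |iteratedDeriv j lateCutoff t| ≤ B := by
  obtain ⟨B, hB⟩ := (isCompact_Icc (a := (1 / 2 : ℝ)) (b := 3 / 4)).exists_bound_of_continuousOn
    (contDiff_lateCutoff.continuous_iteratedDeriv j (by exact_mod_cast le_top)).continuousOn
  have hconst : ∀ c : ℝ, |c| ≤ 1 → ∀ t : ℝ, |iteratedDeriv j (fun _ : ℝ => c) t| ≤ 1 := by
    intro c hc t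
    rw [iteratedDeriv_const]
    split_ifs
    · exact hc
    · simp
  refine ⟨max B 1, by positivity, fun t => ?_⟩
  by_cases ht : t ∈ Set.Icc (1 / 2 : ℝ) (3 / 4)
  · exact (hB t ht).trans (le_max_left _ _)
  · refine le_trans ?_ (le_max_right _ _)
    rcases lt_or_ge t (1 / 2) with h | h
    · have : lateCutoff =ᶠ[nhds t] fun _ => 0 := by
        filter_upwards [gt_mem_nhds h] with s hs using lateCutoff_of_le hs.le
      rw [this.iteratedDeriv_eq]
      exact hconst 0 (by simp) t
    · have h' : 3 / 4 < t := by
        by_contra h''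
        exact ht ⟨h, not_lt.1 h''⟩
      have : lateCutoff =ᶠ[nhds t] fun _ => 1 := by
        filter_upwards [lt_mem_nhds h'] with s hs using lateCutoff_of_ge hs.le
      rw [this.iteratedDeriv_eq]
      exact hconst 1 (by simp) t

lemma deriv_lateCutoff_of_gt {t : ℝ} (ht : 3 / 4 < t) : deriv lateCutoff t = 0 := by
  have : lateCutoff =ᶠ[nhds t] fun _ => 1 := by
    filter_upwards [lt_mem_nhds ht] with s hs using lateCutoff_of_ge hs.le
  rw [this.deriv_eq, deriv_const]

/-! ### Derivatives of products with functions of time -/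

/-- The factor is constant in space, and constants pass through `deriv` without any
differentiability of `f`. -/
lemma spaceDeriv_iterate_mul (η : ℝ → ℝ) (f : SpaceTime → ℝ) (l : ℕ) :
    spaceDeriv^[l] (fun x => η x.1 * f x) = fun x => η x.1 * spaceDeriv^[l] f x := by
  induction l with
  | zero => rfl
  | succ l ih =>
    rw [Function.iterate_succ_apply', ih, Function.iterate_succ_apply']
    ext x
    simp only [spaceDeriv, deriv_const_mul_field']

lemma timeDeriv_iterate_eq (f : SpaceTime → ℝ) (m : ℕ) (t : ℝ) (y : UnitAddCircle) :
    timeDeriv^[m] f (t, y) = iteratedDeriv m (fun s => f (s, y)) t := by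
  induction m generalizing t with
  | zero => simp
  | succ m ih =>
    rw [Function.iterate_succ_apply', iteratedDeriv_succ, timeDeriv]
    simp only [ih]

lemma mixedDeriv_zero_mul (η : ℝ → ℝ) (f : SpaceTime → ℝ) (l : ℕ) (x : SpaceTime) :
    mixedDeriv 0 l (fun x => η x.1 * f x) x = η x.1 * mixedDeriv 0 l f x := by
  simp only [mixedDeriv, spaceDeriv_iterate_mul, Function.iterate_zero, id]

lemma mixedDeriv_one_mul {η : ℝ → ℝ} {f : SpaceTime → ℝ} {l : ℕ} {x : SpaceTime}
    (hη : DifferentiableAt ℝ η x.1)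
    (hf : DifferentiableAt ℝ (fun s => mixedDeriv 0 l f (s, x.2)) x.1) :
    mixedDeriv 1 l (fun x => η x.1 * f x) x =
      deriv η x.1 * mixedDeriv 0 l f x + η x.1 * mixedDeriv 1 l f x := by
  have h : mixedDeriv 1 l (fun x => η x.1 * f x) x =
      deriv (fun s => η s * mixedDeriv 0 l f (s, x.2)) x.1 := by
    simp only [mixedDeriv, spaceDeriv_iterate_mul, Function.iterate_one, Function.iterate_zero, id]
    rfl
  rw [h, deriv_fun_mul hη hf]
  rfl

/-! ### Late times -/

/-- At times `t ≥ 1/2` one part of the exponential, `e^{-q/4}`, absorbs the power `q ^ m` however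
large `q` is, and another is a Gaussian in `k` that sums the series. No lower bound on `|x|` in
terms of `ε` is needed. -/
lemma exists_norm_expSeries_late_le (d : ℕ) {M : ℝ} (hM : 0 < M) (m l : ℕ) :
    ∃ B : ℝ, 0 ≤ B ∧ ∀ q, IsSymbol d M q → ∀ t : ℝ, 1 / 2 ≤ t → ∀ x : UnitAddCircle,
      ‖expSeries q (timeFactor q ^ m * (spaceFactor ^ l * 1)) t x‖ ≤ B := by
  obtain ⟨B, hB, h⟩ := exists_pow_mul_exp_neg_le m (c := 1 / 4) (by norm_num)
  have hsum := (summable_norm_eval_mul_exp (spaceFactor ^ l * 1) (c := 1 / 4 / M)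
    (by positivity)).mul_left B
  refine ⟨_, tsum_nonneg fun k => ?_, fun q hq t ht x =>
    tsum_of_norm_bounded hsum.hasSum fun k => ?_⟩
  · positivity
  · have hq0 := hq.eval_nonneg hM (k : ℝ)
    have h1 := h _ hq0
    have h2 := hq.exp_le hM (t₀ := 1 / 4) (by norm_num) le_rfl (k : ℝ)
    have h3 : Real.exp (-(q.eval (k : ℝ) * t)) ≤
        Real.exp (-(1 / 4 * q.eval (k : ℝ))) * Real.exp (-(q.eval (k : ℝ) * (1 / 4))) := by
      rw [← Real.exp_add]
      refine Real.exp_le_exp.2 ?_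
      nlinarith
    rw [norm_mul, norm_fourier_apply, mul_one, norm_mul, eval_mul, norm_mul, eval_pow, norm_pow,
      eval_timeFactor, norm_neg, Complex.norm_real, Complex.norm_real, Real.norm_eq_abs,
      Real.norm_eq_abs, Real.abs_exp, abs_of_nonneg hq0]
    calc q.eval (k : ℝ) ^ m * ‖(spaceFactor ^ l * 1).eval (k : ℂ)‖ *
          Real.exp (-(q.eval (k : ℝ) * t))
        ≤ q.eval (k : ℝ) ^ m * ‖(spaceFactor ^ l * 1).eval (k : ℂ)‖ *
          (Real.exp (-(1 / 4 * q.eval (k : ℝ))) * Real.exp (-(1 / 4 / M * (k : ℝ) ^ 2))) := by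
          gcongr
          exact h3.trans (mul_le_mul_of_nonneg_left h2 (Real.exp_pos _).le)
      _ = (q.eval (k : ℝ) ^ m * Real.exp (-(1 / 4 * q.eval (k : ℝ)))) *
          (‖(spaceFactor ^ l * 1).eval (k : ℂ)‖ * Real.exp (-(1 / 4 / M * (k : ℝ) ^ 2))) := by ring
      _ ≤ _ := by gcongr

/-! ### The decomposition of the Green's function -/

/-- The singular part of the Green's function. -/
def singularPart (Q : ℝ[X]) (ε : ℝ) (x : SpaceTime) : ℝ := (1 - lateCutoff x.1) * greenP Q ε x

/-- The smooth part of the Green's function. -/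
def smoothPart (Q : ℝ[X]) (ε : ℝ) (x : SpaceTime) : ℝ := lateCutoff x.1 * greenP Q ε x

lemma tsupport_singularPart_subset (Q : ℝ[X]) (ε : ℝ) :
    tsupport (singularPart Q ε) ⊆ Set.Icc (0 : ℝ) 1 ×ˢ Set.univ := by
  refine closure_minimal (fun x hx => ?_) (isClosed_Icc.prod isClosed_univ)
  refine ⟨⟨?_, ?_⟩, Set.mem_univ _⟩
  · by_contra h
    exact hx (by rw [singularPart, isNonAnticipative_greenP Q ε x (not_le.1 h), mul_zero])
  · by_contra h
    exact hx (by rw [singularPart, lateCutoff_of_ge (by linarith), sub_self, zero_mul])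

section Admissible

variable {Q : ℝ[X]}

lemma IsAdmissible.isSmoothOffOrigin_singularPart (hQ : IsAdmissible Q) {ε : ℝ} (hε : 0 ≤ ε) :
    IsSmoothOffOrigin (singularPart Q ε) :=
  ContDiffOn.mul (f := fun z : ℝ × ℝ => 1 - lateCutoff z.1)
    (contDiff_const.sub (contDiff_lateCutoff.comp contDiff_fst)).contDiffOn
    (hQ.isSmoothOffOrigin hε)

lemma IsAdmissible.isSmooth_smoothPart (hQ : IsAdmissible Q) {ε : ℝ} (hε : 0 ≤ ε) :
    IsSmooth (smoothPart Q ε) := by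
  refine contDiff_iff_contDiffAt.2 fun z => ?_
  rcases lt_or_ge z.1 (1 / 2) with h | h
  · refine (contDiffAt_const (c := (0 : ℝ))).congr_of_eventuallyEq ?_
    filter_upwards [(isOpen_lt continuous_fst continuous_const).mem_nhds h] with w hw
    rw [spaceLift, smoothPart, lateCutoff_of_le (le_of_lt hw), zero_mul]
  · refine ContDiffAt.mul (f := fun z : ℝ × ℝ => lateCutoff z.1)
      (contDiff_lateCutoff.comp contDiff_fst).contDiffAt
      ((hQ.isSmoothOffOrigin hε).contDiffAt (isOpen_offOrigin.mem_nhds fun h0 => ?_))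
    have h1 : z.1 = 0 := congrArg Prod.fst h0
    linarith

lemma IsAdmissible.exists_abs_mixedDeriv_smoothPart_le (hQ : IsAdmissible Q) (m l : ℕ) :
    ∃ C : ℝ, ∀ ε ∈ Set.Icc (0 : ℝ) 1, ∀ x : SpaceTime, |mixedDeriv m l (smoothPart Q ε) x| ≤ C := by
  obtain ⟨M, hM, hs⟩ := hQ.exists_isSymbol
  choose A hA hη using exists_abs_iteratedDeriv_lateCutoff_le
  choose B hB hE using fun j => exists_norm_expSeries_late_le (Q.natDegree + 2) hM j l
  refine ⟨∑ i ∈ Finset.range (m + 1), m.choose i * A i * B (m - i), fun ε hε x => ?_⟩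
  obtain ⟨t, y⟩ := x
  have hq := hs ε hε.1
  have e1 : mixedDeriv m l (smoothPart Q ε) (t, y) =
      iteratedDeriv m (fun s => lateCutoff s * spaceDeriv^[l] (greenP Q ε) (s, y)) t := by
    rw [mixedDeriv, timeDeriv_iterate_eq]
    unfold smoothPart
    rw [spaceDeriv_iterate_mul]
  have hnn : 0 ≤ ∑ i ∈ Finset.range (m + 1), m.choose i * A i * B (m - i) :=
    Finset.sum_nonneg fun i _ => by
      have := hA i
      have := hB (m - i)
      positivity
  rw [e1]
  rcases lt_or_ge t (1 / 2) with ht | ht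
  · have : (fun s => lateCutoff s * spaceDeriv^[l] (greenP Q ε) (s, y)) =ᶠ[nhds t]
        fun _ => (0 : ℝ) := by
      filter_upwards [gt_mem_nhds ht] with s hs'
      rw [lateCutoff_of_le hs'.le, zero_mul]
    rw [this.iteratedDeriv_eq, iteratedDeriv_const]
    simpa using hnn
  have hne : ∀ s : ℝ, 0 < s → ((s, y) : SpaceTime) ≠ 0 := fun s hs' h0 =>
    hs'.ne' (congrArg Prod.fst h0)
  have ht0 : 0 < t := by linarith
  have e2 : (fun s => spaceDeriv^[l] (greenP Q ε) (s, y)) =ᶠ[nhds t]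
      fun s => reKernel (symbolPoly Q ε) (spaceFactor ^ l * 1) (s, y) := by
    filter_upwards [lt_mem_nhds ht0] with s hs'
    have := mixedDeriv_reKernel hq hM 1 0 l (s, y) (hne s hs')
    rw [pow_zero, one_mul, ← hQ.greenP_eq] at this
    exact this
  have hsm : ContDiffAt ℝ m
      (fun s => reKernel (symbolPoly Q ε) (spaceFactor ^ l * 1) (s, y)) t := by
    obtain ⟨r, rfl, -, -⟩ := exists_real_rep y
    have h1 := (isSmoothOffOrigin_reKernel hq hM (spaceFactor ^ l * 1)).contDiffAt
      (x := (t, r)) (isOpen_offOrigin.mem_nhds (hne t ht0))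
    have h2 : ContDiffAt ℝ ∞ (fun s : ℝ => ((s, r) : ℝ × ℝ)) t :=
      contDiffAt_id.prodMk contDiffAt_const
    exact (ContDiffAt.comp (n := ∞) t h1 h2).of_le (m := m) (by exact_mod_cast le_top)
  have hη' : ContDiffAt ℝ m lateCutoff t :=
    (contDiff_infty.1 contDiff_lateCutoff m).contDiffAt
  rw [iteratedDeriv_fun_mul hη' (hsm.congr_of_eventuallyEq e2)]
  refine (Finset.abs_sum_le_sum_abs _ _).trans (Finset.sum_le_sum fun i _ => ?_)
  have e3 : iteratedDeriv (m - i) (fun s => spaceDeriv^[l] (greenP Q ε) (s, y)) t =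
      reKernel (symbolPoly Q ε) (timeFactor (symbolPoly Q ε) ^ (m - i) * (spaceFactor ^ l * 1))
        (t, y) := by
    rw [← timeDeriv_iterate_eq, ← mixedDeriv, hQ.greenP_eq,
      mixedDeriv_reKernel hq hM 1 (m - i) l (t, y) (hne t ht0)]
  rw [e3, abs_mul, abs_mul, Nat.abs_cast]
  have h4 := abs_reKernel_le (symbolPoly Q ε)
    (timeFactor (symbolPoly Q ε) ^ (m - i) * (spaceFactor ^ l * 1)) (t, y) (hB (m - i))
    fun _ => hE (m - i) _ hq t ht y
  have h5 := hη i t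
  have := hA i
  gcongr

/-! ### Bounds on the singular part. -/

lemma IsAdmissible.exists_abs_mixedDeriv_early_le (hQ : IsAdmissible Q) (l : ℕ) :
    ∃ C : ℝ, 0 ≤ C ∧ ∀ ε ∈ Set.Icc (0 : ℝ) 1, ∀ x : SpaceTime, x ≠ 0 → x.1 ≤ 3 / 4 →
      |mixedDeriv 0 l (greenP Q ε) x| ≤ C * (parSize x ^ (l + 1))⁻¹ := by
  rcases Nat.eq_zero_or_pos l with rfl | hl
  · obtain ⟨C, h⟩ := hQ.greenP_bound
    refine ⟨|C| * (5 / 2), by positivity, fun ε hε x hx hx1 => ?_⟩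
    have hp := parSize_pos hx
    rcases le_or_gt x.1 0 with hx0 | hx0
    · have : mixedDeriv 0 0 (greenP Q ε) x = 0 := if_neg hx0.not_gt
      rw [this, abs_zero]
      positivity
    refine (h ε hε x hx).trans ?_
    have h1 : parSize x ≤ 3 / 2 := by
      have h2 := AddCircle.norm_le_half_period (x := x.2) (1 : ℝ) one_ne_zero
      rw [abs_one] at h2
      have h3 : √x.1 ≤ 1 := Real.sqrt_le_one.2 (by linarith)
      rw [parSize_of_pos hx0]
      linarith
    -- The contribution of the zero mode is absorbed since `|x| ≤ 3/2` at the times where the cutoff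
    -- leaves something; hence `5/2 = 1 + 3/2`.
    have h2 : 1 + (parSize x)⁻¹ ≤ 5 / 2 * (parSize x)⁻¹ := by
      have : 1 ≤ 3 / 2 * (parSize x)⁻¹ := by
        rw [← div_eq_mul_inv, le_div_iff₀ hp]; linarith
      linarith
    calc C * (1 + (parSize x)⁻¹) ≤ |C| * (5 / 2 * (parSize x)⁻¹) :=
          mul_le_mul (le_abs_self C) h2 (by positivity) (abs_nonneg C)
      _ = _ := by rw [zero_add, pow_one]; ring
  · obtain ⟨C, h⟩ := hQ.derivBound_space hl
    refine ⟨|C|, abs_nonneg C, fun ε hε x hx _ => ?_⟩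
    have hp := parSize_pos hx
    refine (h ε hε x hx (by rw [zero_mul]; exact hp.le)).trans ?_
    rw [mul_zero, zero_add]
    exact mul_le_mul_of_nonneg_right (le_abs_self C) (by positivity)

lemma mixedDeriv_zero_singularPart (Q : ℝ[X]) (ε : ℝ) (l : ℕ) (x : SpaceTime) :
    mixedDeriv 0 l (singularPart Q ε) x = (1 - lateCutoff x.1) * mixedDeriv 0 l (greenP Q ε) x :=
  mixedDeriv_zero_mul (fun t => 1 - lateCutoff t) (greenP Q ε) l x

lemma IsAdmissible.derivBound_space_singularPart (hQ : IsAdmissible Q) (l : ℕ) :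
    DerivBound (singularPart Q) 0 l 0 := by
  obtain ⟨C, hC, h⟩ := hQ.exists_abs_mixedDeriv_early_le l
  refine ⟨C, fun ε hε x hx _ => ?_⟩
  have hp := parSize_pos hx
  rw [mixedDeriv_zero_singularPart, abs_mul, mul_zero, zero_add]
  rcases le_or_gt x.1 (3 / 4) with hx1 | hx1
  · have := h ε hε x hx hx1
    calc _ ≤ 1 * (C * (parSize x ^ (l + 1))⁻¹) := by
          gcongr; exact abs_one_sub_lateCutoff_le _
      _ = _ := one_mul _
  · rw [lateCutoff_of_ge hx1.le, sub_self, abs_zero, zero_mul]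
    positivity

lemma IsAdmissible.derivBound_time_singularPart (hQ : IsAdmissible Q) (l : ℕ) {c : ℝ}
    (hc : 0 < c) : DerivBound (singularPart Q) 1 l c := by
  obtain ⟨C₁, hC₁, h₁⟩ := hQ.exists_abs_mixedDeriv_early_le l
  obtain ⟨C₂, h₂⟩ := hQ.derivBound_time l hc
  obtain ⟨B, hB, hη⟩ := exists_abs_iteratedDeriv_lateCutoff_le 1
  refine ⟨B * (4 * C₁) + |C₂|, fun ε hε x hx hxc => ?_⟩
  have hp := parSize_pos hx
  have e1 : mixedDeriv 1 l (singularPart Q ε) x = -deriv lateCutoff x.1 *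
      mixedDeriv 0 l (greenP Q ε) x + (1 - lateCutoff x.1) * mixedDeriv 1 l (greenP Q ε) x := by
    rw [← deriv_const_sub (1 : ℝ)]
    exact mixedDeriv_one_mul (η := fun t => 1 - lateCutoff t)
      ((differentiableAt_lateCutoff _).const_sub 1) (hQ.differentiableAt_time l hε.1 x.1 x.2 hx)
  have hη' := hη x.1
  rw [iteratedDeriv_one] at hη'
  rw [show 2 * 1 + l + 1 = l + 1 + 2 by ring]
  have h3 : |deriv lateCutoff x.1 * mixedDeriv 0 l (greenP Q ε) x| ≤
      B * (4 * C₁) * (parSize x ^ (l + 1 + 2))⁻¹ := by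
    rcases le_or_gt x.1 (3 / 4) with hx1 | hx1
    · rcases le_or_gt x.1 0 with hx0 | hx0
      · have : deriv lateCutoff x.1 = 0 := by
          have : lateCutoff =ᶠ[nhds x.1] fun _ => 0 := by
            filter_upwards [gt_mem_nhds (show x.1 < 1 / 2 by linarith)] with s hs
              using lateCutoff_of_le hs.le
          rw [this.deriv_eq, deriv_const]
        rw [this, zero_mul, abs_zero]
        positivity
      have h4 : parSize x ≤ 3 / 2 := by
        have h2 := AddCircle.norm_le_half_period (x := x.2) (1 : ℝ) one_ne_zero
        rw [abs_one] at h2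
        have h3 : √x.1 ≤ 1 := Real.sqrt_le_one.2 (by linarith)
        rw [parSize_of_pos hx0]
        linarith
      -- The derivative of the cutoff takes the place of a time derivative, so two powers of `|x|`
      -- are missing; they are bounded by `(3/2)² ≤ 4`.
      have h5 : (parSize x ^ (l + 1))⁻¹ ≤ 4 * (parSize x ^ (l + 1 + 2))⁻¹ := by
        rw [pow_add _ (l + 1), mul_inv, mul_left_comm]
        refine le_mul_of_one_le_right (by positivity) ?_
        rw [← div_eq_mul_inv, le_div_iff₀ (by positivity)]
        nlinarith
      rw [abs_mul]
      calc _ ≤ B * (C₁ * (parSize x ^ (l + 1))⁻¹) := by gcongr; exact h₁ ε hε x hx hx1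
        _ ≤ B * (C₁ * (4 * (parSize x ^ (l + 1 + 2))⁻¹)) := by gcongr
        _ = _ := by ring
    · rw [deriv_lateCutoff_of_gt hx1, zero_mul, abs_zero]
      positivity
  have h4 : |(1 - lateCutoff x.1) * mixedDeriv 1 l (greenP Q ε) x| ≤
      |C₂| * (parSize x ^ (l + 1 + 2))⁻¹ := by
    have h5 := h₂ ε hε x hx hxc
    rw [show 2 * 1 + l + 1 = l + 1 + 2 by ring] at h5
    rw [abs_mul]
    calc _ ≤ 1 * (|C₂| * (parSize x ^ (l + 1 + 2))⁻¹) :=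
          mul_le_mul (abs_one_sub_lateCutoff_le _) (h5.trans (mul_le_mul_of_nonneg_right
            (le_abs_self _) (by positivity))) (abs_nonneg _) zero_le_one
      _ = _ := one_mul _
  rw [e1, add_mul]
  refine (abs_add_le _ _).trans (add_le_add ?_ h4)
  rwa [neg_mul, abs_neg]

lemma IsAdmissible.comparisonBound_singularPart (hQ : IsAdmissible Q) {δ : ℝ}
    (hδ : δ ∈ Set.Ioo (0 : ℝ) 1) : ComparisonBound (singularPart Q) δ := by
  obtain ⟨C, h⟩ := hQ.comparisonBound hδ
  refine ⟨C, fun ε hε x hx => ?_⟩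
  rw [mixedDeriv_zero_singularPart, mixedDeriv_zero_singularPart, ← mul_sub, abs_mul]
  exact (mul_le_of_le_one_left (abs_nonneg _) (abs_one_sub_lateCutoff_le _)).trans (h ε hε x hx)

lemma IsAdmissible.incrementBound_singularPart (hQ : IsAdmissible Q) {δ : ℝ}
    (hδ : δ ∈ Set.Icc (0 : ℝ) 1) : IncrementBound (singularPart Q) δ := by
  refine incrementBound_of_derivBound hδ (hQ.derivBound_space_singularPart 1)
    (hQ.derivBound_space_singularPart 2) (hQ.derivBound_time_singularPart 1 one_half_pos)
    (fun ε hε t y hx => ?_) (fun ε hε t y hx => ?_)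
  · simp only [mixedDeriv_zero_singularPart]
    exact ((differentiableAt_lateCutoff t).const_sub 1).mul
      (hQ.differentiableAt_time 1 hε.1 t y hx)
  · simp only [mixedDeriv_zero_singularPart]
    exact (hQ.differentiableAt_space 1 hε.1 t y hx).const_mul _

end Admissible

/-! ### Smooth functions on space-time -/

lemma isOpenQuotientMap_spaceProj :
    IsOpenQuotientMap fun p : ℝ × ℝ => ((p.1, (p.2 : UnitAddCircle)) : SpaceTime) :=
  IsOpenQuotientMap.id.prodMap QuotientAddGroup.isOpenQuotientMap_mk

/-- `f` vanishes at all times of absolute value larger than `T`. -/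
def TimeSupported (T : ℝ) (f : SpaceTime → ℝ) : Prop := ∀ x : SpaceTime, T < |x.1| → f x = 0

namespace IsSmooth

variable {f g : SpaceTime → ℝ}

lemma continuous (hf : IsSmooth f) : Continuous f := by
  have h : Continuous (spaceLift f) := ContDiff.continuous hf
  exact isOpenQuotientMap_spaceProj.continuous_comp_iff.1 h

lemma hasDerivAt_time_fderiv (hf : IsSmooth f) (t r : ℝ) :
    HasDerivAt (fun s => f (s, (r : UnitAddCircle))) (fderiv ℝ (spaceLift f) (t, r) (1, 0)) t :=
  HasFDerivAt.comp_hasDerivAt (l := spaceLift f) (f := fun s => (s, r)) t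
    (ContDiff.differentiable hf (by simp) (t, r)).hasFDerivAt
    ((hasDerivAt_id t).prodMk (hasDerivAt_const t r))

lemma hasDerivAt_space_fderiv (hf : IsSmooth f) (t r : ℝ) :
    HasDerivAt (fun s : ℝ => f (t, (s : UnitAddCircle)))
      (fderiv ℝ (spaceLift f) (t, r) (0, 1)) r :=
  HasFDerivAt.comp_hasDerivAt (l := spaceLift f) (f := fun s => (t, s)) r
    (ContDiff.differentiable hf (by simp) (t, r)).hasFDerivAt
    ((hasDerivAt_const r t).prodMk (hasDerivAt_id r))

lemma timeDeriv_eq (hf : IsSmooth f) (t r : ℝ) :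
    _root_.timeDeriv f (t, (r : UnitAddCircle)) = fderiv ℝ (spaceLift f) (t, r) (1, 0) :=
  (hf.hasDerivAt_time_fderiv t r).deriv

lemma spaceDeriv_eq (hf : IsSmooth f) (t r : ℝ) :
    _root_.spaceDeriv f (t, (r : UnitAddCircle)) = fderiv ℝ (spaceLift f) (t, r) (0, 1) := by
  have h : HasDerivAt (fun s : ℝ => f (t, (s : UnitAddCircle)))
      (fderiv ℝ (spaceLift f) (t, r) (0, 1)) (r + 0) := by
    rw [add_zero]; exact hf.hasDerivAt_space_fderiv t r
  have h2 := HasDerivAt.comp_const_add r 0 h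
  simp only [AddCircle.coe_add] at h2
  exact h2.deriv

lemma hasDerivAt_time (hf : IsSmooth f) (t : ℝ) (y : UnitAddCircle) :
    HasDerivAt (fun s => f (s, y)) (_root_.timeDeriv f (t, y)) t := by
  obtain ⟨r, rfl, -, -⟩ := exists_real_rep y
  rw [hf.timeDeriv_eq]
  exact hf.hasDerivAt_time_fderiv t r

lemma hasDerivAt_space (hf : IsSmooth f) (t r : ℝ) :
    HasDerivAt (fun s : ℝ => f (t, (s : UnitAddCircle)))
      (_root_.spaceDeriv f (t, (r : UnitAddCircle))) r := by
  rw [hf.spaceDeriv_eq]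
  exact hf.hasDerivAt_space_fderiv t r

lemma timeDeriv (hf : IsSmooth f) : IsSmooth (_root_.timeDeriv f) := by
  have h : ContDiff ℝ ∞ fun z => fderiv ℝ (spaceLift f) z (1, 0) :=
    (ContDiff.fderiv_right (m := ∞) hf (by simp)).clm_apply contDiff_const
  have h2 : spaceLift (_root_.timeDeriv f) = fun z => fderiv ℝ (spaceLift f) z (1, 0) := by
    ext z; exact hf.timeDeriv_eq z.1 z.2
  rw [IsSmooth, h2]
  exact h

lemma spaceDeriv (hf : IsSmooth f) : IsSmooth (_root_.spaceDeriv f) := by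
  have h : ContDiff ℝ ∞ fun z => fderiv ℝ (spaceLift f) z (0, 1) :=
    (ContDiff.fderiv_right (m := ∞) hf (by simp)).clm_apply contDiff_const
  have h2 : spaceLift (_root_.spaceDeriv f) = fun z => fderiv ℝ (spaceLift f) z (0, 1) := by
    ext z; exact hf.spaceDeriv_eq z.1 z.2
  rw [IsSmooth, h2]
  exact h

lemma mixedDeriv_zero (hf : IsSmooth f) (l : ℕ) : IsSmooth (mixedDeriv 0 l f) := by
  induction l with
  | zero => exact hf
  | succ l ih =>
    have : mixedDeriv 0 (l + 1) f = _root_.spaceDeriv (mixedDeriv 0 l f) := by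
      simp only [mixedDeriv, Function.iterate_zero, id, Function.iterate_succ_apply']
    rw [this]
    exact ih.spaceDeriv

end IsSmooth

namespace TimeSupported

variable {T : ℝ} {f : SpaceTime → ℝ}

lemma timeDeriv (hf : TimeSupported T f) : TimeSupported T (_root_.timeDeriv f) := by
  intro x hx
  have : (fun s => f (s, x.2)) =ᶠ[nhds x.1] fun _ => 0 := by
    filter_upwards [(isOpen_lt continuous_const continuous_abs).mem_nhds hx] with s hs
    exact hf (s, x.2) hs
  rw [_root_.timeDeriv, this.deriv_eq, deriv_const]

lemma mixedDeriv_zero (hf : TimeSupported T f) (l : ℕ) : TimeSupported T (mixedDeriv 0 l f) := by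
  induction l with
  | zero => exact hf
  | succ l ih =>
    have : mixedDeriv 0 (l + 1) f = spaceDeriv (mixedDeriv 0 l f) := by
      simp only [mixedDeriv, Function.iterate_zero, id, Function.iterate_succ_apply']
    rw [this]
    intro x hx
    have h : (fun s : ℝ => mixedDeriv 0 l f (x.1, x.2 + (s : UnitAddCircle))) = fun _ => 0 := by
      ext s
      exact ih (x.1, x.2 + (s : UnitAddCircle)) hx
    rw [spaceDeriv, h, deriv_const]

lemma exists_bound (hf : TimeSupported T f) (hc : Continuous f) : ∃ B : ℝ, ∀ x, |f x| ≤ B := by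
  have h : HasCompactSupport f := by
    refine HasCompactSupport.intro (K := Set.Icc (-T) T ×ˢ Set.univ)
      (isCompact_Icc.prod isCompact_univ) fun x hx => hf x ?_
    by_contra h
    exact hx ⟨abs_le.1 (not_lt.1 h), Set.mem_univ _⟩
  exact h.exists_bound_of_continuous hc

end TimeSupported

lemma exists_timeSupported {f : SpaceTime → ℝ} (hf : HasCompactSupport f) :
    ∃ T : ℝ, 0 < T ∧ TimeSupported T f := by
  obtain ⟨R, hR⟩ := hf.isCompact.isBounded.exists_norm_le
  refine ⟨max R 1, by positivity, fun x hx => ?_⟩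
  by_contra h
  have h1 := hR x (subset_tsupport f h)
  have h2 : |x.1| ≤ ‖x‖ := norm_fst_le x
  exact absurd (h2.trans h1) (not_le.2 ((le_max_left _ _).trans_lt hx))

/-! ### Spatial Fourier modes -/

/-- The spatial Fourier modes of a function on space-time. -/
def fourierMode (f : SpaceTime → ℝ) (k : ℤ) (t : ℝ) : ℂ :=
  ∫ y : UnitAddCircle, (f (t, y) : ℂ) * fourier k y

lemma continuous_mode_integrand {f : SpaceTime → ℝ} (hf : Continuous f) (k : ℤ) (t : ℝ) :
    Continuous fun y : UnitAddCircle => (f (t, y) : ℂ) * fourier k y :=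
  (Complex.continuous_ofReal.comp (hf.comp (by fun_prop))).mul (fourier k).continuous

lemma integrable_mode_integrand {f : SpaceTime → ℝ} (hf : Continuous f) (k : ℤ) (t : ℝ) :
    Integrable fun y : UnitAddCircle => (f (t, y) : ℂ) * fourier k y :=
  (continuous_mode_integrand hf k t).integrable_of_hasCompactSupport
    (HasCompactSupport.of_compactSpace _)

lemma norm_fourierMode_le {f : SpaceTime → ℝ} {B : ℝ} (hB : ∀ x, |f x| ≤ B) (k : ℤ) (t : ℝ) :
    ‖fourierMode f k t‖ ≤ B := by
  have h := norm_integral_le_of_norm_le_const (μ := (volume : Measure UnitAddCircle))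
    (f := fun y : UnitAddCircle => (f (t, y) : ℂ) * fourier k y) (C := B)
    (Filter.Eventually.of_forall fun y => by
      rw [norm_mul, norm_fourier_apply, mul_one, Complex.norm_real]
      exact hB (t, y))
  have h1 : (volume : Measure UnitAddCircle).real Set.univ = 1 := by
    simp [Measure.real]
  rwa [h1, mul_one] at h

/-- Integration by parts over one period. The minus sign arises because the pairing is with `fourier
k` and not with its conjugate. -/
lemma fourierMode_spaceDeriv {f : SpaceTime → ℝ} (hf : IsSmooth f) (k : ℤ) (t : ℝ) :
    fourierMode (spaceDeriv f) k t = -(2 * Real.pi * Complex.I * k) * fourierMode f k t := by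
  have h1 := hf.continuous
  have h2 := hf.spaceDeriv.continuous
  rw [fourierMode, fourierMode, ← UnitAddCircle.intervalIntegral_preimage 0,
    ← UnitAddCircle.intervalIntegral_preimage 0, zero_add]
  have hmk : Continuous fun r : ℝ => (r : UnitAddCircle) := AddCircle.continuous_mk' 1
  have hu : ∀ r ∈ Set.uIcc (0 : ℝ) 1, HasDerivAt (fun r : ℝ => (fourier k (r : UnitAddCircle) : ℂ))
      (2 * Real.pi * Complex.I * k * fourier k (r : UnitAddCircle)) r := by
    intro r _
    have := hasDerivAt_fourier 1 k r
    simpa using this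
  have hv : ∀ r ∈ Set.uIcc (0 : ℝ) 1, HasDerivAt
      (fun r : ℝ => ((f (t, (r : UnitAddCircle)) : ℝ) : ℂ))
      ((spaceDeriv f (t, (r : UnitAddCircle)) : ℝ) : ℂ) r := fun r _ =>
    (hf.hasDerivAt_space t r).ofReal_comp
  have hcv : Continuous fun r : ℝ => ((spaceDeriv f (t, (r : UnitAddCircle)) : ℝ) : ℂ) :=
    Complex.continuous_ofReal.comp (h2.comp (continuous_const.prodMk hmk))
  have hcu : Continuous fun r : ℝ =>
      (2 * Real.pi * Complex.I * k * fourier k (r : UnitAddCircle) : ℂ) :=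
    continuous_const.mul ((fourier k).continuous.comp hmk)
  have h := intervalIntegral.integral_mul_deriv_eq_deriv_mul hu hv (hcu.intervalIntegrable _ _)
    (hcv.intervalIntegrable _ _)
  have hone : ((1 : ℝ) : UnitAddCircle) = ((0 : ℝ) : UnitAddCircle) := by
    rw [AddCircle.coe_period, AddCircle.coe_zero]
  rw [hone, sub_self, zero_sub] at h
  simp_rw [mul_comm ((spaceDeriv f _ : ℝ) : ℂ)]
  rw [h, neg_mul, ← intervalIntegral.integral_const_mul]
  congr 2
  ext r
  ring

lemma fourierMode_mixedDeriv_zero {f : SpaceTime → ℝ} (hf : IsSmooth f) (k : ℤ) (t : ℝ) (l : ℕ) :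
    fourierMode (mixedDeriv 0 l f) k t =
      (-(2 * Real.pi * Complex.I * k)) ^ l * fourierMode f k t := by
  induction l with
  | zero => simp [mixedDeriv]
  | succ l ih =>
    have : mixedDeriv 0 (l + 1) f = spaceDeriv (mixedDeriv 0 l f) := by
      simp only [mixedDeriv, Function.iterate_zero, id, Function.iterate_succ_apply']
    rw [this, fourierMode_spaceDeriv (hf.mixedDeriv_zero l), ih]
    ring

/-- Two integrations by parts in space give decay like `k⁻²`, uniformly in time by the compact time
support. -/
lemma exists_norm_fourierMode_le {T : ℝ} {f : SpaceTime → ℝ} (hf : IsSmooth f)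
    (hT : TimeSupported T f) : ∃ u : ℤ → ℝ, Summable u ∧ ∀ k t, ‖fourierMode f k t‖ ≤ u k := by
  obtain ⟨B, hB⟩ := hT.exists_bound hf.continuous
  obtain ⟨B₂, hB₂⟩ := (hT.mixedDeriv_zero 2).exists_bound (hf.mixedDeriv_zero 2).continuous
  have hB0 : 0 ≤ B := (abs_nonneg _).trans (hB 0)
  have hB20 : 0 ≤ B₂ := (abs_nonneg _).trans (hB₂ 0)
  refine ⟨fun k => (if k = 0 then B else 0) + B₂ * (1 / (k : ℝ) ^ 2), ?_, fun k t => ?_⟩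
  · refine Summable.add ?_ ((Real.summable_one_div_int_pow.2 (by norm_num)).mul_left _)
    exact summable_of_ne_finset_zero (s := {0}) fun k hk => if_neg (by simpa using hk)
  · beta_reduce
    split_ifs with hk
    · exact le_add_of_le_of_nonneg (norm_fourierMode_le hB k t) (by positivity)
    · rw [zero_add]
      have h := norm_fourierMode_le hB₂ k t
      rw [fourierMode_mixedDeriv_zero hf, norm_mul, norm_pow, norm_neg] at h
      have hk0 : (0 : ℝ) < |(k : ℝ)| := abs_pos.2 (by exact_mod_cast hk)
      have h2 : |(k : ℝ)| ≤ ‖(2 * Real.pi * Complex.I * k : ℂ)‖ := by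
        rw [norm_mul, norm_mul, norm_mul, Complex.norm_I, Complex.norm_intCast, Complex.norm_real,
          Real.norm_eq_abs, abs_of_pos Real.pi_pos, Complex.norm_ofNat, mul_one]
        refine le_mul_of_one_le_left hk0.le ?_
        linarith [Real.pi_gt_three]
      rw [mul_one_div, le_div_iff₀ (by rw [← sq_abs]; positivity), mul_comm, ← sq_abs]
      refine le_trans ?_ h
      gcongr

lemma hasDerivAt_fourierMode {T : ℝ} {f : SpaceTime → ℝ} (hf : IsSmooth f)
    (hT : TimeSupported T f) (k : ℤ) (t : ℝ) :
    HasDerivAt (fourierMode f k) (fourierMode (timeDeriv f) k t) t := by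
  obtain ⟨B, hB⟩ := hT.timeDeriv.exists_bound hf.timeDeriv.continuous
  refine (hasDerivAt_integral_of_dominated_loc_of_deriv_le (bound := fun _ => B)
    (F := fun t (y : UnitAddCircle) => (f (t, y) : ℂ) * fourier k y)
    (F' := fun t (y : UnitAddCircle) => ((timeDeriv f (t, y) : ℝ) : ℂ) * fourier k y)
    (s := Set.univ) Filter.univ_mem (Filter.Eventually.of_forall fun s =>
      (continuous_mode_integrand hf.continuous k s).aestronglyMeasurable)
    (integrable_mode_integrand hf.continuous k t)
    (continuous_mode_integrand hf.timeDeriv.continuous k t).aestronglyMeasurable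
    (Filter.Eventually.of_forall fun y s _ => ?_) (integrable_const B)
    (Filter.Eventually.of_forall fun y s _ => ?_)).2
  · rw [norm_mul, norm_fourier_apply, mul_one, Complex.norm_real]
    exact hB (s, y)
  · exact ((hf.hasDerivAt_time s y).ofReal_comp).mul_const _

/-- The mode of index `k` is the Fourier coefficient of index `-k`. The Fourier series with summable
coefficients converges pointwise, and at the origin all characters equal `1`. -/
lemma hasSum_fourierMode {T : ℝ} {f : SpaceTime → ℝ} (hf : IsSmooth f) (hT : TimeSupported T f) :
    HasSum (fun k => fourierMode f k 0) (f 0 : ℂ) := by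
  obtain ⟨u, hu, hb⟩ := exists_norm_fourierMode_le hf hT
  have hsum : Summable fun k => fourierMode f k 0 := Summable.of_norm_bounded hu fun k => hb k 0
  let F : C(UnitAddCircle, ℂ) := ⟨fun y => (f (0, y) : ℂ),
    Complex.continuous_ofReal.comp (hf.continuous.comp (by fun_prop))⟩
  have hF : ∀ k, fourierCoeff (F : UnitAddCircle → ℂ) k = fourierMode f (-k) 0 := by
    intro k
    rw [fourierCoeff, AddCircle.integral_haarAddCircle, inv_one, one_smul, fourierMode]
    refine integral_congr_ae (Filter.Eventually.of_forall fun y => ?_)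
    simp only [smul_eq_mul, F, ContinuousMap.coe_mk]
    ring
  have hs : Summable (fourierCoeff (F : UnitAddCircle → ℂ)) := by
    have : fourierCoeff (F : UnitAddCircle → ℂ) = fun k => fourierMode f (-k) 0 := funext hF
    rw [this]
    exact (Equiv.neg ℤ).summable_iff.2 hsum
  have h := has_pointwise_sum_fourier_series_of_summable hs 0
  simp only [hF, fourier_eval_zero, smul_eq_mul, mul_one] at h
  exact (Equiv.neg ℤ).hasSum_iff.1 h

section Admissible

variable {Q : ℝ[X]}

/-! ### Local integrability of the Green's function -/

lemma IsAdmissible.aestronglyMeasurable_greenP (hQ : IsAdmissible Q) {ε : ℝ} (hε : 0 ≤ ε) :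
    AEStronglyMeasurable (greenP Q ε) := by
  have hopen : IsOpen {x : SpaceTime | 0 < x.1} := isOpen_lt continuous_const continuous_fst
  have hind : greenP Q ε = Set.indicator {x : SpaceTime | 0 < x.1} (greenP Q ε) := by
    ext x
    by_cases hx : 0 < x.1
    · rw [Set.indicator_of_mem (show x ∈ {x : SpaceTime | 0 < x.1} from hx)]
    · rw [Set.indicator_of_notMem (show x ∉ {x : SpaceTime | 0 < x.1} from hx)]
      exact if_neg hx
  have hco : ContinuousOn (greenP Q ε) {x : SpaceTime | 0 < x.1} := ?_
  · rw [hind]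
    exact (aestronglyMeasurable_indicator_iff hopen.measurableSet).2
      (hco.aestronglyMeasurable hopen.measurableSet)
  intro x hx
  obtain ⟨z, rfl⟩ := isOpenQuotientMap_spaceProj.surjective x
  refine (isOpenQuotientMap_spaceProj.continuousAt_comp_iff.1 ?_).continuousWithinAt
  refine ((hQ.isSmoothOffOrigin hε).continuousOn).continuousAt
    (isOpen_offOrigin.mem_nhds fun h0 => ?_)
  have h1 : z.1 = 0 := congrArg Prod.fst h0
  exact absurd hx (by simp [h1])

/-- The bound `|x|⁻¹ ≤ t^{-1/2}` gives an integrable majorant in time on a bounded interval, and the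
circle has finite measure. -/
lemma IsAdmissible.integrableOn_greenP (hQ : IsAdmissible Q) {ε : ℝ} (hε : ε ∈ Set.Icc (0 : ℝ) 1)
    {T : ℝ} (hT : 0 ≤ T) :
    IntegrableOn (greenP Q ε) (Set.Icc (-T) T ×ˢ (Set.univ : Set UnitAddCircle)) := by
  obtain ⟨C, hC⟩ := hQ.greenP_bound
  have hg : IntegrableOn (fun t : ℝ => |C| * (1 + t ^ (-(1 / 2) : ℝ))) (Set.Ioc 0 T) := by
    have h1 := (intervalIntegral.intervalIntegrable_rpow' (a := 0) (b := T)
      (r := -(1 / 2)) (by norm_num))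
    rw [intervalIntegrable_iff_integrableOn_Ioc_of_le hT] at h1
    exact ((integrableOn_const (by simp)).add h1).const_mul _
  have hg' : Integrable (fun x : SpaceTime =>
      Set.indicator (Set.Ioc 0 T) (fun t : ℝ => |C| * (1 + t ^ (-(1 / 2) : ℝ))) x.1) := by
    have := (hg.integrable_indicator measurableSet_Ioc).comp_fst
      (volume : Measure UnitAddCircle)
    exact this
  refine Integrable.mono' hg'.integrableOn (hQ.aestronglyMeasurable_greenP hε.1).restrict ?_
  refine (ae_restrict_iff' (measurableSet_Icc.prod MeasurableSet.univ)).2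
    (Filter.Eventually.of_forall fun x hx => ?_)
  rcases le_or_gt x.1 0 with h0 | h0
  · have : greenP Q ε x = 0 := if_neg h0.not_gt
    rw [this, norm_zero]
    refine Set.indicator_nonneg (fun t ht => ?_) _
    have := ht.1
    positivity
  · rw [Set.indicator_of_mem (show x.1 ∈ Set.Ioc 0 T from ⟨h0, hx.1.2⟩), Real.norm_eq_abs]
    have hx0 : x ≠ 0 := fun h => h0.ne' (congrArg Prod.fst h)
    have hp := parSize_pos hx0
    have hs : 0 < √x.1 := Real.sqrt_pos.2 h0
    refine (hC ε hε x hx0).trans ?_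
    have h2 : (parSize x)⁻¹ ≤ x.1 ^ (-(1 / 2) : ℝ) := by
      rw [Real.rpow_neg h0.le, ← Real.sqrt_eq_rpow, parSize_of_pos h0]
      gcongr
      linarith [norm_nonneg x.2]
    have := le_abs_self C
    gcongr

lemma IsAdmissible.locallyIntegrable_greenP (hQ : IsAdmissible Q) {ε : ℝ}
    (hε : ε ∈ Set.Icc (0 : ℝ) 1) : LocallyIntegrable (greenP Q ε) := by
  intro x
  refine ⟨Set.Icc (-(|x.1| + 1)) (|x.1| + 1) ×ˢ Set.univ, ?_,
    hQ.integrableOn_greenP hε (by positivity)⟩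
  refine prod_mem_nhds (Icc_mem_nhds ?_ ?_) Filter.univ_mem
  · linarith [neg_abs_le x.1]
  · linarith [le_abs_self x.1]

/-! ### The operator `L_ε` on Fourier modes -/

lemma fourierMode_const_mul (c : ℝ) (f : SpaceTime → ℝ) (k : ℤ) (t : ℝ) :
    fourierMode (fun x => c * f x) k t = c * fourierMode f k t := by
  simp only [fourierMode]
  rw [← integral_const_mul]
  congr 1
  ext y
  push_cast
  ring

lemma fourierMode_sum {ι : Type*} (s : Finset ι) {f : ι → SpaceTime → ℝ}
    (hf : ∀ i, Continuous (f i)) (k : ℤ) (t : ℝ) :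
    fourierMode (fun x => ∑ i ∈ s, f i x) k t = ∑ i ∈ s, fourierMode (f i) k t := by
  simp only [fourierMode]
  rw [← integral_finsetSum _ fun i _ => integrable_mode_integrand (hf i) k t]
  congr 1
  ext y
  push_cast
  rw [Finset.sum_mul]

lemma fourierMode_neg_sub {f g : SpaceTime → ℝ} (hf : Continuous f) (hg : Continuous g) (k : ℤ)
    (t : ℝ) : fourierMode (fun x => -f x - g x) k t = -fourierMode f k t - fourierMode g k t := by
  simp only [fourierMode]
  rw [← integral_neg, ← integral_sub (f := fun y : UnitAddCircle => -((f (t, y) : ℂ) * fourier k y))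
    (integrable_mode_integrand hf k t).neg (integrable_mode_integrand hg k t)]
  congr 1
  ext y
  push_cast
  ring

lemma opL_eq (Q : ℝ[X]) (ε : ℝ) (f : SpaceTime → ℝ) :
    opL Q ε f = if ε = 0 then mixedDeriv 0 2 f else fun x => -(ε ^ 2)⁻¹ *
      ∑ j ∈ Finset.range (Q.natDegree + 1),
        Q.coeff j * ((Complex.I * (ε : ℂ)) ^ j).re * mixedDeriv 0 j f x := by
  ext x
  rw [opL]
  split_ifs <;> rfl

lemma isSmooth_opL (Q : ℝ[X]) (ε : ℝ) {f : SpaceTime → ℝ} (hf : IsSmooth f) :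
    IsSmooth (opL Q ε f) := by
  rw [opL_eq]
  split_ifs
  · exact hf.mixedDeriv_zero 2
  · exact ContDiff.mul (f := fun _ : ℝ × ℝ => -(ε ^ 2)⁻¹) contDiff_const
      (ContDiff.sum (f := fun j (z : ℝ × ℝ) => Q.coeff j * ((Complex.I * (ε : ℂ)) ^ j).re *
        spaceLift (mixedDeriv 0 j f) z) fun j _ => contDiff_const.mul (hf.mixedDeriv_zero j))

lemma timeSupported_opL (Q : ℝ[X]) (ε : ℝ) {T : ℝ} {f : SpaceTime → ℝ} (hf : TimeSupported T f) :
    TimeSupported T (opL Q ε f) := by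
  intro x hx
  rw [opL]
  split_ifs
  · exact hf.mixedDeriv_zero 2 x hx
  · rw [Finset.sum_eq_zero fun j _ => by rw [hf.mixedDeriv_zero j x hx, mul_zero], mul_zero]

/-- The signs `(-1)^{j/2}` coming from `I ^ j` and `(-I) ^ j` cancel. -/
lemma re_pow_mul_pow_of_even {j : ℕ} (hj : Even j) (ε a : ℝ) :
    ((((Complex.I * (ε : ℂ)) ^ j).re : ℝ) : ℂ) * (-(a * Complex.I)) ^ j = ((ε * a) ^ j : ℝ) := by
  obtain ⟨i, rfl⟩ := hj
  have h1 : (Complex.I * (ε : ℂ)) ^ (i + i) = (((-1) ^ i * ε ^ (i + i) : ℝ) : ℂ) := by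
    rw [mul_pow, ← two_mul, pow_mul, Complex.I_sq]
    push_cast
    ring
  have h2 : (-(a * Complex.I) : ℂ) ^ (i + i) = (((-1) ^ i * a ^ (i + i) : ℝ) : ℂ) := by
    rw [← two_mul, pow_mul, neg_sq, mul_pow, Complex.I_sq, pow_mul]
    push_cast
    rw [← mul_pow]
    ring
  rw [h1, h2, Complex.ofReal_re, ← Complex.ofReal_mul]
  congr 1
  have h3 : ((-1 : ℝ) ^ i) * (-1) ^ i = 1 := by rw [← mul_pow]; simp
  calc _ = ((-1 : ℝ) ^ i * (-1) ^ i) * (ε ^ (i + i) * a ^ (i + i)) := by ring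
    _ = _ := by rw [h3, one_mul, mul_pow]

lemma IsAdmissible.fourierMode_opL (hQ : IsAdmissible Q) (ε : ℝ) {f : SpaceTime → ℝ}
    (hf : IsSmooth f) (k : ℤ) (t : ℝ) :
    fourierMode (opL Q ε f) k t = -(symbolL Q ε k : ℂ) * fourierMode f k t := by
  have hk : ∀ j, (-(2 * Real.pi * Complex.I * k) : ℂ) ^ j =
      (-(((2 * Real.pi * k : ℝ) : ℂ) * Complex.I)) ^ j := by
    intro j; push_cast; ring_nf
  rw [opL_eq, symbolL]
  split_ifs with h
  · rw [fourierMode_mixedDeriv_zero hf]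
    congr 1
    rw [hk, neg_sq, mul_pow, Complex.I_sq]
    push_cast
    ring
  · rw [fourierMode_const_mul, fourierMode_sum _ (f := fun j x => Q.coeff j *
      ((Complex.I * (ε : ℂ)) ^ j).re * mixedDeriv 0 j f x) fun j =>
      continuous_const.mul (hf.mixedDeriv_zero j).continuous]
    simp_rw [fourierMode_const_mul, fourierMode_mixedDeriv_zero hf, ← mul_assoc]
    rw [← Finset.sum_mul, ← mul_assoc]
    congr 1
    have hsum : ∑ j ∈ Finset.range (Q.natDegree + 1),
        ((Q.coeff j * ((Complex.I * (ε : ℂ)) ^ j).re : ℝ) : ℂ) *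
          (-(2 * Real.pi * Complex.I * k)) ^ j = ((Q.eval (2 * Real.pi * ε * k) : ℝ) : ℂ) := by
      rw [eval_eq_sum_range, Complex.ofReal_sum]
      refine Finset.sum_congr rfl fun j _ => ?_
      rcases Nat.even_or_odd j with hj | hj
      · rw [hk, Complex.ofReal_mul, mul_assoc, re_pow_mul_pow_of_even hj, ← Complex.ofReal_mul]
        congr 3
        ring
      · rw [hQ.coeff_odd hj]; simp
    rw [hsum, hQ.even]
    push_cast
    ring

/-! ### The weak equation -/

/-- At fixed `t > 0` the coefficients of the series are absolutely summable, so sum and integral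
over the circle may be exchanged. -/
lemma IsAdmissible.integral_space_greenP_mul (hQ : IsAdmissible Q) {ε : ℝ} (hε : 0 ≤ ε)
    {ψ : SpaceTime → ℝ} (hψ : Continuous ψ) {B : ℝ} (hB : ∀ x, |ψ x| ≤ B) {t : ℝ} (ht : 0 < t) :
    ∫ y : UnitAddCircle, greenP Q ε (t, y) * ψ (t, y) =
      (∑' k : ℤ, (Real.exp (-(symbolL Q ε k * t)) : ℂ) * fourierMode ψ k t).re := by
  obtain ⟨M, hM, hs⟩ := hQ.exists_isSymbol
  have hsum := (hs ε hε).summable hM 1 ht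
  simp only [eval_one, one_mul, ← hQ.symbolL_eq] at hsum
  have hB0 : 0 ≤ B := (abs_nonneg _).trans (hB 0)
  have hint : ∀ k : ℤ, Integrable fun y : UnitAddCircle =>
      (Real.exp (-(symbolL Q ε k * t)) : ℂ) * ((ψ (t, y) : ℂ) * fourier k y) := fun k =>
    (integrable_mode_integrand hψ k t).const_mul _
  have hnorm : ∀ (k : ℤ) (y : UnitAddCircle),
      ‖(Real.exp (-(symbolL Q ε k * t)) : ℂ) * ((ψ (t, y) : ℂ) * fourier k y)‖ ≤
        ‖(Real.exp (-(symbolL Q ε k * t)) : ℂ)‖ * B := by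
    intro k y
    rw [norm_mul, norm_mul, norm_fourier_apply, mul_one, Complex.norm_real (ψ _)]
    gcongr
    exact hB _
  have hvol : (volume : Measure UnitAddCircle).real Set.univ = 1 := by simp [Measure.real]
  have hsn : Summable fun k : ℤ => ∫ y : UnitAddCircle,
      ‖(Real.exp (-(symbolL Q ε k * t)) : ℂ) * ((ψ (t, y) : ℂ) * fourier k y)‖ := by
    refine Summable.of_nonneg_of_le (fun k => integral_nonneg fun y => norm_nonneg _) (fun k => ?_)
      (hsum.norm.mul_right B)
    calc _ ≤ ∫ _ : UnitAddCircle, ‖(Real.exp (-(symbolL Q ε k * t)) : ℂ)‖ * B :=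
          integral_mono (hint k).norm (integrable_const _) (hnorm k)
      _ = _ := by rw [integral_const, hvol, one_smul]
  have h := (hasSum_integral_of_summable_integral_norm hint hsn).tsum_eq
  simp only [integral_const_mul] at h
  have hpt : ∀ y : UnitAddCircle, greenP Q ε (t, y) * ψ (t, y) = Complex.reCLM (∑' k : ℤ,
      (Real.exp (-(symbolL Q ε k * t)) : ℂ) * ((ψ (t, y) : ℂ) * fourier k y)) := by
    intro y
    have e : ∀ k : ℤ, (Real.exp (-(symbolL Q ε k * t)) : ℂ) * ((ψ (t, y) : ℂ) * fourier k y) =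
        (ψ (t, y) : ℂ) * ((Real.exp (-(symbolL Q ε k * t)) : ℂ) * fourier k y) := fun k => by ring
    simp_rw [e, tsum_mul_left]
    rw [Complex.reCLM_apply, Complex.re_ofReal_mul, mul_comm, greenP, if_pos ht]
  simp_rw [hpt]
  rw [ContinuousLinearMap.integral_comp_comm, Complex.reCLM_apply, ← h]
  · rfl
  · refine Integrable.mono' (integrable_const (∑' k : ℤ, ‖(Real.exp (-(symbolL Q ε k * t)) : ℂ)‖ * B))
      (Continuous.aestronglyMeasurable ?_) (Filter.Eventually.of_forall fun y => ?_)
    · exact continuous_tsum (fun k => continuous_const.mul (continuous_mode_integrand hψ k t))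
        (hsum.norm.mul_right B) hnorm
    · exact tsum_of_norm_bounded (hsum.norm.mul_right B).hasSum fun k => hnorm k y

lemma symbolL_nonneg (hQ : IsAdmissible Q) {ε : ℝ} (hε : 0 ≤ ε) (k : ℤ) : 0 ≤ symbolL Q ε k := by
  obtain ⟨M, hM, hs⟩ := hQ.exists_isSymbol
  rw [hQ.symbolL_eq]
  exact (hs ε hε).eval_nonneg hM _

lemma IsAdmissible.weak_eq (hQ : IsAdmissible Q) {ε : ℝ} (hε : ε ∈ Set.Icc (0 : ℝ) 1)
    {φ : SpaceTime → ℝ} (hφ : IsSmooth φ) (hc : HasCompactSupport φ) :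
    ∫ x, greenP Q ε x * (-(timeDeriv φ x) - opL Q ε φ x) = φ 0 := by
  obtain ⟨T, hT, hφT⟩ := exists_timeSupported hc
  set ψ : SpaceTime → ℝ := fun x => -(timeDeriv φ x) - opL Q ε φ x with hψdef
  have hLs := isSmooth_opL Q ε hφ
  have hψs : IsSmooth ψ := ContDiff.sub (ContDiff.neg hφ.timeDeriv) hLs
  have hψT : TimeSupported T ψ := fun x hx => by
    rw [hψdef]
    simp only [hφT.timeDeriv x hx, timeSupported_opL Q ε hφT x hx, neg_zero, sub_zero]
  obtain ⟨B, hB⟩ := hψT.exists_bound hψs.continuous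
  -- In each mode the adjoint operator becomes `-d/dt + q(k)`.
  have hmode : ∀ k t, fourierMode ψ k t =
      -fourierMode (timeDeriv φ) k t + symbolL Q ε k * fourierMode φ k t := by
    intro k t
    rw [hψdef, fourierMode_neg_sub hφ.timeDeriv.continuous hLs.continuous,
      hQ.fourierMode_opL ε hφ]
    ring
  have hintg : Integrable (fun x => greenP Q ε x * ψ x) := by
    have h1 := (hQ.integrableOn_greenP hε hT.le).integrable_indicator
      (measurableSet_Icc.prod MeasurableSet.univ)
    have h2 := h1.bdd_mul hψs.continuous.aestronglyMeasurable (c := B)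
      (Filter.Eventually.of_forall hB)
    refine h2.congr (Filter.Eventually.of_forall fun x => ?_)
    by_cases hx : x ∈ Set.Icc (-T) T ×ˢ (Set.univ : Set UnitAddCircle)
    · simp only [Set.indicator_of_mem hx, mul_comm]
    · have : ψ x = 0 := hψT x (by
        by_contra h
        exact hx ⟨abs_le.1 (not_lt.1 h), Set.mem_univ _⟩)
      simp only [this, zero_mul, mul_zero]
  -- The endpoint is `T + 1` because `φ` is known to vanish only at times strictly larger than `T`,
  -- and its modes must be zero at the upper endpoint.
  have hsupp : ∀ t : ℝ, t ∉ Set.Ioc 0 (T + 1) →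
      ∫ y : UnitAddCircle, greenP Q ε (t, y) * ψ (t, y) = 0 := by
    intro t ht
    rw [← integral_zero UnitAddCircle ℝ (μ := volume)]
    congr 1
    ext y
    rcases le_or_gt t 0 with h0 | h0
    · have : greenP Q ε (t, y) = 0 := if_neg h0.not_gt
      rw [this, zero_mul]
    · have h1 : T + 1 < t := by
        by_contra h
        exact ht ⟨h0, not_lt.1 h⟩
      rw [hψT (t, y) (by simp only [abs_of_pos h0]; linarith), mul_zero]
  have h1 : ∫ x, greenP Q ε x * ψ x =
      ∫ t in Set.Ioc 0 (T + 1), ∫ y : UnitAddCircle, greenP Q ε (t, y) * ψ (t, y) := by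
    rw [setIntegral_eq_integral_of_forall_compl_eq_zero hsupp]
    exact integral_prod _ hintg
  -- Near `t = 0` the exponentials give no summability in `k`; the decay of the modes of the smooth
  -- function `ψ` provides it, and so allows the exchange of sum and time integral.
  obtain ⟨u, hu, hub⟩ := exists_norm_fourierMode_le hψs hψT
  have hdm : ∀ k t, HasDerivAt (fourierMode φ k) (fourierMode (timeDeriv φ) k t) t :=
    hasDerivAt_fourierMode hφ hφT
  have hψc : ∀ k, Continuous (fourierMode ψ k) := fun k =>
    continuous_iff_continuousAt.2 fun t => (hasDerivAt_fourierMode hψs hψT k t).continuousAt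
  have hFc : ∀ k : ℤ, Continuous fun t : ℝ =>
      (Real.exp (-(symbolL Q ε k * t)) : ℂ) * fourierMode ψ k t := fun k =>
    (Complex.continuous_ofReal.comp (by fun_prop)).mul (hψc k)
  have hFn : ∀ (k : ℤ) (t : ℝ), 0 ≤ t →
      ‖(Real.exp (-(symbolL Q ε k * t)) : ℂ) * fourierMode ψ k t‖ ≤ u k := by
    intro k t ht
    rw [norm_mul, Complex.norm_real, Real.norm_eq_abs, Real.abs_exp]
    refine (mul_le_of_le_one_left (norm_nonneg _) ?_).trans (hub k t)
    rw [Real.exp_le_one_iff, neg_nonpos]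
    exact mul_nonneg (symbolL_nonneg hQ hε.1 k) ht
  have hFi : ∀ k : ℤ, IntegrableOn (fun t : ℝ =>
      (Real.exp (-(symbolL Q ε k * t)) : ℂ) * fourierMode ψ k t) (Set.Ioc 0 (T + 1)) := fun k =>
    ((hFc k).integrableOn_Icc).mono_set Set.Ioc_subset_Icc_self
  -- The integrand is the derivative of `-e^{-q(k)t}` times the mode of `φ`, so only the boundary
  -- value at `t = 0` remains.
  have hone : ∀ k : ℤ, ∫ t in Set.Ioc 0 (T + 1),
      (Real.exp (-(symbolL Q ε k * t)) : ℂ) * fourierMode ψ k t = fourierMode φ k 0 := by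
    intro k
    rw [← intervalIntegral.integral_of_le (by linarith : (0 : ℝ) ≤ T + 1)]
    have hd : ∀ t ∈ Set.uIcc (0 : ℝ) (T + 1), HasDerivAt (fun t : ℝ =>
        -((Real.exp (-(symbolL Q ε k * t)) : ℂ) * fourierMode φ k t))
        ((Real.exp (-(symbolL Q ε k * t)) : ℂ) * fourierMode ψ k t) t := by
      intro t _
      have h2 : HasDerivAt (fun s : ℝ => (Real.exp (-(symbolL Q ε k * s)) : ℂ))
          ((Real.exp (-(symbolL Q ε k * t)) * -(symbolL Q ε k * 1) : ℝ) : ℂ) t :=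
        ((((hasDerivAt_id t).const_mul (symbolL Q ε k)).neg).exp).ofReal_comp
      refine ((h2.mul (hdm k t)).neg).congr_deriv ?_
      rw [hmode]
      push_cast
      ring
    rw [intervalIntegral.integral_eq_sub_of_hasDerivAt hd ((hFc k).intervalIntegrable _ _)]
    have hz : fourierMode φ k (T + 1) = 0 := by
      rw [fourierMode, ← integral_zero UnitAddCircle ℂ (μ := volume)]
      congr 1
      ext y
      rw [hφT (T + 1, y) (by simp only [abs_of_pos (by linarith : 0 < T + 1)]; linarith)]
      simp
    rw [hz]
    simp
  have hsn : Summable fun k : ℤ => ∫ t in Set.Ioc 0 (T + 1),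
      ‖(Real.exp (-(symbolL Q ε k * t)) : ℂ) * fourierMode ψ k t‖ := by
    refine Summable.of_nonneg_of_le (fun k => integral_nonneg fun t => norm_nonneg _) (fun k => ?_)
      (hu.mul_left (T + 1))
    calc _ ≤ ∫ _ in Set.Ioc 0 (T + 1), u k :=
          setIntegral_mono_on (hFi k).norm (integrableOn_const (by simp)) measurableSet_Ioc
            fun t ht => hFn k t ht.1.le
      _ = _ := by
        rw [setIntegral_const, smul_eq_mul, Real.volume_real_Ioc_of_le (by linarith), sub_zero]
  have h2 := hasSum_integral_of_summable_integral_norm hFi hsn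
  simp only [hone] at h2
  have h3 := h2.unique (hasSum_fourierMode hφ hφT)
  rw [h1, setIntegral_congr_fun measurableSet_Ioc fun t ht =>
    hQ.integral_space_greenP_mul hε.1 hψs.continuous hB ht.1]
  have h4 : Integrable (fun t : ℝ => ∑' k : ℤ,
      (Real.exp (-(symbolL Q ε k * t)) : ℂ) * fourierMode ψ k t)
      (volume.restrict (Set.Ioc 0 (T + 1))) := by
    refine ContinuousOn.integrableOn_Icc ?_ |>.mono_set Set.Ioc_subset_Icc_self
    exact continuousOn_tsum (fun k => (hFc k).continuousOn) hu fun k t ht => hFn k t ht.1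
  have h5 := Complex.reCLM.integral_comp_comm h4
  rw [h3] at h5
  simpa using h5

lemma IsAdmissible.isGreenFunction (hQ : IsAdmissible Q) {ε : ℝ} (hε : ε ∈ Set.Icc (0 : ℝ) 1) :
    IsGreenFunction (opL Q ε) (greenP Q ε) where
  nonAnticipative := isNonAnticipative_greenP Q ε
  locallyIntegrable := hQ.locallyIntegrable_greenP hε
  weak_eq _ hφ hc := hQ.weak_eq hε hφ hc

end Admissible

end

theorem proposition2p1 (Q : Polynomial ℝ) (hQ : IsAdmissible Q) :
    -- `P_ε` is the Green's function, and it is smooth away from the origin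
    (∀ ε ∈ Set.Icc (0 : ℝ) 1,
      IsGreenFunction (opL Q ε) (greenP Q ε) ∧ IsSmoothOffOrigin (greenP Q ε)) ∧
    -- the bounds for `P_ε`
    (∃ C : ℝ, ∀ ε ∈ Set.Icc (0 : ℝ) 1, ∀ x : SpaceTime, x ≠ 0 →
      |greenP Q ε x| ≤ C * (1 + (parSize x)⁻¹)) ∧
    (∀ l : ℕ, 1 ≤ l → DerivBound (greenP Q) 0 l 0) ∧
    (∀ (l : ℕ) (c : ℝ), 0 < c → DerivBound (greenP Q) 1 l c) ∧
    (∀ δ ∈ Set.Ioo (0 : ℝ) 1, ComparisonBound (greenP Q) δ) ∧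
    (∀ δ ∈ Set.Icc (0 : ℝ) 1, IncrementBound (greenP Q) δ) ∧
    -- the decomposition `P_ε = K_ε + R_ε`
    ∃ K R : ℝ → SpaceTime → ℝ,
      (∀ ε ∈ Set.Icc (0 : ℝ) 1,
        (∀ x : SpaceTime, greenP Q ε x = K ε x + R ε x) ∧
        IsNonAnticipative (K ε) ∧ IsNonAnticipative (R ε) ∧
        IsSpaceSymmetric (K ε) ∧ IsSpaceSymmetric (R ε) ∧
        tsupport (K ε) ⊆ Set.Icc (0 : ℝ) 1 ×ˢ Set.univ ∧
        IsSmoothOffOrigin (K ε) ∧ IsSmooth (R ε)) ∧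
      -- `R_ε` is smooth uniformly in `ε`
      (∀ m l : ℕ, ∃ C : ℝ, ∀ ε ∈ Set.Icc (0 : ℝ) 1, ∀ x : SpaceTime,
        |mixedDeriv m l (R ε) x| ≤ C) ∧
      -- the bounds for `K_ε`
      (∀ l : ℕ, DerivBound K 0 l 0) ∧
      (∀ (l : ℕ) (c : ℝ), 0 < c → DerivBound K 1 l c) ∧
      (∀ δ ∈ Set.Ioo (0 : ℝ) 1, ComparisonBound K δ) ∧
      (∀ δ ∈ Set.Icc (0 : ℝ) 1, IncrementBound K δ) := by
  refine ⟨fun ε hε => ⟨hQ.isGreenFunction hε, hQ.isSmoothOffOrigin hε.1⟩, hQ.greenP_bound,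
    fun l hl => hQ.derivBound_space hl, fun l c hc => hQ.derivBound_time l hc,
    fun δ hδ => hQ.comparisonBound hδ, fun δ hδ => hQ.incrementBound hδ,
    singularPart Q, smoothPart Q, fun ε hε => ⟨fun x => ?_, fun x hx => ?_, fun x hx => ?_,
      fun t y => ?_, fun t y => ?_, tsupport_singularPart_subset Q ε,
      hQ.isSmoothOffOrigin_singularPart hε.1, hQ.isSmooth_smoothPart hε.1⟩,
    hQ.exists_abs_mixedDeriv_smoothPart_le, hQ.derivBound_space_singularPart,
    fun l c hc => hQ.derivBound_time_singularPart l hc,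
    fun δ hδ => hQ.comparisonBound_singularPart hδ,
    fun δ hδ => hQ.incrementBound_singularPart hδ⟩
  · rw [singularPart, smoothPart]; ring
  · rw [singularPart, isNonAnticipative_greenP Q ε x hx, mul_zero]
  · rw [smoothPart, isNonAnticipative_greenP Q ε x hx, mul_zero]
  · simp only [singularPart, isSpaceSymmetric_greenP Q ε t y]
  · simp only [smoothPart, isSpaceSymmetric_greenP Q ε t y]
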